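/- \textbf{Setting.} A finite-horizon layered POMDP has horizon $H$, finite spaces $\mathcal S_h,\mathcal X_h,\mathcal A_h$ of latent states, observations and actions for $h=1,\dots,H$, an initial law $\mathbb P_1$ on $\mathcal S_1$, transitions $\mathbb P_{h}(\cdot\mid s_{h-1},a_{h-1})$ on $\mathcal S_h$, emissions $\mathbb O_h(\cdot\mid s_h)$ on $\mathcal X_h$ and rewards $R_h(s_h,a_h)\in[0,1]$ with $\sum_h R_h(s_h,a_h)\le 1$ almost surely under every policy. Put $S=\max_h|\mathcal S_h|$, $X=\max_h|\mathcal X_h|$, $A=\max_h|\mathcal A_h|$. For a policy $\pi$, $\mathbb P^\pi$ is the law of the trajectory $(s_h,x_h,a_h)_{h\le H}$, $J(\pi)=\mathbb E^\pi[\sum_h R_h(s_h,a_h)]$, and $\mathsf{TV}(P,Q)=\frac12\|P-Q\|_1$. The POMDP is a \emph{$\delta$-perturbed Block MDP} if for every $h$ there are $\widetilde{\mathbb O}_h,E_h:\mathcal S_h\to\Delta(\mathcal X_h)$ with $\mathbb O_h=(1-\delta)\widetilde{\mathbb O}_h+\delta E_h$ such that $\widetilde{\mathbb O}_h(\cdot\mid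 s)$ and $\widetilde{\mathbb O}_h(\cdot\mid s')$ have disjoint supports for all $s\ne s'$. It has \emph{deterministic transitions} if every $\mathbb P_h(\cdot\mid s,a)$ with $2\le h\le H$ is a point mass (the initial law is arbitrary). \textbf{Algorithm.} Let $\pi^{\mathsf{lat}}=(\pi^{\mathsf{lat}}_h:\mathcal S_h\to\Delta(\mathcal A_h))_h$ be a latent policy and $1\le L\le H$. An $L$-step policy at step $h$ is a map $\pi_h$ from windows $\tau_h=(x_{\max(1,h-L+1):h},a_{\max(1,h-L):h-1})$ to $\Delta(\mathcal A_h)$. The modified Forward algorithm with $n$ samples per step does the following for $h=1,\dots,H$: it draws $n$ independent trajectories from the policy that follows $\widehat\pi_1,\dots,\widehat\pi_{h-L-1}$ and plays uniformly random actions from step $\max(1,h-L)$ on; it draws for each of them an expert action $y^i\sim\pi^{\mathsf{lat}}_h(s_h^i)$; and it lets $\widehat\pi_h$ be a maximizer of $\frac1n\sum_{i=1}^n\log\pi_h(y^i\mid\tau_h^i)$ over all $L$-step policies $\pi_h$ at step $h$ (with $\log 0=-\infty$; ties are broken arbitrarily). Its output is $\widehat\pi=(\widehat\pi_h)_{h\le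 H}$. \textbf{Theorem.} There are universal constants $C_0>0$, $C_1>1$, $K>0$ with the following property. Let $\delta,\eta,\epsilon_{\mathsf{opt}}>0$, let the POMDP be a $\delta$-perturbed Block MDP with deterministic transitions, let $\pi^{\mathsf{lat}}$ be any latent policy, let $1\le L\le H$, and let $n$ satisfy $Hn\ge 2$ and \[ n\ \ge\ C_0\,X^LA^{3L+1}H^2\,\epsilon_{\mathsf{opt}}^{-2}\,\log(Hn/\eta). \] Then, for every way of breaking ties, with probability at least $1-\eta$ the output $\widehat\pi$ of the modified Forward algorithm with $n$ samples per step satisfies \[ J(\pi^{\mathsf{lat}})-J(\widehat\pi)\ \le\ \mathsf{TV}(\mathbb P^{\pi^{\mathsf{lat}}},\mathbb P^{\widehat\pi})\ \le\ K\delta+(C_1\delta)^{L/9}SH+\epsilon_{\mathsf{opt}}. \] Moreover, the modified Forward algorithm (with a suitable way of breaking ties) runs in time $\mathrm{poly}(n,H,X^L,A^L)$: there is one program for a unit-cost random access machine (addition, truncated subtraction, random integers, unit-cost steps of interaction with the POMDP and unit-cost queries to $\pi^{\mathsf{lat}}$ at the current latent state) and one polynomial $p$ such that for every POMDP, every $\pi^{\mathsf{lat}}$,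 every $1\le L\le H$ and every $n\ge1$ the program starts exactly $Hn$ episodes, always stops after at most $p(n,H,X^L,A^L)$ steps, and writes a table of a policy $\widehat\pi$ that has exactly the law of the output of the algorithm. -/

import Mathlib

open scoped ENNReal BigOperators

noncomputable section

namespace PerturbedBlock

/-- A finite-horizon layered POMDP with horizon `H`. The layers are indexed by `h = 0, …, H - 1`
(layer `h` here is step `h + 1` in one-based counting), and the finite spaces of layer `h` are
`Fin (nS h)`, `Fin (nX h)`, `Fin (nA h)`. The data at indices `h ≥ H` is never used. -/
structure POMDP where
  /-- the horizon -/
  H : ℕ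
  /-- numbers of latent states, layer by layer -/
  nS : ℕ → ℕ
  /-- numbers of observations -/
  nX : ℕ → ℕ
  /-- numbers of actions -/
  nA : ℕ → ℕ
  nA_pos : ∀ h, 0 < nA h
  /-- law of the first latent state -/
  init : PMF (Fin (nS 0))
  /-- latent transitions from layer `h` to layer `h + 1` -/
  trans : ∀ h, Fin (nS h) → Fin (nA h) → PMF (Fin (nS (h + 1)))
  /-- emission distributions -/
  emit : ∀ h, Fin (nS h) → PMF (Fin (nX h))
  /-- rewards -/
  reward : ∀ h, Fin (nS h) → Fin (nA h) → ℝ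
  reward_nonneg : ∀ h s a, 0 ≤ reward h s a
  reward_le_one : ∀ h s a, reward h s a ≤ 1

namespace POMDP

variable (P : POMDP)

/-- `S`: the largest number of latent states in a layer. -/
def maxS : ℕ := (Finset.range P.H).sup P.nS

/-- `X`: the largest number of observations in a layer. -/
def maxX : ℕ := (Finset.range P.H).sup P.nX

/-- `A`: the largest number of actions in a layer. -/
def maxA : ℕ := (Finset.range P.H).sup P.nA

/-- Trajectories `(s, x, a)` of the first `h` steps. -/
abbrev Traj (h : ℕ) : Type := (k : Fin h) → Fin (P.nS k) × Fin (P.nX k) × Fin (P.nA k)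

/-- Arbitrary policies: the action at step `h` may depend on the whole past (latent states
included), the current latent state and the current observation. -/
abbrev Policy : Type :=
  ∀ h, P.Traj h → Fin (P.nS h) → Fin (P.nX h) → PMF (Fin (P.nA h))

/-- Law of the latent state of step `h` given the steps before it. -/
def nextState : ∀ h, P.Traj h → PMF (Fin (P.nS h))
  | 0, _ => P.init
  | h + 1, τ => P.trans h (τ (Fin.last h)).1 (τ (Fin.last h)).2.2

/-- Law of the first `h` steps of a trajectory when the policy `π` is played. -/
def law (π : P.Policy) : ∀ h, PMF (P.Traj h)
  | 0 => PMF.pure fun k => k.elim0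
  | h + 1 =>
    (law π h).bind fun τ =>
    (P.nextState h τ).bind fun s =>
    (P.emit h s).bind fun x =>
    (π h τ s x).map fun a =>
      Fin.snoc (α := fun k : Fin (h + 1) => Fin (P.nS k) × Fin (P.nX k) × Fin (P.nA k))
        τ (s, x, a)

/-- Total reward of a full trajectory. -/
def totalReward (τ : P.Traj P.H) : ℝ := ∑ k : Fin P.H, P.reward k (τ k).1 (τ k).2.2

/-- Under every policy the total reward is at most `1` almost surely. -/
def NormalizedRewards : Prop :=
  ∀ π : P.Policy, ∀ τ ∈ (P.law π P.H).support, P.totalReward τ ≤ 1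

/-- The value `J(π)`. -/
def value (π : P.Policy) : ℝ := ∑ τ : P.Traj P.H, (P.law π P.H τ).toReal * P.totalReward τ

/-- Total variation distance of the laws of full trajectories `(s, x, a)` under two policies. -/
def tv (π π' : P.Policy) : ℝ :=
  (1 / 2) * ∑ τ : P.Traj P.H, |(P.law π P.H τ).toReal - (P.law π' P.H τ).toReal|

/-- `δ`-perturbed Block MDP. -/
def IsPerturbedBlock (δ : ℝ) : Prop :=
  ∀ h < P.H, ∃ O E : Fin (P.nS h) → PMF (Fin (P.nX h)),
    (∀ s s', s ≠ s' → Disjoint (O s).support (O s').support) ∧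
    ∀ s x, (P.emit h s x).toReal = (1 - δ) * (O s x).toReal + δ * (E s x).toReal

/-- Deterministic latent transitions (the initial state may be random). -/
def DeterministicTransitions : Prop :=
  ∀ h, h + 1 < P.H → ∀ s a, ∃ s', P.trans h s a = PMF.pure s'

/-- Latent (Markovian) policies. -/
abbrev LatentPolicy : Type := ∀ h, Fin (P.nS h) → PMF (Fin (P.nA h))

/-- A latent policy as a policy. -/
def ofLatent (π : P.LatentPolicy) : P.Policy := fun h _ s _ => π h s

/-- Windows that an `L`-step executable policy sees at step `h`: the at most `L` latest
observations (the current one included) and the at most `L` latest actions. The subtractions are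
truncated at `0`. -/
abbrev Window (L h : ℕ) : Type :=
  ((k : Finset.Icc (h + 1 - L) h) → Fin (P.nX k)) × ((k : Finset.Ico (h - L) h) → Fin (P.nA k))

/-- The window at step `h` cut out of an observation history and an action history. -/
def window (L h : ℕ) (x : (k : Fin (h + 1)) → Fin (P.nX k)) (a : (k : Fin h) → Fin (P.nA k)) :
    P.Window L h :=
  (fun k => x ⟨k, Nat.lt_succ_of_le (Finset.mem_Icc.1 k.2).2⟩,
    fun k => a ⟨k, (Finset.mem_Ico.1 k.2).2⟩)

/-- The window at step `h` of a full trajectory. -/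
def windowOf (L : ℕ) {h : ℕ} (hh : h < P.H) (τ : P.Traj P.H) : P.Window L h :=
  P.window L h (fun k => (τ ⟨k, lt_of_lt_of_le k.2 hh⟩).2.1)
    (fun k => (τ ⟨k, k.2.trans hh⟩).2.2)

/-- The component of an `L`-step executable policy at step `h`. -/
abbrev StepPolicy (L h : ℕ) : Type := P.Window L h → PMF (Fin (P.nA h))

/-- `L`-step executable policies for the first `m` steps. -/
abbrev Executable (L m : ℕ) : Type := (k : Fin m) → P.StepPolicy L k

/-- The uniform distribution on the actions of step `h`. -/
def unif (h : ℕ) : PMF (Fin (P.nA h)) :=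
  haveI : Nonempty (Fin (P.nA h)) := ⟨⟨0, P.nA_pos h⟩⟩
  PMF.uniformOfFintype (Fin (P.nA h))

/-- The policy that follows the `L`-step executable policy `π` for the first `j` steps and then
plays uniformly random actions. -/
def follow {L m : ℕ} (j : ℕ) (hj : j ≤ m) (π : P.Executable L m) : P.Policy := fun k τ _ x =>
  if hk : k < j then
    π ⟨k, lt_of_lt_of_le hk hj⟩
      (P.window L k (Fin.snoc (α := fun i : Fin (k + 1) => Fin (P.nX i)) (fun i => (τ i).2.1) x)
        (fun i => (τ i).2.2))
  else P.unif k

/-- An `L`-step executable policy (for all `H` steps) as a policy. -/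
def ofExecutable {L : ℕ} (π : P.Executable L P.H) : P.Policy := P.follow P.H le_rfl π

end POMDP

/-- `n` independent draws from `p`. -/
def iid {α : Type} (p : PMF α) : (n : ℕ) → PMF (Fin n → α)
  | 0 => PMF.pure fun i => i.elim0
  | n + 1 => p.bind fun x => (iid p n).map fun v => Fin.cons x v

namespace POMDP

variable (P : POMDP)

/-- A sample for step `h`: a full trajectory together with an action of the expert. -/
abbrev Sample (h : ℕ) : Type := P.Traj P.H × Fin (P.nA h)

/-- The law of one sample for step `h`: a trajectory of the policy that follows `π` before step
`h - L` and is uniformly random from then on, and an action drawn from the expert at the latent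
state of step `h`. -/
def sampleLaw (e : P.LatentPolicy) {L h : ℕ} (hh : h < P.H) (π : P.Executable L h) :
    PMF (P.Sample h) :=
  (P.law (P.follow (h - L) (Nat.sub_le h L) π) P.H).bind fun τ =>
    (e h (τ ⟨h, hh⟩).1).map fun y => (τ, y)

/-- The empirical log-likelihood `(1/n) ∑ i, log q(yⁱ | windowⁱ)`, with `log 0 = -∞`. -/
def logLik {L n h : ℕ} (hh : h < P.H) (D : Fin n → P.Sample h) (q : P.StepPolicy L h) : EReal :=
  (∑ i, ENNReal.log (q (P.windowOf L hh (D i).1) (D i).2)) / ((n : ℝ) : EReal)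

/-- A (possibly randomized) rule that picks the policy of step `h` from the policies learned so
far and the samples of step `h`. -/
abbrev Rule (L n : ℕ) : Type :=
  ∀ h, h < P.H → P.Executable L h → (Fin n → P.Sample h) → PMF (P.StepPolicy L h)

/-- The rule always picks a maximizer of the empirical log-likelihood over all `L`-step
policies. -/
def IsArgmaxRule {L n : ℕ} (sel : P.Rule L n) : Prop :=
  ∀ h (hh : h < P.H) (π : P.Executable L h) (D : Fin n → P.Sample h),
    ∀ q ∈ (sel h hh π D).support, ∀ q' : P.StepPolicy L h, P.logLik hh D q' ≤ P.logLik hh D q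

/-- The modified Forward algorithm with expert `e`, `n` samples per step and argmax rule `sel`:
the law of the policies it has learned after `h` rounds. -/
def forward (e : P.LatentPolicy) {L n : ℕ} (sel : P.Rule L n) :
    ∀ h, h ≤ P.H → PMF (P.Executable L h)
  | 0, _ => PMF.pure fun k => k.elim0
  | h + 1, hh =>
    (forward e sel h (Nat.le_of_succ_le hh)).bind fun π =>
    (iid (P.sampleLaw e hh π) n).bind fun D =>
    (sel h hh π D).map fun q => Fin.snoc (α := fun k : Fin (h + 1) => P.StepPolicy L k) π q

end POMDP

/-! A unit-cost random access machine with addition and truncated subtraction, presented as a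
structured language. Its memory consists of arrays of natural numbers (array names are literals in
the program text, indices are computed). It can draw random numbers, and it can interact with a
POMDP and query an expert. -/

/-- Arithmetic expressions; `get k e` is the entry `e` of array `k`. -/
inductive Expr : Type
  | lit (v : ℕ)
  | get (k : ℕ) (e : Expr)
  | add (e f : Expr)
  | sub (e f : Expr)

/-- Memory contents: array name, index, value. -/
abbrev Mem : Type := ℕ → ℕ → ℕ

/-- Value of an expression. -/
def Expr.val (m : Mem) : Expr → ℕ
  | lit v => v
  | get k e => m k (e.val m)
  | add e f => e.val m + f.val m
  | sub e f => e.val m - f.val m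

/-- Number of operations in an expression. -/
def Expr.cost : Expr → ℕ
  | lit _ => 1
  | get _ e => e.cost + 1
  | add e f => e.cost + f.cost + 1
  | sub e f => e.cost + f.cost + 1

/-- Programs. In `set`, `rand`, `reset`, `act` and `expert` the first two arguments `k`, `i` say
where the result goes: to the entry `i` of array `k`. -/
inductive Prog : Type
  /-- store the value of `e` -/
  | set (k : ℕ) (i e : Expr)
  /-- run `c`, then `d` -/
  | seq (c d : Prog)
  /-- run `c` if `e ≠ 0`, otherwise `d` -/
  | ite (e : Expr) (c d : Prog)
  /-- run `c` as many times as the value of `e` at the start says -/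
  | loop (e : Expr) (c : Prog)
  /-- store a uniformly random number below the value of `e` (or `0` if that value is `0`) -/
  | rand (k : ℕ) (i e : Expr)
  /-- start a new episode and store its first observation -/
  | reset (k : ℕ) (i : Expr)
  /-- play the action `e` in the current episode and store the next observation -/
  | act (k : ℕ) (i e : Expr)
  /-- store an action that the expert draws at the current latent state -/
  | expert (k : ℕ) (i : Expr)

/-- Machine configurations: memory, current step and latent state of the running episode (hidden
from the program), number of elementary steps so far, number of episodes started so far. -/
structure Config (P : POMDP) where
  mem : Mem
  env : Option (Σ h : ℕ, Fin (P.nS h))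
  time : ℕ
  episodes : ℕ

namespace Config

variable {P : POMDP}

/-- Spend `t` elementary steps. -/
def tick (c : Config P) (t : ℕ) : Config P := { c with time := c.time + t }

/-- Store `v` in the entry `i` of array `k`. -/
def write (c : Config P) (k i v : ℕ) : Config P :=
  { c with mem := fun k' i' => if k' = k ∧ i' = i then v else c.mem k' i' }

end Config

/-- A uniformly random number below `m`, or `0` if `m = 0`. -/
def randBelow : ℕ → PMF ℕ
  | 0 => PMF.pure 0
  | m + 1 => (PMF.uniformOfFintype (Fin (m + 1))).map fun r => (r : ℕ)

/-- Playing action `a` in the environment state `env`: the new environment state and the new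
observation. Nothing happens if no episode is running, if the last step has been reached, or if
`a` is not an action of the current step. -/
def envStep (P : POMDP) (env : Option (Σ h : ℕ, Fin (P.nS h))) (a : ℕ) :
    PMF (Option ((Σ h : ℕ, Fin (P.nS h)) × ℕ)) :=
  match env with
  | none => PMF.pure none
  | some ⟨h, s⟩ =>
    if ha : h + 1 < P.H ∧ a < P.nA h then
      (P.trans h s ⟨a, ha.2⟩).bind fun s' =>
        (P.emit (h + 1) s').map fun x => some (⟨h + 1, s'⟩, (x : ℕ))
    else PMF.pure none

/-- Semantics of programs: the law of the configuration after a run. -/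
def Prog.run (P : POMDP) (e : P.LatentPolicy) : Prog → Config P → PMF (Config P)
  | set k i f, c => PMF.pure ((c.write k (i.val c.mem) (f.val c.mem)).tick (i.cost + f.cost + 1))
  | seq p q, c => (p.run P e c).bind fun c' => q.run P e c'
  | ite f p q, c =>
    if f.val c.mem ≠ 0 then p.run P e (c.tick (f.cost + 1)) else q.run P e (c.tick (f.cost + 1))
  | loop f p, c =>
    (fun μ : PMF (Config P) => μ.bind fun c' => p.run P e (c'.tick 1))^[f.val c.mem]
      (PMF.pure (c.tick (f.cost + 1)))
  | rand k i f, c =>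
    (randBelow (f.val c.mem)).map fun r =>
      (c.write k (i.val c.mem) r).tick (i.cost + f.cost + 1)
  | reset k i, c =>
    P.init.bind fun s => (P.emit 0 s).map fun x =>
      { (c.write k (i.val c.mem) (x : ℕ)).tick (i.cost + 1) with
        env := some ⟨0, s⟩
        episodes := c.episodes + 1 }
  | act k i f, c =>
    (envStep P c.env (f.val c.mem)).map fun o =>
      match o with
      | none => c.tick (i.cost + f.cost + 1)
      | some (env', x) =>
        { (c.write k (i.val c.mem) x).tick (i.cost + f.cost + 1) with env := some env' }
  | expert k i, c =>
    match c.env with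
    | none => PMF.pure (c.tick (i.cost + 1))
    | some ⟨h, s⟩ =>
      (e h s).map fun y => (c.write k (i.val c.mem) (y : ℕ)).tick (i.cost + 1)

/-- The start configuration. Array `0` holds `n, H, L, X, A`, arrays `1` and `2` hold the numbers
of observations and of actions of the `H` layers, and everything else is `0`. -/
def Config.start (P : POMDP) (L n : ℕ) : Config P where
  mem := fun k i =>
    if k = 0 then [n, P.H, L, P.maxX, P.maxA].getD i 0
    else if k = 1 then (if i < P.H then P.nX i else 0)
    else if k = 2 then (if i < P.H then P.nA i else 0)
    else 0
  env := none
  time := 0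
  episodes := 0

/-- The distribution on `Fin m` proportional to given weights; uniform if all weights vanish. -/
def ofWeights {m : ℕ} (hm : 0 < m) (c : Fin m → ℕ) : PMF (Fin m) :=
  haveI : Nonempty (Fin m) := ⟨⟨0, hm⟩⟩
  if hc : ∑' a, (c a : ℝ≥0∞) = 0 then PMF.uniformOfFintype (Fin m)
  else PMF.normalize (fun a => (c a : ℝ≥0∞)) hc
    (by rw [tsum_fintype]; exact ENNReal.sum_ne_top.2 fun a _ => ENNReal.natCast_ne_top _)

/-- Index of the table entry for step `h`, window `w` and action `a`: the observations of the
window are digits in base `X`, the actions are digits in base `A`, the latest one last. -/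
def tableIndex (P : POMDP) {L h : ℕ} (w : P.Window L h) (a : ℕ) : ℕ :=
  ((h * P.maxX ^ L + ∑ k, (w.1 k : ℕ) * P.maxX ^ (h - (k : ℕ))) * P.maxA ^ L
    + ∑ k, (w.2 k : ℕ) * P.maxA ^ (h - 1 - (k : ℕ))) * P.maxA + a

/-- The policy that a final memory stands for: array `3` is a table of weights. -/
def outputPolicy (P : POMDP) (L : ℕ) (m : Mem) : P.Executable L P.H := fun h w =>
  ofWeights (P.nA_pos h) fun a => m 3 (tableIndex P w a)

end PerturbedBlock

end

/-!
Why the theorem is true.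

*Error bound.* The trajectory laws of the expert and of the learned policy differ by at most the sum
over the steps `h` of the expected `ℓ¹` distance between the two action distributions
(`l1_law_le`), and this distance splits into two parts (`expect_step_error_le`).

The first part is a decoding error: how far the posterior of the latent state given the window is
from a point mass. Posteriors are taken for the roll-in policy `f` of step `h`, which is uniform
inside the window, so that only transitions and emissions enter the filter. If the window is full,
the expected sum of the square roots of the odds of all wrong latent states is at most `S` when the
window starts. Deterministic transitions do not increase it, as they only merge states, and every
observation multiplies it by at most `2 √δ`, because the emissions of two distinct states have
Bhattacharyya coefficient at most `2 √δ` (`sum_sqrt_emit_le`, `oddsPotential_succ_le`). This holds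
whatever policy generates the trajectory, so no change of measure is paid for. If `h < L`, the
window is the whole history. Two latent trajectories that end in different states have never met,
so each observation is noise for one of them; hence a wrong decoding needs noise in half of the
`h + 1` observations, which has probability of order `(4 δ) ^ ((h + 1) / 2)`, and the sum over `h`
is `O(δ)` (`le_noiseCount_add`, `short_window_posterior_error_le`).

The second part is a fitting error. Maximizers of the likelihood over all policies of a step are the
conditional frequencies of the sample (`eq_empirical_of_prod_le`), so their error under the roll-in
law is at most twice the `ℓ¹` deviation of the joint frequencies of windows and expert actions
(`sum_abs_sub_le_of_maximal`), which concentrates (`tally_deviation_prob_le`). Passing from the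
roll-in law to the learned policy costs a factor `A ^ L` (`expect_law_le_follow`). A union bound
over the steps gives `value_and_tv_bound`.

*Program.* `forwardProg` stores for each step, window and action how often the action was seen. It
rolls in by sampling from this table, which makes it the Forward algorithm for the rule
`empiricalRule`. Its output law is computed by a coupling: an episode of the machine is coupled with
a draw from `obsLaw`, a round with `n` independent draws, and the whole run with `forward`
(`couples_episodeProg`, `couples_samples`, `couples_rounds`). All its loops are bounded by entries
of the parameter array, so a polynomial time bound and the number of episodes can be read off the
program text (`Prog.run_time_episodes`).
-/

noncomputable section

namespace PerturbedBlock

/-! ### Expectations over finite types -/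

/-- The expectation of a real function on a finite type. -/
def expect {α : Type} [Fintype α] (p : PMF α) (f : α → ℝ) : ℝ := ∑ a, (p a).toReal * f a

section Expect

variable {α β : Type} [Fintype α] [Fintype β]

omit [Fintype β] in
theorem toReal_bind (p : PMF α) (f : α → PMF β) (b : β) :
    (p.bind f b).toReal = ∑ a, (p a).toReal * (f a b).toReal := by
  rw [PMF.bind_apply, tsum_fintype, ENNReal.toReal_sum]
  · simp [ENNReal.toReal_mul]
  · exact fun a _ => ENNReal.mul_ne_top (p.apply_ne_top a) ((f a).apply_ne_top b)

theorem expect_bind (p : PMF α) (f : α → PMF β) (F : β → ℝ) :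
    expect (p.bind f) F = expect p fun a => expect (f a) F := by
  simp only [expect, toReal_bind, Finset.sum_mul, Finset.mul_sum]
  rw [Finset.sum_comm]
  simp [mul_assoc]

theorem expect_pure (a : α) (F : α → ℝ) : expect (PMF.pure a) F = F a := by
  classical
  unfold expect
  rw [Finset.sum_eq_single a]
  · simp [PMF.pure_apply]
  · intro b _ hb
    simp [PMF.pure_apply, hb]
  · simp

theorem expect_map (p : PMF α) (f : α → β) (F : β → ℝ) :
    expect (p.map f) F = expect p fun a => F (f a) := by
  rw [← PMF.bind_pure_comp, expect_bind]
  simp [expect_pure]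

theorem sum_toReal (p : PMF α) : ∑ a, (p a).toReal = 1 := by
  have h := p.tsum_coe
  rw [tsum_fintype] at h
  rw [← ENNReal.toReal_sum fun a _ => p.apply_ne_top a, h, ENNReal.toReal_one]

omit [Fintype α] in
theorem toReal_le_one (p : PMF α) (a : α) : (p a).toReal ≤ 1 := by
  have := ENNReal.toReal_mono ENNReal.one_ne_top (p.coe_le_one a)
  simpa using this

theorem expect_const (p : PMF α) (c : ℝ) : expect p (fun _ => c) = c := by
  rw [expect, ← Finset.sum_mul, sum_toReal, one_mul]

theorem expect_mono_support (p : PMF α) {F G : α → ℝ} (h : ∀ a, 0 < (p a).toReal → F a ≤ G a) :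
    expect p F ≤ expect p G := by
  refine Finset.sum_le_sum fun a _ => ?_
  rcases (ENNReal.toReal_nonneg (a := p a)).lt_or_eq with h0 | h0
  · exact mul_le_mul_of_nonneg_left (h a h0) h0.le
  · simp [← h0]

theorem expect_mono (p : PMF α) {F G : α → ℝ} (h : ∀ a, F a ≤ G a) : expect p F ≤ expect p G :=
  expect_mono_support p fun a _ => h a

theorem expect_congr (p : PMF α) {F G : α → ℝ} (h : ∀ a, F a = G a) : expect p F = expect p G := by
  simp [expect, h]

theorem expect_nonneg (p : PMF α) {F : α → ℝ} (h : ∀ a, 0 ≤ F a) : 0 ≤ expect p F :=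
  Finset.sum_nonneg fun a _ => mul_nonneg ENNReal.toReal_nonneg (h a)

theorem expect_add (p : PMF α) (F G : α → ℝ) :
    expect p (fun a => F a + G a) = expect p F + expect p G := by
  simp [expect, mul_add, Finset.sum_add_distrib]

theorem expect_const_mul (p : PMF α) (c : ℝ) (F : α → ℝ) :
    expect p (fun a => c * F a) = c * expect p F := by
  simp only [expect, Finset.mul_sum]
  exact Finset.sum_congr rfl fun a _ => by ring

theorem expect_mul_const (p : PMF α) (F : α → ℝ) (c : ℝ) :
    expect p (fun a => F a * c) = expect p F * c := by
  simp only [expect, Finset.sum_mul]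
  exact Finset.sum_congr rfl fun a _ => by ring

theorem expect_sum {ι : Type} (s : Finset ι) (p : PMF α) (F : ι → α → ℝ) :
    expect p (fun a => ∑ i ∈ s, F i a) = ∑ i ∈ s, expect p (F i) := by
  simp only [expect, Finset.mul_sum]
  rw [Finset.sum_comm]

theorem expect_ite_eq [DecidableEq α] (p : PMF α) (a : α) :
    expect p (fun b => if b = a then 1 else 0) = (p a).toReal := by
  simp [expect]

theorem expect_single (p : PMF α) (a : α) {F : α → ℝ} (h : ∀ b, b ≠ a → F b = 0) :
    expect p F = (p a).toReal * F a :=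
  Finset.sum_eq_single a (fun b _ hb => by rw [h b hb, mul_zero])
    fun h => absurd (Finset.mem_univ a) h

omit [Fintype α] in
theorem toReal_eq_zero_iff (p : PMF α) (a : α) : (p a).toReal = 0 ↔ a ∉ p.support := by
  rw [ENNReal.toReal_eq_zero_iff]
  simp [p.apply_ne_top a, PMF.mem_support_iff]

omit [Fintype α] in
theorem toReal_pos_iff (p : PMF α) (a : α) : 0 < (p a).toReal ↔ a ∈ p.support := by
  rw [ENNReal.toReal_nonneg.lt_iff_ne', Ne, toReal_eq_zero_iff, not_not]

end Expect

/-! ### Laws of trajectories -/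

namespace POMDP

variable (P : POMDP)

/-- A trajectory of `h` steps followed by one more step. -/
def extend {h : ℕ} (τ : P.Traj h) (s : Fin (P.nS h)) (x : Fin (P.nX h)) (a : Fin (P.nA h)) :
    P.Traj (h + 1) :=
  Fin.snoc (α := fun k : Fin (h + 1) => Fin (P.nS k) × Fin (P.nX k) × Fin (P.nA k)) τ (s, x, a)

variable {P}

theorem extend_last {h : ℕ} (τ : P.Traj h) (s : Fin (P.nS h)) (x : Fin (P.nX h))
    (a : Fin (P.nA h)) : P.extend τ s x a (Fin.last h) = (s, x, a) := by
  simp [extend]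

theorem extend_castSucc {h : ℕ} (τ : P.Traj h) (s : Fin (P.nS h)) (x : Fin (P.nX h))
    (a : Fin (P.nA h)) (k : Fin h) : P.extend τ s x a k.castSucc = τ k := by
  simp [extend]

theorem extend_of_lt {h : ℕ} (τ : P.Traj h) (s : Fin (P.nS h)) (x : Fin (P.nX h))
    (a : Fin (P.nA h)) (k : ℕ) (hk : k < h) :
    P.extend τ s x a ⟨k, hk.trans (Nat.lt_succ_self h)⟩ = τ ⟨k, hk⟩ :=
  extend_castSucc τ s x a ⟨k, hk⟩

theorem exists_eq_extend {h : ℕ} (τ : P.Traj (h + 1)) :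
    ∃ (τ' : P.Traj h) (s : _) (x : _) (a : _), τ = P.extend τ' s x a := by
  refine ⟨fun k => τ k.castSucc, (τ (Fin.last h)).1, (τ (Fin.last h)).2.1,
    (τ (Fin.last h)).2.2, ?_⟩
  exact (Fin.snoc_init_self (α := fun k : Fin (h + 1) =>
    Fin (P.nS k) × Fin (P.nX k) × Fin (P.nA k)) τ).symm

theorem extend_inj {h : ℕ} {τ τ' : P.Traj h} {s s' : Fin (P.nS h)} {x x' : Fin (P.nX h)}
    {a a' : Fin (P.nA h)} :
    P.extend τ s x a = P.extend τ' s' x' a' ↔ τ = τ' ∧ s = s' ∧ x = x' ∧ a = a' := by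
  constructor
  · intro e
    have h1 : τ = τ' := by
      funext k
      have := congrFun e k.castSucc
      rwa [extend_castSucc, extend_castSucc] at this
    have h2 := congrFun e (Fin.last h)
    rw [extend_last, extend_last] at h2
    simpa [h1] using h2
  · rintro ⟨rfl, rfl, rfl, rfl⟩
    rfl

theorem nextState_extend {h : ℕ} (τ : P.Traj h) (s : Fin (P.nS h)) (x : Fin (P.nX h))
    (a : Fin (P.nA h)) : P.nextState (h + 1) (P.extend τ s x a) = P.trans h s a := by
  rw [nextState, extend_last]

theorem law_succ (π : P.Policy) (h : ℕ) :
    P.law π (h + 1) = (P.law π h).bind fun τ => (P.nextState h τ).bind fun s =>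
      (P.emit h s).bind fun x => (π h τ s x).map fun a => P.extend τ s x a := rfl

theorem expect_law_succ (π : P.Policy) (h : ℕ) (F : P.Traj (h + 1) → ℝ) :
    expect (P.law π (h + 1)) F = expect (P.law π h) fun τ => expect (P.nextState h τ) fun s =>
      expect (P.emit h s) fun x => expect (π h τ s x) fun a => F (P.extend τ s x a) := by
  simp only [law_succ, expect_bind, expect_map]

theorem expect_law_zero (π : P.Policy) (F : P.Traj 0 → ℝ) (τ : P.Traj 0) :
    expect (P.law π 0) F = F τ := by
  rw [law, expect_pure]
  congr 1
  funext k
  exact k.elim0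

theorem law_extend_toReal (π : P.Policy) {h : ℕ} (τ : P.Traj h) (s : Fin (P.nS h))
    (x : Fin (P.nX h)) (a : Fin (P.nA h)) :
    (P.law π (h + 1) (P.extend τ s x a)).toReal = (P.law π h τ).toReal *
      ((P.nextState h τ s).toReal * ((P.emit h s x).toReal * (π h τ s x a).toReal)) := by
  classical
  rw [← expect_ite_eq, expect_law_succ]
  simp only [extend_inj]
  have e3 : ∀ τ' s' x', expect (π h τ' s' x') (fun a' =>
      if τ' = τ ∧ s' = s ∧ x' = x ∧ a' = a then (1 : ℝ) else 0) =
        if τ' = τ ∧ s' = s ∧ x' = x then (π h τ s x a).toReal else 0 := by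
    intro τ' s' x'
    rw [expect_single _ a (by simp +contextual)]
    split_ifs with h1 h2 h2
    · obtain ⟨rfl, rfl, rfl, -⟩ := h1
      simp
    · tauto
    · tauto
    · simp
  simp only [e3]
  rw [expect_single _ τ (fun τ' hτ => by simp [hτ, expect_const]),
    expect_single _ s (fun s' hs => by simp [hs, expect_const]),
    expect_single _ x (fun x' hx => by simp [hx])]
  simp

/-- What a policy sees at step `h`, together with the past: the first `h` steps, the latent state
and the observation of step `h`. -/
abbrev Pre (P : POMDP) (h : ℕ) : Type := P.Traj h × Fin (P.nS h) × Fin (P.nX h)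

/-- The law of the first `h` steps, the latent state and the observation of step `h`. -/
def preLaw (P : POMDP) (π : P.Policy) (h : ℕ) : PMF (P.Pre h) :=
  (P.law π h).bind fun τ => (P.nextState h τ).bind fun s => (P.emit h s).map fun x => (τ, s, x)

theorem expect_preLaw (π : P.Policy) (h : ℕ) (F : P.Pre h → ℝ) :
    expect (P.preLaw π h) F = expect (P.law π h) fun τ => expect (P.nextState h τ) fun s =>
      expect (P.emit h s) fun x => F (τ, s, x) := by
  simp only [preLaw, expect_bind, expect_map]

theorem law_succ_eq_preLaw (π : P.Policy) (h : ℕ) :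
    P.law π (h + 1) = (P.preLaw π h).bind fun z => (π h z.1 z.2.1 z.2.2).map fun a =>
      P.extend z.1 z.2.1 z.2.2 a := by
  simp only [law_succ, preLaw, PMF.bind_bind, PMF.bind_map, Function.comp_def]

/-- The part of a longer trajectory that is visible at step `h`. -/
def cut {h k : ℕ} (hk : h < k) (τ : P.Traj k) : P.Pre h :=
  (fun i => τ ⟨i, i.2.trans hk⟩, (τ ⟨h, hk⟩).1, (τ ⟨h, hk⟩).2.1)

/-- Playing on does not change the law of the past. -/
theorem map_cut_law (π : P.Policy) {h k : ℕ} (hk : h < k) :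
    (P.law π k).map (cut hk) = P.preLaw π h := by
  induction k, hk using Nat.le_induction with
  | base =>
    rw [law_succ_eq_preLaw, PMF.map_bind]
    have : ∀ z : P.Pre h, ((π h z.1 z.2.1 z.2.2).map fun a =>
        P.extend z.1 z.2.1 z.2.2 a).map (cut (Nat.lt_succ_self h)) = PMF.pure z := by
      intro z
      rw [PMF.map_comp]
      have : (cut (Nat.lt_succ_self h) ∘ fun a => P.extend z.1 z.2.1 z.2.2 a)
          = Function.const _ z := by
        funext a
        refine Prod.ext ?_ ?_
        · funext i
          exact extend_of_lt _ _ _ _ _ i.2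
        · have := extend_last z.1 z.2.1 z.2.2 a
          simp only [Function.comp_apply, cut, Function.const_apply]
          change ((P.extend z.1 z.2.1 z.2.2 a (Fin.last h)).1,
            (P.extend z.1 z.2.1 z.2.2 a (Fin.last h)).2.1) = _
          rw [this]
          rfl
      rw [this, PMF.map_const]
    simp only [this, PMF.bind_pure]
  | succ k hk ih =>
    rw [← ih, law_succ]
    simp only [PMF.map_bind, PMF.map_comp]
    rw [← PMF.bind_pure_comp]
    congr 1
    funext τ
    have : ∀ s x a, cut (Nat.lt_of_lt_of_le hk (Nat.le_succ k)) (P.extend τ s x a) = cut hk τ := by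
      intro s x a
      have e : ∀ i (hi : i < k), P.extend τ s x a ⟨i, hi.trans (Nat.lt_succ_self k)⟩ = τ ⟨i, hi⟩ :=
        fun i hi => extend_of_lt _ _ _ _ _ hi
      refine Prod.ext ?_ ?_
      · funext i
        exact e i (i.2.trans hk)
      · simp only [cut]
        rw [e h hk]
    have e2 : ∀ s x, (cut (Nat.lt_of_lt_of_le hk (Nat.le_succ k)) ∘ fun a => P.extend τ s x a)
        = Function.const _ (cut hk τ) := by
      intro s x
      funext a
      exact this s x a
    simp only [Nat.succ_eq_add_one] at e2 ⊢
    simp only [e2, PMF.map_const, PMF.bind_const, Function.comp]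

/-! ### Windows and samples -/

/-- The window at step `h` of a history. -/
def preWindow (L : ℕ) {h : ℕ} (z : P.Pre h) : P.Window L h :=
  P.window L h (Fin.snoc (α := fun i : Fin (h + 1) => Fin (P.nX i)) (fun i => (z.1 i).2.1) z.2.2)
    (fun i => (z.1 i).2.2)

theorem follow_of_lt {L m j : ℕ} (hj : j ≤ m) (π : P.Executable L m) {k : ℕ} (hk : k < j)
    (z : P.Pre k) : P.follow j hj π k z.1 z.2.1 z.2.2 = π ⟨k, hk.trans_le hj⟩ (preWindow L z) := by
  simp [follow, hk, preWindow]

theorem follow_of_not_lt {L m j : ℕ} (hj : j ≤ m) (π : P.Executable L m) {k : ℕ} (hk : ¬ k < j)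
    (z : P.Pre k) : P.follow j hj π k z.1 z.2.1 z.2.2 = P.unif k := by
  simp [follow, hk]

theorem windowOf_eq (L : ℕ) {h : ℕ} (hh : h < P.H) (τ : P.Traj P.H) :
    P.windowOf L hh τ = preWindow L (cut hh τ) := by
  unfold windowOf preWindow
  congr 1
  funext k
  refine Fin.lastCases ?_ (fun i => ?_) k
  · simp [cut]
  · simp [cut]

/-- Agreement of two trajectories in all observations from step `a` on and in all actions from
step `b` on. -/
def Agree (a b : ℕ) {k : ℕ} (τ τ' : P.Traj k) : Prop :=
  ∀ i : Fin k, (a ≤ i → (τ i).2.1 = (τ' i).2.1) ∧ (b ≤ i → (τ i).2.2 = (τ' i).2.2)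

theorem agree_refl (a b : ℕ) {k : ℕ} (τ : P.Traj k) : Agree a b τ τ :=
  fun _ => ⟨fun _ => rfl, fun _ => rfl⟩

theorem Agree.symm {a b k : ℕ} {τ τ' : P.Traj k} (h : Agree a b τ τ') : Agree a b τ' τ :=
  fun i => ⟨fun hi => ((h i).1 hi).symm, fun hi => ((h i).2 hi).symm⟩

theorem agree_extend {a b k : ℕ} {τ τ' : P.Traj k} {s s' : Fin (P.nS k)} {x x' : Fin (P.nX k)}
    {y y' : Fin (P.nA k)} : Agree a b (P.extend τ s x y) (P.extend τ' s' x' y') ↔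
      Agree a b τ τ' ∧ (a ≤ k → x = x') ∧ (b ≤ k → y = y') := by
  unfold Agree
  rw [Fin.forall_fin_succ']
  simp only [extend_castSucc, extend_last]
  simp

theorem agree_of_le {a b k : ℕ} (ha : k ≤ a) (hb : k ≤ b) (τ τ' : P.Traj k) : Agree a b τ τ' :=
  fun i => ⟨fun h => absurd i.2 (not_lt.2 (ha.trans h)),
    fun h => absurd i.2 (not_lt.2 (hb.trans h))⟩

/-- Two histories have the same window exactly if they agree from its start on. The hypothesis
`1 ≤ L` puts the current observation into the window. -/
theorem preWindow_eq_iff {L h : ℕ} (hL : 1 ≤ L) {z z' : P.Pre h} :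
    preWindow L z = preWindow L z' ↔
      Agree (h + 1 - L) (h - L) z.1 z'.1 ∧ z.2.2 = z'.2.2 := by
  obtain ⟨τ, s, x⟩ := z
  obtain ⟨τ', s', x'⟩ := z'
  simp only [preWindow, window, Prod.mk.injEq]
  constructor
  · rintro ⟨h1, h2⟩
    have h1' : ∀ k (hk : k ∈ Finset.Icc (h + 1 - L) h), _ := fun k hk => congrFun h1 ⟨k, hk⟩
    have h2' : ∀ k (hk : k ∈ Finset.Ico (h - L) h), _ := fun k hk => congrFun h2 ⟨k, hk⟩
    refine ⟨fun i => ⟨fun hi => ?_, fun hi => ?_⟩, ?_⟩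
    · have e := h1' i (Finset.mem_Icc.2 ⟨hi, i.2.le⟩)
      have e1 := Fin.snoc_castSucc (α := fun i : Fin (h + 1) => Fin (P.nX i)) x
        (fun i => (τ i).2.1) i
      have e2 := Fin.snoc_castSucc (α := fun i : Fin (h + 1) => Fin (P.nX i)) x'
        (fun i => (τ' i).2.1) i
      exact e1.symm.trans (e.trans e2)
    · exact h2' i (Finset.mem_Ico.2 ⟨hi, i.2⟩)
    · have e := h1' h (Finset.mem_Icc.2 ⟨by omega, le_rfl⟩)
      have e1 := Fin.snoc_last (α := fun i : Fin (h + 1) => Fin (P.nX i)) x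
        (fun i => (τ i).2.1)
      have e2 := Fin.snoc_last (α := fun i : Fin (h + 1) => Fin (P.nX i)) x'
        (fun i => (τ' i).2.1)
      exact e1.symm.trans (e.trans e2)
  · rintro ⟨h1, rfl⟩
    refine ⟨?_, ?_⟩
    · funext ⟨k, hk⟩
      rcases (Finset.mem_Icc.1 hk).2.lt_or_eq with hlt | rfl
      · have e1 := Fin.snoc_castSucc (α := fun i : Fin (h + 1) => Fin (P.nX i)) x
          (fun i => (τ i).2.1) ⟨k, hlt⟩
        have e2 := Fin.snoc_castSucc (α := fun i : Fin (h + 1) => Fin (P.nX i)) x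
          (fun i => (τ' i).2.1) ⟨k, hlt⟩
        exact e1.trans (((h1 ⟨k, hlt⟩).1 (Finset.mem_Icc.1 hk).1).trans e2.symm)
      · have e1 := Fin.snoc_last (α := fun i : Fin (k + 1) => Fin (P.nX i)) x
          (fun i => (τ i).2.1)
        have e2 := Fin.snoc_last (α := fun i : Fin (k + 1) => Fin (P.nX i)) x
          (fun i => (τ' i).2.1)
        exact e1.trans e2.symm
    · funext ⟨k, hk⟩
      exact (h1 ⟨k, (Finset.mem_Ico.1 hk).2⟩).2 (Finset.mem_Ico.1 hk).1

/-- The law of the window at step `h` and of the expert action when `π` is played. -/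
def obsLaw (P : POMDP) (e : P.LatentPolicy) (L h : ℕ) (π : P.Policy) :
    PMF (P.Window L h × Fin (P.nA h)) :=
  (P.preLaw π h).bind fun z => (e h z.2.1).map fun y => (preWindow L z, y)

/-- The part of a sample that the learner looks at. -/
def visible (L : ℕ) {h : ℕ} (hh : h < P.H) (d : P.Sample h) : P.Window L h × Fin (P.nA h) :=
  (P.windowOf L hh d.1, d.2)

/-- A sample is a full trajectory, but its window and expert action only depend on the steps up to
`h`. -/
theorem map_visible_sampleLaw (e : P.LatentPolicy) {L h : ℕ} (hh : h < P.H)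
    (π : P.Executable L h) : (P.sampleLaw e hh π).map (visible L hh) =
      P.obsLaw e L h (P.follow (h - L) (Nat.sub_le h L) π) := by
  rw [obsLaw, ← map_cut_law _ hh, PMF.bind_map, sampleLaw, PMF.map_bind]
  congr 1
  funext τ
  rw [PMF.map_comp]
  simp only [Function.comp_def, visible, windowOf_eq]
  rfl

theorem expect_obsLaw (e : P.LatentPolicy) (L h : ℕ) (π : P.Policy)
    (F : P.Window L h × Fin (P.nA h) → ℝ) : expect (P.obsLaw e L h π) F =
      expect (P.preLaw π h) fun z => expect (e h z.2.1) fun y => F (preWindow L z, y) := by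
  simp only [obsLaw, expect_bind, expect_map]

end POMDP

theorem map_iid {α β : Type} (p : PMF α) (f : α → β) (n : ℕ) :
    (iid p n).map (fun v i => f (v i)) = iid (p.map f) n := by
  induction n with
  | zero =>
    simp only [iid, PMF.pure_map]
    congr 1
    funext i
    exact i.elim0
  | succ n ih =>
    simp only [iid, PMF.map_bind, PMF.bind_map, Function.comp_def, ← ih, PMF.map_comp]
    congr 1
    funext x
    congr 1
    funext v i
    refine Fin.cases ?_ (fun j => ?_) i <;> simp

/-! ### Values and total variation distances -/

/-- The `ℓ¹` distance of two laws on a finite type (twice their total variation distance). -/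
def l1 {α : Type} [Fintype α] (p q : PMF α) : ℝ := ∑ a, |(p a).toReal - (q a).toReal|

theorem l1_le_two {α : Type} [Fintype α] (p q : PMF α) : l1 p q ≤ 2 := by
  calc l1 p q ≤ ∑ a, ((p a).toReal + (q a).toReal) := by
        refine Finset.sum_le_sum fun a _ => ?_
        refine (abs_sub _ _).trans ?_
        rw [abs_of_nonneg ENNReal.toReal_nonneg, abs_of_nonneg ENNReal.toReal_nonneg]
    _ = 2 := by rw [Finset.sum_add_distrib, sum_toReal, sum_toReal]; norm_num

namespace POMDP

variable {P : POMDP}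

theorem tv_eq_l1 (π π' : P.Policy) : P.tv π π' = (1 / 2) * l1 (P.law π P.H) (P.law π' P.H) := rfl

theorem tv_le_one (π π' : P.Policy) : P.tv π π' ≤ 1 := by
  rw [tv_eq_l1]
  linarith [l1_le_two (P.law π P.H) (P.law π' P.H)]

theorem totalReward_nonneg (τ : P.Traj P.H) : 0 ≤ P.totalReward τ :=
  Finset.sum_nonneg fun _ _ => P.reward_nonneg _ _ _

/-- As the total reward has values in `[0, 1]` on the supports, values differ by at most the total
variation distance. -/
theorem value_sub_le_tv (hP : P.NormalizedRewards) (π π' : P.Policy) :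
    P.value π - P.value π' ≤ P.tv π π' := by
  set p := fun τ => (P.law π P.H τ).toReal
  set q := fun τ => (P.law π' P.H τ).toReal
  have h0 : ∑ τ, (p τ - q τ) = 0 := by
    rw [Finset.sum_sub_distrib, sum_toReal, sum_toReal, sub_self]
  have h1 : ∀ τ, p τ * P.totalReward τ - q τ * P.totalReward τ ≤
      1 / 2 * |p τ - q τ| + 1 / 2 * (p τ - q τ) := by
    intro τ
    have hR := totalReward_nonneg τ
    have hq : 0 ≤ q τ := ENNReal.toReal_nonneg
    rcases le_or_gt (p τ) (q τ) with hle | hlt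
    · rw [abs_of_nonpos (sub_nonpos.2 hle)]
      nlinarith
    · rw [abs_of_pos (sub_pos.2 hlt)]
      have : P.totalReward τ ≤ 1 := hP π τ ((toReal_pos_iff _ _).1 (hq.trans_lt hlt))
      nlinarith
  calc P.value π - P.value π' = ∑ τ, (p τ * P.totalReward τ - q τ * P.totalReward τ) := by
        rw [Finset.sum_sub_distrib]; rfl
    _ ≤ ∑ τ, (1 / 2 * |p τ - q τ| + 1 / 2 * (p τ - q τ)) := Finset.sum_le_sum fun τ _ => h1 τ
    _ = P.tv π π' := by
        rw [Finset.sum_add_distrib, ← Finset.mul_sum, ← Finset.mul_sum, h0]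
        simp [tv, p, q]

theorem sum_traj_succ {h : ℕ} (F : P.Traj (h + 1) → ℝ) :
    ∑ τ, F τ = ∑ τ : P.Traj h, ∑ s, ∑ x, ∑ a, F (P.extend τ s x a) := by
  have hb : Function.Bijective (fun z : P.Traj h × Fin (P.nS h) × Fin (P.nX h) × Fin (P.nA h) =>
      P.extend z.1 z.2.1 z.2.2.1 z.2.2.2) := by
    refine ⟨fun z z' e => ?_, fun τ => ?_⟩
    · obtain ⟨h1, h2, h3, h4⟩ := extend_inj.1 e
      exact Prod.ext h1 (Prod.ext h2 (Prod.ext h3 h4))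
    · obtain ⟨τ', s, x, a, rfl⟩ := exists_eq_extend τ
      exact ⟨(τ', s, x, a), rfl⟩
  rw [← hb.sum_comp]
  simp only [Fintype.sum_prod_type]

/-- One step of the hybrid argument: transitions and emissions are the same for both policies, so
only the decision rules add to the distance. -/
theorem l1_law_succ_le (π π' : P.Policy) (h : ℕ) :
    l1 (P.law π (h + 1)) (P.law π' (h + 1)) ≤ l1 (P.law π h) (P.law π' h) +
      expect (P.preLaw π' h) fun z => l1 (π h z.1 z.2.1 z.2.2) (π' h z.1 z.2.1 z.2.2) := by
  rw [expect_preLaw]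
  set p := fun τ => (P.law π h τ).toReal
  set q := fun τ => (P.law π' h τ).toReal
  have h1 : ∀ τ, ∑ s, ∑ x, ∑ a, |(P.law π (h + 1) (P.extend τ s x a)).toReal
      - (P.law π' (h + 1) (P.extend τ s x a)).toReal| ≤
      |p τ - q τ| + q τ * expect (P.nextState h τ) fun s => expect (P.emit h s) fun x =>
        l1 (π h τ s x) (π' h τ s x) := by
    intro τ
    have h2 : |p τ - q τ| = expect (P.nextState h τ) fun s => expect (P.emit h s) fun _ =>
        |p τ - q τ| := by simp only [expect_const]
    rw [h2, ← expect_const_mul, ← expect_add]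
    refine Finset.sum_le_sum fun s _ => ?_
    beta_reduce
    rw [← expect_const_mul, ← expect_add]
    unfold expect
    rw [Finset.mul_sum]
    refine Finset.sum_le_sum fun x _ => ?_
    set u := (P.nextState h τ s).toReal
    set v := (P.emit h s x).toReal
    have hu : 0 ≤ u := ENNReal.toReal_nonneg
    have hv : 0 ≤ v := ENNReal.toReal_nonneg
    have hq : 0 ≤ q τ := ENNReal.toReal_nonneg
    calc ∑ a, |(P.law π (h + 1) (P.extend τ s x a)).toReal
          - (P.law π' (h + 1) (P.extend τ s x a)).toReal|
        ≤ ∑ a, (u * v * (|p τ - q τ| * (π h τ s x a).toReal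
            + q τ * |(π h τ s x a).toReal - (π' h τ s x a).toReal|)) := by
          refine Finset.sum_le_sum fun a _ => ?_
          rw [law_extend_toReal, law_extend_toReal]
          have : p τ * (u * (v * (π h τ s x a).toReal)) - q τ * (u * (v * (π' h τ s x a).toReal))
              = u * v * ((p τ - q τ) * (π h τ s x a).toReal
                + q τ * ((π h τ s x a).toReal - (π' h τ s x a).toReal)) := by ring
          change |p τ * (u * (v * (π h τ s x a).toReal))
            - q τ * (u * (v * (π' h τ s x a).toReal))| ≤ _
          rw [this, abs_mul, abs_of_nonneg (mul_nonneg hu hv)]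
          refine mul_le_mul_of_nonneg_left ((abs_add_le _ _).trans ?_) (mul_nonneg hu hv)
          rw [abs_mul, abs_mul, abs_of_nonneg hq,
            abs_of_nonneg (ENNReal.toReal_nonneg (a := π h τ s x a))]
      _ = u * (v * (|p τ - q τ| + q τ * l1 (π h τ s x) (π' h τ s x))) := by
          rw [← Finset.mul_sum, Finset.sum_add_distrib, ← Finset.mul_sum, ← Finset.mul_sum,
            sum_toReal, l1]
          ring
  calc l1 (P.law π (h + 1)) (P.law π' (h + 1))
      ≤ ∑ τ, (|p τ - q τ| + q τ * expect (P.nextState h τ) fun s => expect (P.emit h s) fun x =>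
        l1 (π h τ s x) (π' h τ s x)) := by
        rw [l1, sum_traj_succ]
        exact Finset.sum_le_sum fun τ _ => h1 τ
    _ = _ := by
        rw [Finset.sum_add_distrib]
        rfl

/-- The laws of trajectories differ by at most the expected differences of the decision rules. -/
theorem l1_law_le (π π' : P.Policy) (m : ℕ) :
    l1 (P.law π m) (P.law π' m) ≤ ∑ h ∈ Finset.range m,
      expect (P.preLaw π' h) fun z => l1 (π h z.1 z.2.1 z.2.2) (π' h z.1 z.2.1 z.2.2) := by
  induction m with
  | zero => simp [law, l1]
  | succ m ih =>
    rw [Finset.sum_range_succ]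
    exact (l1_law_succ_le π π' m).trans (add_le_add ih le_rfl)

/-! ### Comparison with the roll-in policy -/

theorem nA_le_maxA {h : ℕ} (hh : h < P.H) : P.nA h ≤ P.maxA :=
  Finset.le_sup (f := P.nA) (Finset.mem_range.2 hh)

theorem nX_le_maxX {h : ℕ} (hh : h < P.H) : P.nX h ≤ P.maxX :=
  Finset.le_sup (f := P.nX) (Finset.mem_range.2 hh)

theorem nS_le_maxS {h : ℕ} (hh : h < P.H) : P.nS h ≤ P.maxS :=
  Finset.le_sup (f := P.nS) (Finset.mem_range.2 hh)

theorem one_le_maxA (hH : 0 < P.H) : 1 ≤ P.maxA := (P.nA_pos 0).trans_le (nA_le_maxA hH)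

theorem one_le_maxX (hH : 0 < P.H) : 1 ≤ P.maxX := by
  obtain ⟨s, -⟩ := P.init.support_nonempty
  obtain ⟨x, -⟩ := (P.emit 0 s).support_nonempty
  exact (Nat.zero_lt_of_lt x.2).trans_le (nX_le_maxX hH)

theorem unif_toReal (h : ℕ) (a : Fin (P.nA h)) : (P.unif h a).toReal = (P.nA h : ℝ)⁻¹ := by
  simp [unif, PMF.uniformOfFintype_apply]

theorem expect_le_mul_expect_unif {h : ℕ} (hh : h < P.H) (p : PMF (Fin (P.nA h)))
    {F : Fin (P.nA h) → ℝ} (hF : ∀ a, 0 ≤ F a) :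
    expect p F ≤ P.maxA * expect (P.unif h) F := by
  unfold expect
  rw [Finset.mul_sum]
  refine Finset.sum_le_sum fun a _ => ?_
  rw [unif_toReal, ← mul_assoc]
  refine mul_le_mul_of_nonneg_right ((toReal_le_one p a).trans ?_) (hF a)
  have h1 : (0 : ℝ) < P.nA h := by exact_mod_cast P.nA_pos h
  have h2 : (P.nA h : ℝ) ≤ P.maxA := by exact_mod_cast nA_le_maxA hh
  rw [← div_eq_mul_inv, le_div_iff₀ h1]
  linarith

/-- Uniform exploration from step `j` on costs a factor `A` per step. -/
theorem expect_law_le_follow {L m : ℕ} (π : P.Executable L m) {i j : ℕ} (hi : i ≤ m) (hj : j ≤ i)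
    {k : ℕ} (hk : k ≤ P.H) (F : P.Traj k → ℝ) (hF : ∀ τ, 0 ≤ F τ) :
    expect (P.law (P.follow i hi π) k) F ≤
      (P.maxA : ℝ) ^ (k - j) * expect (P.law (P.follow j (hj.trans hi) π) k) F := by
  induction k with
  | zero => simp [expect_law_zero _ _ (fun k => k.elim0 : P.Traj 0)]
  | succ k ih =>
    rw [expect_law_succ, expect_law_succ]
    refine (ih (Nat.le_of_succ_le hk) _ fun τ => expect_nonneg _ fun s => expect_nonneg _ fun x =>
      expect_nonneg _ fun a => hF _).trans ?_
    rcases lt_or_ge k j with hkj | hkj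
    · rw [Nat.sub_eq_zero_of_le hkj.le, Nat.sub_eq_zero_of_le hkj, pow_zero, one_mul, one_mul]
      refine expect_mono _ fun τ => expect_mono _ fun s => expect_mono _ fun x => ?_
      rw [follow_of_lt hi π (hkj.trans_le hj) (τ, s, x),
        follow_of_lt (hj.trans hi) π hkj (τ, s, x)]
    · rw [Nat.sub_add_comm hkj, pow_succ, mul_assoc]
      refine mul_le_mul_of_nonneg_left ?_ (by positivity)
      rw [← expect_const_mul]
      refine expect_mono _ fun τ => ?_
      rw [← expect_const_mul]
      refine expect_mono _ fun s => ?_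
      rw [← expect_const_mul]
      refine expect_mono _ fun x => ?_
      rw [follow_of_not_lt (hj.trans hi) π (not_lt.2 hkj) (τ, s, x)]
      exact expect_le_mul_expect_unif hk _ fun a => hF _

theorem expect_preLaw_le_follow {L m : ℕ} (π : P.Executable L m) {i j : ℕ} (hi : i ≤ m)
    (hj : j ≤ i) {k : ℕ} (hk : k ≤ P.H) (F : P.Pre k → ℝ) (hF : ∀ z, 0 ≤ F z) :
    expect (P.preLaw (P.follow i hi π) k) F ≤
      (P.maxA : ℝ) ^ (k - j) * expect (P.preLaw (P.follow j (hj.trans hi) π) k) F := by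
  rw [expect_preLaw, expect_preLaw]
  exact expect_law_le_follow π hi hj hk _ fun τ => expect_nonneg _ fun s => expect_nonneg _
    fun x => hF _

theorem law_follow_eq {L m : ℕ} (π : P.Executable L m) {i j : ℕ} (hi : i ≤ m) (hj : j ≤ i)
    {k : ℕ} (hk : k ≤ j) :
    P.law (P.follow i hi π) k = P.law (P.follow j (hj.trans hi) π) k := by
  induction k with
  | zero => rfl
  | succ k ih =>
    rw [law_succ, law_succ, ih (Nat.le_of_succ_le hk)]
    congr 1
    funext τ
    congr 1
    funext s
    congr 1
    funext x
    rw [follow_of_lt hi π (hk.trans hj) (τ, s, x), follow_of_lt (hj.trans hi) π hk (τ, s, x)]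

end POMDP

namespace POMDP

variable {P : POMDP}

/-! ### Emissions of distinct states -/

/-- The Bhattacharyya coefficient of the emissions of two distinct latent states is at most
`2 √δ`: at each observation one of the two emission probabilities consists of noise only. -/
theorem sum_sqrt_emit_le {δ : ℝ} (hδ : 0 ≤ δ) (hP : P.IsPerturbedBlock δ) {h : ℕ} (hh : h < P.H)
    {s t : Fin (P.nS h)} (hst : s ≠ t) :
    ∑ x, √((P.emit h s x).toReal * (P.emit h t x).toReal) ≤ 2 * √δ := by
  obtain ⟨O, E, hd, hO⟩ := hP h hh
  have key : ∀ x, √((P.emit h s x).toReal * (P.emit h t x).toReal) ≤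
      √δ * (((E s x).toReal + (P.emit h t x).toReal) / 2
        + ((P.emit h s x).toReal + (E t x).toReal) / 2) := by
    intro x
    have n1 : 0 ≤ (E s x).toReal := ENNReal.toReal_nonneg
    have n2 : 0 ≤ (E t x).toReal := ENNReal.toReal_nonneg
    have n3 : 0 ≤ (P.emit h s x).toReal := ENNReal.toReal_nonneg
    have n4 : 0 ≤ (P.emit h t x).toReal := ENNReal.toReal_nonneg
    have amgm : ∀ u v : ℝ, 0 ≤ u → 0 ≤ v → √(u * v) ≤ (u + v) / 2 := by
      intro u v hu hv
      rw [Real.sqrt_le_left (by positivity)]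
      nlinarith [sq_nonneg (u - v)]
    by_cases hx : x ∈ (O s).support
    · have ht : (O t x).toReal = 0 :=
        (toReal_eq_zero_iff _ _).2 fun h' => Set.disjoint_left.1 (hd s t hst) hx h'
      have e : (P.emit h t x).toReal = δ * (E t x).toReal := by rw [hO, ht]; ring
      have : (P.emit h s x).toReal * (P.emit h t x).toReal =
          δ * ((P.emit h s x).toReal * (E t x).toReal) := by rw [e]; ring
      rw [this, Real.sqrt_mul hδ]
      refine mul_le_mul_of_nonneg_left ((amgm _ _ n3 n2).trans ?_) (Real.sqrt_nonneg _)
      linarith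
    · have ht : (O s x).toReal = 0 := (toReal_eq_zero_iff _ _).2 hx
      have e : (P.emit h s x).toReal = δ * (E s x).toReal := by rw [hO, ht]; ring
      have : (P.emit h s x).toReal * (P.emit h t x).toReal =
          δ * ((E s x).toReal * (P.emit h t x).toReal) := by rw [e]; ring
      rw [this, Real.sqrt_mul hδ]
      refine mul_le_mul_of_nonneg_left ((amgm _ _ n1 n4).trans ?_) (Real.sqrt_nonneg _)
      linarith
  refine (Finset.sum_le_sum fun x _ => key x).trans (le_of_eq ?_)
  rw [← Finset.mul_sum, Finset.sum_add_distrib, ← Finset.sum_div, ← Finset.sum_div,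
    Finset.sum_add_distrib, Finset.sum_add_distrib, sum_toReal, sum_toReal, sum_toReal, sum_toReal]
  ring

theorem expect_sqrt_emit_le {δ : ℝ} (hδ : 0 ≤ δ) (hP : P.IsPerturbedBlock δ) {h : ℕ} (hh : h < P.H)
    {s t : Fin (P.nS h)} (hst : s ≠ t) :
    expect (P.emit h s) (fun x => √((P.emit h t x).toReal / (P.emit h s x).toReal)) ≤ 2 * √δ := by
  refine le_trans (Finset.sum_le_sum fun x _ => ?_) (sum_sqrt_emit_le hδ hP hh hst)
  set p := (P.emit h s x).toReal
  set q := (P.emit h t x).toReal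
  have hp : 0 ≤ p := ENNReal.toReal_nonneg
  rcases hp.eq_or_lt with h0 | h0
  · simp [← h0]
  · -- under the law `p` the mean of `√(q / p)` is the sum of `√(p q)`
    have : p * q = p ^ 2 * (q / p) := by field_simp
    rw [this, Real.sqrt_mul (by positivity), Real.sqrt_sq hp]

/-! ### Filtering with a window -/

open Classical in
/-- The probability that a trajectory of the policy `f` agrees with `τ` in the observations from
step `a` on and the actions from step `b` on, and that the next latent state is `s`. As a function
of `s` this is an unnormalized belief. -/
def belief (f : P.Policy) (a b : ℕ) {k : ℕ} (τ : P.Traj k) (s : Fin (P.nS k)) : ℝ :=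
  expect (P.law f k) fun τ' => if Agree a b τ τ' then (P.nextState k τ' s).toReal else 0

theorem belief_nonneg (f : P.Policy) (a b : ℕ) {k : ℕ} (τ : P.Traj k) (s : Fin (P.nS k)) :
    0 ≤ belief f a b τ s := by
  refine expect_nonneg _ fun τ' => ?_
  split_ifs
  · exact ENNReal.toReal_nonneg
  · exact le_rfl

theorem mul_le_belief (f : P.Policy) (a b : ℕ) {k : ℕ} (τ : P.Traj k) (s : Fin (P.nS k)) :
    (P.law f k τ).toReal * (P.nextState k τ s).toReal ≤ belief f a b τ s := by
  classical
  unfold belief expect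
  have := Finset.single_le_sum (f := fun τ' => (P.law f k τ').toReal *
    (if Agree a b τ τ' then (P.nextState k τ' s).toReal else 0)) (s := Finset.univ) (fun τ' _ => by
      split_ifs
      · exact mul_nonneg ENNReal.toReal_nonneg ENNReal.toReal_nonneg
      · simp) (Finset.mem_univ τ)
  simpa [agree_refl] using this

open Classical in
/-- One step of the filter, for a policy that explores uniformly at step `k`: the action contributes
a constant factor, the observation a likelihood (if it is inside the window), and the deterministic
transition `g` pushes the weights forward. -/
theorem belief_extend {f : P.Policy} {a b k : ℕ} (hb : b ≤ k)
    (hf : ∀ τ s x, f k τ s x = P.unif k)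
    {g : Fin (P.nS k) → Fin (P.nA k) → Fin (P.nS (k + 1))}
    (hg : ∀ s y, P.trans k s y = PMF.pure (g s y)) (τ : P.Traj k) (s : Fin (P.nS k))
    (x : Fin (P.nX k)) (y : Fin (P.nA k)) (s' : Fin (P.nS (k + 1))) :
    belief f a b (P.extend τ s x y) s' = (P.nA k : ℝ)⁻¹ * ∑ t, if g t y = s' then
      belief f a b τ t * (if a ≤ k then (P.emit k t x).toReal else 1) else 0 := by
  have inner : ∀ τ' t, (expect (P.emit k t) fun x' => expect (P.unif k) fun y' =>
      if Agree a b (P.extend τ s x y) (P.extend τ' t x' y') then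
        (P.nextState (k + 1) (P.extend τ' t x' y') s').toReal else 0) =
      (if Agree a b τ τ' then 1 else 0) * ((P.nA k : ℝ)⁻¹ * (if g t y = s' then
        (if a ≤ k then (P.emit k t x).toReal else 1) else 0)) := by
    intro τ' t
    simp only [agree_extend, nextState_extend, hg, hb, true_imp_iff]
    have e1 : ∀ x', (expect (P.unif k) fun y' => if Agree a b τ τ' ∧ (a ≤ k → x = x') ∧ y = y' then
        (PMF.pure (g t y') s').toReal else 0) = (P.nA k : ℝ)⁻¹ *
          if Agree a b τ τ' ∧ (a ≤ k → x = x') then if g t y = s' then 1 else 0 else 0 := by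
      intro x'
      rw [expect_single _ y fun y' hy => by simp [Ne.symm hy], unif_toReal]
      congr 1
      simp only [and_true, PMF.pure_apply, eq_comm (a := s')]
      split_ifs <;> simp
    simp only [e1]
    rw [expect_const_mul]
    by_cases hA : Agree a b τ τ' <;> by_cases hgs : g t y = s' <;> by_cases ha : a ≤ k <;>
      simp [hA, hgs, ha, expect_const]
    left
    rw [← expect_ite_eq]
    exact expect_congr _ fun x' => by simp [eq_comm]
  rw [belief, expect_law_succ]
  simp only [hf, inner]
  rw [Finset.mul_sum]
  simp only [expect, Finset.mul_sum]
  rw [Finset.sum_comm]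
  refine Finset.sum_congr rfl fun t _ => ?_
  by_cases hgs : g t y = s'
  · simp only [hgs, if_true, belief, expect]
    rw [Finset.sum_mul, Finset.mul_sum]
    refine Finset.sum_congr rfl fun τ' _ => ?_
    split_ifs <;> ring
  · simp [hgs]

theorem sqrt_sum_le {ι : Type} (s : Finset ι) (f : ι → ℝ) (hf : ∀ i, 0 ≤ f i) :
    √(∑ i ∈ s, f i) ≤ ∑ i ∈ s, √(f i) := by
  classical
  induction s using Finset.induction_on with
  | empty => simp
  | insert i s hi ih =>
    rw [Finset.sum_insert hi, Finset.sum_insert hi]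
    refine le_trans ?_ (add_le_add le_rfl ih)
    have h1 := Finset.sum_nonneg fun j (_ : j ∈ s) => hf j
    rw [Real.sqrt_le_left (by positivity)]
    nlinarith [Real.sq_sqrt (hf i), Real.sq_sqrt h1, Real.sqrt_nonneg (f i),
      Real.sqrt_nonneg (∑ j ∈ s, f j),
      mul_nonneg (Real.sqrt_nonneg (f i)) (Real.sqrt_nonneg (∑ j ∈ s, f j))]

/-- Pushing weights forward along a map does not increase the sum of the square roots of the odds
against the true state. -/
theorem sum_sqrt_odds_pushforward_le {S S' : Type} [Fintype S] [Fintype S'] [DecidableEq S]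
    [DecidableEq S'] (w : S → ℝ) (hw : ∀ t, 0 ≤ w t) (g : S → S') {c : ℝ} (hc : 0 < c) (s : S)
    (hs : 0 < w s) (w' : S' → ℝ) (hw' : ∀ s', w' s' = c * ∑ t, if g t = s' then w t else 0) :
    (∑ s', if s' = g s then 0 else √(w' s' / w' (g s))) ≤
      ∑ t, if t = s then 0 else √(w t / w s) := by
  have h1 : c * w s ≤ w' (g s) := by
    rw [hw']
    refine mul_le_mul_of_nonneg_left ?_ hc.le
    have := Finset.single_le_sum (f := fun t => if g t = g s then w t else 0)
      (s := Finset.univ) (fun t _ => by split_ifs <;> simp [hw]) (Finset.mem_univ s)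
    simpa using this
  have h2 : ∀ s', (if s' = g s then 0 else √(w' s' / w' (g s))) ≤
      ∑ t, if g t = s' then (if t = s then 0 else √(w t / w s)) else 0 := by
    intro s'
    split_ifs with hs'
    · exact Finset.sum_nonneg fun t _ => by split_ifs <;> simp [Real.sqrt_nonneg]
    · have hpos : 0 < c * w s := mul_pos hc hs
      have h3 : w' s' / w' (g s) ≤ ∑ t, if g t = s' then w t / w s else 0 := by
        have h3n : 0 ≤ w' s' := by
          rw [hw']
          exact mul_nonneg hc.le (Finset.sum_nonneg fun t _ => by split_ifs <;> simp [hw])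
        refine (div_le_div_of_nonneg_left h3n hpos h1).trans (le_of_eq ?_)
        rw [hw', mul_div_mul_left _ _ hc.ne', Finset.sum_div]
        exact Finset.sum_congr rfl fun t _ => by split_ifs <;> simp
      refine (Real.sqrt_le_sqrt h3).trans ((sqrt_sum_le _ _ fun t => ?_).trans ?_)
      · split_ifs
        · exact div_nonneg (hw t) hs.le
        · exact le_rfl
      · refine Finset.sum_le_sum fun t _ => ?_
        by_cases ht : g t = s'
        · have : t ≠ s := fun e => hs' (by rw [← ht, e])
          simp [ht, this]
        · simp [ht]
  refine (Finset.sum_le_sum fun s' _ => h2 s').trans (le_of_eq ?_)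
  rw [Finset.sum_comm]
  exact Finset.sum_congr rfl fun t _ => by simp

/-- The potential that controls the filter: the expected sum of the square roots of the odds of
all wrong latent states against the true one. -/
def oddsPotential (π f : P.Policy) (a b k : ℕ) : ℝ :=
  expect (P.law π k) fun τ => expect (P.nextState k τ) fun s =>
    ∑ t, if t = s then 0 else √(belief f a b τ t / belief f a b τ s)

theorem sum_odds_emit_le {δ : ℝ} (hδ : 0 ≤ δ) (hP : P.IsPerturbedBlock δ) {k : ℕ} (hk : k < P.H)
    (w : Fin (P.nS k) → ℝ) (hw : ∀ t, 0 ≤ w t) (s : Fin (P.nS k)) :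
    (expect (P.emit k s) fun x => ∑ t, if t = s then 0 else
      √(w t * (P.emit k t x).toReal / (w s * (P.emit k s x).toReal))) ≤
      2 * √δ * ∑ t, if t = s then 0 else √(w t / w s) := by
  rw [expect_sum, Finset.mul_sum]
  refine Finset.sum_le_sum fun t _ => ?_
  by_cases hts : t = s
  · simp [hts, expect_const]
  · simp only [hts, if_false]
    have : ∀ x, √(w t * (P.emit k t x).toReal / (w s * (P.emit k s x).toReal)) =
        √(w t / w s) * √((P.emit k t x).toReal / (P.emit k s x).toReal) := by
      intro x
      rw [← Real.sqrt_mul (div_nonneg (hw t) (hw s)), div_mul_div_comm]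
    simp only [this]
    rw [expect_const_mul, mul_comm]
    exact mul_le_mul_of_nonneg_right (expect_sqrt_emit_le hδ hP hk (Ne.symm hts))
      (Real.sqrt_nonneg _)

theorem belief_pos {π f : P.Policy} {k : ℕ}
    (hdom : ∀ τ, 0 < (P.law π k τ).toReal → 0 < (P.law f k τ).toReal) (a b : ℕ) {τ : P.Traj k}
    {s : Fin (P.nS k)} (hτ : 0 < (P.law π k τ).toReal) (hs : 0 < (P.nextState k τ s).toReal) :
    0 < belief f a b τ s :=
  (mul_pos (hdom τ hτ) hs).trans_le (mul_le_belief f a b τ s)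

/-- Each observation inside the window contracts the potential by `2 √δ`, whatever the policy
`π` that generates the trajectory does. -/
theorem oddsPotential_succ_le {δ : ℝ} (hδ : 0 ≤ δ) (hP : P.IsPerturbedBlock δ)
    (hD : P.DeterministicTransitions) {π f : P.Policy} {a b k : ℕ} (hb : b ≤ k) (hk : k + 1 < P.H)
    (hf : ∀ τ s x, f k τ s x = P.unif k)
    (hdom : ∀ τ, 0 < (P.law π k τ).toReal → 0 < (P.law f k τ).toReal) :
    oddsPotential π f a b (k + 1) ≤
      (if a ≤ k then 2 * √δ else 1) * oddsPotential π f a b k := by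
  classical
  choose g hg using hD k hk
  unfold oddsPotential
  rw [expect_law_succ, ← expect_const_mul]
  refine expect_mono_support _ fun τ hτ => ?_
  rw [← expect_const_mul]
  refine expect_mono_support _ fun s hs => ?_
  have hB := belief_pos hdom a b hτ hs
  have hnA : (0 : ℝ) < (P.nA k : ℝ)⁻¹ := inv_pos.2 (by exact_mod_cast P.nA_pos k)
  set w : Fin (P.nX k) → Fin (P.nS k) → ℝ := fun x t =>
    belief f a b τ t * (if a ≤ k then (P.emit k t x).toReal else 1) with hwdef
  have step : ∀ x, 0 < (P.emit k s x).toReal → (expect (π k τ s x) fun y =>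
      expect (P.nextState (k + 1) (P.extend τ s x y)) fun s' => ∑ t, if t = s' then 0 else
        √(belief f a b (P.extend τ s x y) t / belief f a b (P.extend τ s x y) s')) ≤
      ∑ t, if t = s then 0 else √(w x t / w x s) := by
    intro x hx
    rw [← expect_const (π k τ s x) (∑ t, if t = s then 0 else √(w x t / w x s))]
    refine expect_mono _ fun y => ?_
    rw [nextState_extend, hg, expect_pure]
    refine sum_sqrt_odds_pushforward_le (w x) (fun t => ?_) (fun t => g t y) hnA s ?_ _
      fun s' => belief_extend hb hf hg τ s x y s'
    · refine mul_nonneg (belief_nonneg f a b τ t) ?_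
      split_ifs
      · exact ENNReal.toReal_nonneg
      · exact zero_le_one
    · refine mul_pos hB ?_
      split_ifs
      · exact hx
      · exact one_pos
  refine (expect_mono_support _ step).trans ?_
  by_cases ha : a ≤ k
  · simp only [hwdef, ha, if_true]
    exact sum_odds_emit_le hδ hP (Nat.lt_of_succ_lt hk) _ (belief_nonneg f a b τ) s
  · simp only [hwdef, ha, if_false, mul_one, one_mul, expect_const]
    exact le_rfl

/-- Before any information is used, the potential is at most the number of states. -/
theorem oddsPotential_base_le {π f : P.Policy} {a b : ℕ} (hab : b ≤ a)
    (hlaw : P.law π b = P.law f b) (hb : b < P.H) :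
    oddsPotential π f a b b ≤ P.maxS := by
  classical
  set μ : Fin (P.nS b) → ℝ := fun s => expect (P.law f b) fun τ => (P.nextState b τ s).toReal
  have hμ0 : ∀ s, 0 ≤ μ s := fun s => expect_nonneg _ fun _ => ENNReal.toReal_nonneg
  have hB : ∀ (τ : P.Traj b) s, belief f a b τ s = μ s := by
    intro τ s
    simp [belief, agree_of_le hab le_rfl, μ]
  have hμ : ∑ s, μ s = 1 := by
    rw [← expect_sum]
    simp [sum_toReal, expect_const]
  unfold oddsPotential
  simp only [hB, hlaw]
  set c : Fin (P.nS b) → ℝ := fun s => ∑ t, if t = s then 0 else √(μ t / μ s)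
  calc (expect (P.law f b) fun τ => expect (P.nextState b τ) c) = ∑ s, μ s * c s := by
        simp only [μ]
        simp_rw [← expect_mul_const]
        rw [← expect_sum]
        rfl
    _ ≤ ∑ s, ∑ t, √(μ s) * √(μ t) := by
        refine Finset.sum_le_sum fun s _ => ?_
        rw [Finset.mul_sum]
        refine Finset.sum_le_sum fun t _ => ?_
        split_ifs
        · rw [mul_zero]
          positivity
        · rw [Real.sqrt_div (hμ0 t)]
          rcases (hμ0 s).eq_or_lt with h0 | h0
          · simp [← h0]
          · have := Real.sqrt_pos.2 h0
            refine le_of_eq ?_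
            nth_rewrite 1 [← Real.mul_self_sqrt (hμ0 s)]
            field_simp
    _ = (∑ s, √(μ s)) ^ 2 := by rw [sq, Finset.sum_mul_sum]
    _ ≤ (P.nS b : ℝ) * ∑ s, √(μ s) ^ 2 := by
        have := sq_sum_le_card_mul_sum_sq (s := Finset.univ) (f := fun s => √(μ s))
        simpa using this
    _ = P.nS b := by
        simp_rw [Real.sq_sqrt (hμ0 _)]
        rw [hμ, mul_one]
    _ ≤ P.maxS := by exact_mod_cast nS_le_maxS hb

/-- The window that starts at step `b` contains the action of step `b`, but not its observation; so
the first contraction happens at step `b + 1`. -/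
theorem oddsPotential_le {δ : ℝ} (hδ : 0 ≤ δ) (hP : P.IsPerturbedBlock δ)
    (hD : P.DeterministicTransitions) {π f : P.Policy} {b h : ℕ} (hh : h < P.H)
    (hf : ∀ k, b ≤ k → ∀ τ s x, f k τ s x = P.unif k)
    (hdom : ∀ k ≤ h, ∀ τ, 0 < (P.law π k τ).toReal → 0 < (P.law f k τ).toReal)
    (hlaw : P.law π b = P.law f b) {k : ℕ} (hbk : b ≤ k) (hk : k ≤ h) :
    oddsPotential π f (b + 1) b k ≤ (2 * √δ) ^ (k - (b + 1)) * P.maxS := by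
  induction k, hbk using Nat.le_induction with
  | base => simpa using oddsPotential_base_le (Nat.le_succ b) hlaw (hk.trans_lt hh)
  | succ k hbk ih =>
    refine (oddsPotential_succ_le hδ hP hD hbk (hk.trans_lt hh) (hf k hbk)
      (hdom k (Nat.le_of_succ_le hk))).trans ?_
    have ih := ih (Nat.le_of_succ_le hk)
    split_ifs with hbk'
    · rw [Nat.sub_add_comm hbk', pow_succ', mul_assoc (2 * √δ)]
      exact mul_le_mul_of_nonneg_left ih (by positivity)
    · rw [one_mul]
      have : k - (b + 1) = k + 1 - (b + 1) := by omega
      rwa [← this]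

/-- The weight of the latent state `s` given the part of the history that is inside the window. -/
def score (f : P.Policy) (a b : ℕ) {k : ℕ} (z : P.Pre k) (s : Fin (P.nS k)) : ℝ :=
  belief f a b z.1 s * (P.emit k s z.2.2).toReal

theorem score_nonneg (f : P.Policy) (a b : ℕ) {k : ℕ} (z : P.Pre k) (s : Fin (P.nS k)) :
    0 ≤ score f a b z s := mul_nonneg (belief_nonneg _ _ _ _ _) ENNReal.toReal_nonneg

/-- The error of a posterior is at most the sum of the square roots of the odds. -/
theorem one_sub_div_sum_le {S : Type} [Fintype S] [DecidableEq S] (w : S → ℝ) (hw : ∀ t, 0 ≤ w t)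
    (s : S) (hs : 0 < w s) : 1 - w s / ∑ t, w t ≤ ∑ t, if t = s then 0 else √(w t / w s) := by
  have hsum : w s ≤ ∑ t, w t := Finset.single_le_sum (fun t _ => hw t) (Finset.mem_univ s)
  have hpos : 0 < ∑ t, w t := hs.trans_le hsum
  have h1 : 1 - w s / ∑ t, w t = ∑ t, if t = s then 0 else w t / ∑ t, w t := by
    have : ∀ t, (if t = s then 0 else w t / ∑ t, w t) =
        w t / ∑ t, w t - if t = s then w s / ∑ t, w t else 0 := by
      intro t
      split_ifs with h
      · rw [h, sub_self]
      · rw [sub_zero]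
    rw [Finset.sum_congr rfl fun t _ => this t, Finset.sum_sub_distrib, ← Finset.sum_div,
      div_self hpos.ne']
    simp
  rw [h1]
  refine Finset.sum_le_sum fun t _ => ?_
  split_ifs with hts
  · exact le_rfl
  · have h2 : w t ≤ ∑ t, w t := Finset.single_le_sum (fun t _ => hw t) (Finset.mem_univ t)
    have h3 : w t / ∑ t, w t ≤ 1 := (div_le_one hpos).2 h2
    have h4 : 0 ≤ w t / ∑ t, w t := div_nonneg (hw t) hpos.le
    calc w t / ∑ t, w t ≤ √(w t / ∑ t, w t) := by
          refine Real.le_sqrt_of_sq_le ?_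
          rw [sq]
          exact mul_le_of_le_one_left h4 h3
      _ ≤ √(w t / w s) := Real.sqrt_le_sqrt (div_le_div_of_nonneg_left (hw t) hs hsum)

/-- With a full window, the posterior of the true latent state is close to one, even though the
posterior is computed for a policy that explores uniformly inside the window and the trajectory
comes from another policy. -/
theorem expect_posterior_error_le {δ : ℝ} (hδ : 0 ≤ δ) (hP : P.IsPerturbedBlock δ)
    (hD : P.DeterministicTransitions) {π f : P.Policy} {b h : ℕ} (hh : h < P.H)
    (hf : ∀ k, b ≤ k → ∀ τ s x, f k τ s x = P.unif k)
    (hdom : ∀ k ≤ h, ∀ τ, 0 < (P.law π k τ).toReal → 0 < (P.law f k τ).toReal)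
    (hlaw : P.law π b = P.law f b) (hbh : b < h) :
    (expect (P.preLaw π h) fun z => 1 - score f (b + 1) b z z.2.1 / ∑ t, score f (b + 1) b z t) ≤
      (2 * √δ) ^ (h - b) * P.maxS := by
  classical
  have h1 := oddsPotential_le hδ hP hD hh hf hdom hlaw hbh.le le_rfl
  have e : h - b = h - (b + 1) + 1 := by omega
  rw [e, pow_succ', mul_assoc]
  refine le_trans ?_ (mul_le_mul_of_nonneg_left h1 (by positivity))
  rw [expect_preLaw, oddsPotential, ← expect_const_mul]
  refine expect_mono_support _ fun τ hτ => ?_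
  rw [← expect_const_mul]
  refine expect_mono_support _ fun s hs => ?_
  have hB := belief_pos (hdom h le_rfl) (b + 1) b hτ hs
  refine le_trans (expect_mono_support _ fun x hx => ?_)
    (sum_odds_emit_le hδ hP hh _ (belief_nonneg f (b + 1) b τ) s)
  exact one_sub_div_sum_le (score f (b + 1) b (τ, s, x)) (score_nonneg f _ _ _) s (mul_pos hB hx)

end POMDP

namespace POMDP

variable {P : POMDP}

/-! ### The posterior given a window -/

theorem preLaw_toReal (π : P.Policy) {h : ℕ} (z : P.Pre h) :
    (P.preLaw π h z).toReal = (P.law π h z.1).toReal *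
      ((P.nextState h z.1 z.2.1).toReal * (P.emit h z.2.1 z.2.2).toReal) := by
  classical
  obtain ⟨τ, s, x⟩ := z
  rw [← expect_ite_eq, expect_preLaw]
  simp only [Prod.mk.injEq]
  rw [expect_single _ τ (fun τ' hτ => by simp [hτ, expect_const]),
    expect_single _ s (fun s' hs => by simp [hs, expect_const]),
    expect_single _ x (fun x' hx => by simp [hx])]
  simp

open Classical in
/-- The probability of the window `w` and the latent state `t` at step `h`. -/
def windowWeight (f : P.Policy) {L h : ℕ} (w : P.Window L h) (t : Fin (P.nS h)) : ℝ :=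
  expect (P.preLaw f h) fun z => if preWindow L z = w ∧ z.2.1 = t then 1 else 0

open Classical in
/-- The probability of the window `w` at step `h`. -/
def windowMass (f : P.Policy) {L h : ℕ} (w : P.Window L h) : ℝ :=
  expect (P.preLaw f h) fun z => if preWindow L z = w then 1 else 0

theorem windowWeight_nonneg (f : P.Policy) {L h : ℕ} (w : P.Window L h) (t : Fin (P.nS h)) :
    0 ≤ windowWeight f w t := expect_nonneg _ fun z => by split_ifs <;> simp

theorem sum_windowWeight (f : P.Policy) {L h : ℕ} (w : P.Window L h) :
    ∑ t, windowWeight f w t = windowMass f w := by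
  classical
  unfold windowWeight windowMass
  rw [← expect_sum]
  refine expect_congr _ fun z => ?_
  by_cases hz : preWindow L z = w <;> simp [hz]

/-- The weights of the filter are the joint probabilities of window and latent state, for windows
that start at step `h - L`. -/
theorem score_eq_windowWeight (f : P.Policy) {L h : ℕ} (hL : 1 ≤ L) (z : P.Pre h)
    (t : Fin (P.nS h)) :
    score f (h + 1 - L) (h - L) z t = windowWeight f (preWindow L z) t := by
  classical
  unfold windowWeight
  rw [expect_preLaw, score, belief, ← expect_mul_const]
  refine expect_congr _ fun τ' => ?_
  rw [expect_single _ t fun s' hs => by simp [hs, expect_const],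
    expect_single _ z.2.2 fun x' hx => by simp [preWindow_eq_iff hL, hx]]
  have : preWindow L (τ', t, z.2.2) = preWindow L z ↔ Agree (h + 1 - L) (h - L) z.1 τ' := by
    rw [preWindow_eq_iff hL]
    exact ⟨fun h => h.1.symm, fun h => ⟨h.symm, rfl⟩⟩
  by_cases hA : Agree (h + 1 - L) (h - L) z.1 τ' <;> simp [this, hA]

theorem preLaw_le_windowWeight (f : P.Policy) {L h : ℕ} (z : P.Pre h) :
    (P.preLaw f h z).toReal ≤ windowWeight f (preWindow L z) z.2.1 := by
  classical
  unfold windowWeight expect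
  have := Finset.single_le_sum (f := fun z' => (P.preLaw f h z').toReal *
    (if preWindow L z' = preWindow L z ∧ z'.2.1 = z.2.1 then 1 else 0)) (s := Finset.univ)
    (fun z' _ => by
      split_ifs
      · simp [ENNReal.toReal_nonneg]
      · simp) (Finset.mem_univ z)
  simpa using this

theorem preLaw_le_windowMass (f : P.Policy) {L h : ℕ} (z : P.Pre h) :
    (P.preLaw f h z).toReal ≤ windowMass f (preWindow L z) := by
  rw [← sum_windowWeight]
  exact (preLaw_le_windowWeight f z).trans
    (Finset.single_le_sum (fun t _ => windowWeight_nonneg f _ t) (Finset.mem_univ z.2.1))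

/-- The decoding error with a full window. The window is drawn from `π`, the posterior is that of the
roll-in policy `f`. -/
theorem full_window_posterior_error_le {δ : ℝ} (hδ : 0 ≤ δ) (hP : P.IsPerturbedBlock δ)
    (hD : P.DeterministicTransitions) {π f : P.Policy} {L h : ℕ} (hL : 1 ≤ L) (hLh : L ≤ h)
    (hh : h < P.H) (hf : ∀ k, h - L ≤ k → ∀ τ s x, f k τ s x = P.unif k)
    (hdom : ∀ k ≤ h, ∀ τ, 0 < (P.law π k τ).toReal → 0 < (P.law f k τ).toReal)
    (hlaw : P.law π (h - L) = P.law f (h - L)) :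
    (expect (P.preLaw π h) fun z =>
      1 - windowWeight f (preWindow L z) z.2.1 / windowMass f (preWindow L z)) ≤
      (2 * √δ) ^ L * P.maxS := by
  have := expect_posterior_error_le hδ hP hD hh hf hdom hlaw (by omega)
  have e1 : h - L + 1 = h + 1 - L := by omega
  have e2 : h - (h - L) = L := by omega
  simp only [e1, e2, score_eq_windowWeight f hL, sum_windowWeight] at this
  exact this

/-! ### Short histories: counting noisy observations -/

/-- An indicator of noise: an observation cannot be noise-free for two different latent states,
and noise is rare. -/
theorem exists_noise_indicator {δ : ℝ} (hδ : 0 < δ) (hP : P.IsPerturbedBlock δ) :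
    ∃ c : ∀ h, Fin (P.nS h) → Fin (P.nX h) → ℕ, ∀ h < P.H,
      (∀ s t x, s ≠ t → 1 ≤ c h s x + c h t x) ∧
      ∀ s, (expect (P.emit h s) fun x => δ⁻¹ ^ c h s x) ≤ 2 := by
  classical
  have : ∀ h, ∃ c : Fin (P.nS h) → Fin (P.nX h) → ℕ, h < P.H →
      (∀ s t x, s ≠ t → 1 ≤ c s x + c t x) ∧
      ∀ s, (expect (P.emit h s) fun x => δ⁻¹ ^ c s x) ≤ 2 := by
    intro h
    by_cases hh : h < P.H
    · obtain ⟨O, E, hd, hO⟩ := hP h hh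
      refine ⟨fun s x => if x ∈ (O s).support then 0 else 1, fun _ => ⟨?_, ?_⟩⟩
      · intro s t x hst
        by_cases h1 : x ∈ (O s).support
        · have : x ∉ (O t).support := fun h2 => Set.disjoint_left.1 (hd s t hst) h1 h2
          simp [this]
        · simp [h1]
      · intro s
        calc (expect (P.emit h s) fun x => δ⁻¹ ^ (if x ∈ (O s).support then 0 else 1))
            ≤ ∑ x, ((P.emit h s x).toReal + (E s x).toReal) := by
              refine Finset.sum_le_sum fun x _ => ?_
              have h0 : 0 ≤ (P.emit h s x).toReal := ENNReal.toReal_nonneg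
              have h0' : 0 ≤ (E s x).toReal := ENNReal.toReal_nonneg
              by_cases h1 : x ∈ (O s).support
              · simp [h1]
              · have : (P.emit h s x).toReal = δ * (E s x).toReal := by
                  rw [hO, (toReal_eq_zero_iff _ _).2 h1]; ring
                simp only [h1, if_false, pow_one]
                have e : (P.emit h s x).toReal * δ⁻¹ = (E s x).toReal := by
                  rw [this]; field_simp
                linarith
          _ = 2 := by rw [Finset.sum_add_distrib, sum_toReal, sum_toReal]; norm_num
    · exact ⟨fun _ _ => 0, fun h' => absurd h' hh⟩
  choose c hc using this
  exact ⟨c, hc⟩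

/-- The number of noisy observations in a trajectory, for a given indicator of noise. -/
def noiseCount (c : ∀ h, Fin (P.nS h) → Fin (P.nX h) → ℕ) {k : ℕ} (τ : P.Traj k) : ℕ :=
  ∑ i : Fin k, c i (τ i).1 (τ i).2.1

theorem noiseCount_extend (c : ∀ h, Fin (P.nS h) → Fin (P.nX h) → ℕ) {k : ℕ} (τ : P.Traj k)
    (s : Fin (P.nS k)) (x : Fin (P.nX k)) (a : Fin (P.nA k)) :
    noiseCount c (P.extend τ s x a) = noiseCount c τ + c k s x := by
  unfold noiseCount
  rw [Fin.sum_univ_castSucc, extend_last]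
  congr 1
  exact Finset.sum_congr rfl fun i _ => by rw [extend_castSucc]; rfl

/-- The number of noisy observations up to and including step `h`. -/
def preNoise (c : ∀ h, Fin (P.nS h) → Fin (P.nX h) → ℕ) {h : ℕ} (z : P.Pre h) : ℕ :=
  noiseCount c z.1 + c h z.2.1 z.2.2

section Noise

variable {c : ∀ h, Fin (P.nS h) → Fin (P.nX h) → ℕ} {δ : ℝ}

theorem expect_law_noise_le (hδ : 0 < δ)
    (hc : ∀ h < P.H, ∀ s, (expect (P.emit h s) fun x => δ⁻¹ ^ c h s x) ≤ 2) (π : P.Policy)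
    {k : ℕ} (hk : k ≤ P.H) : (expect (P.law π k) fun τ => δ⁻¹ ^ noiseCount c τ) ≤ 2 ^ k := by
  induction k with
  | zero => simp [expect_law_zero _ _ (fun k => k.elim0 : P.Traj 0), noiseCount]
  | succ k ih =>
    rw [expect_law_succ, pow_succ]
    refine le_trans ?_ (mul_le_mul_of_nonneg_right (ih (Nat.le_of_succ_le hk)) zero_le_two)
    rw [← expect_mul_const]
    refine expect_mono _ fun τ => ?_
    simp only [noiseCount_extend, expect_const, pow_add, expect_const_mul]
    refine mul_le_mul_of_nonneg_left ?_ (by positivity)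
    rw [← expect_const (P.nextState k τ) 2]
    exact expect_mono _ fun s => hc k hk s

theorem expect_preLaw_noise_le (hδ : 0 < δ)
    (hc : ∀ h < P.H, ∀ s, (expect (P.emit h s) fun x => δ⁻¹ ^ c h s x) ≤ 2) (π : P.Policy)
    {h : ℕ} (hh : h < P.H) :
    (expect (P.preLaw π h) fun z => δ⁻¹ ^ preNoise c z) ≤ 2 ^ (h + 1) := by
  rw [expect_preLaw, pow_succ]
  refine le_trans ?_ (mul_le_mul_of_nonneg_right (expect_law_noise_le hδ hc π hh.le) zero_le_two)
  rw [← expect_mul_const]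
  refine expect_mono _ fun τ => ?_
  simp only [preNoise, pow_add, expect_const_mul]
  refine mul_le_mul_of_nonneg_left ?_ (by positivity)
  rw [← expect_const (P.nextState h τ) 2]
  exact expect_mono _ fun s => hc h hh s

/-- Two possible trajectories with the same observations and actions but different latent states at
the end have had different latent states all the time, as transitions are deterministic. So each
observation was noisy for one of them. -/
theorem le_noiseCount_add (hc : ∀ h < P.H, ∀ s t x, s ≠ t → 1 ≤ c h s x + c h t x)
    (hD : P.DeterministicTransitions) {f : P.Policy} {k : ℕ} (hk : k < P.H) {τ τ' : P.Traj k}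
    (hA : Agree 0 0 τ τ') (hτ : 0 < (P.law f k τ).toReal) (hτ' : 0 < (P.law f k τ').toReal)
    {s s' : Fin (P.nS k)} (hs : 0 < (P.nextState k τ s).toReal)
    (hs' : 0 < (P.nextState k τ' s').toReal) (hne : s ≠ s') :
    k ≤ noiseCount c τ + noiseCount c τ' := by
  induction k with
  | zero => simp
  | succ k ih =>
    obtain ⟨σ, t, x, a, rfl⟩ := exists_eq_extend τ
    obtain ⟨σ', t', x', a', rfl⟩ := exists_eq_extend τ'
    rw [agree_extend] at hA
    obtain ⟨hA, hx, ha⟩ := hA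
    obtain rfl := hx (Nat.zero_le _)
    obtain rfl := ha (Nat.zero_le _)
    rw [nextState_extend] at hs hs'
    have htt : t ≠ t' := by
      rintro rfl
      obtain ⟨u, hu⟩ := hD k hk t a
      rw [hu, toReal_pos_iff, PMF.mem_support_pure_iff] at hs hs'
      exact hne (hs.trans hs'.symm)
    rw [law_extend_toReal] at hτ hτ'
    have nn : ∀ {α : Type} (p : PMF α) (a : α), 0 ≤ (p a).toReal := fun p a => ENNReal.toReal_nonneg
    have h1 := pos_of_mul_pos_left hτ (by positivity)
    have h1' := pos_of_mul_pos_left hτ' (by positivity)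
    have h2 := pos_of_mul_pos_left (pos_of_mul_pos_right hτ (by positivity)) (by positivity)
    have h2' := pos_of_mul_pos_left (pos_of_mul_pos_right hτ' (by positivity)) (by positivity)
    have := ih (Nat.lt_of_succ_lt hk) hA h1 h1' h2 h2' htt
    have := hc k (Nat.lt_of_succ_lt hk) t t' x htt
    rw [noiseCount_extend, noiseCount_extend]
    omega

end Noise

/-! ### Short histories: the posterior does not depend on the policy -/

theorem Agree.mono {a b a' b' k : ℕ} (ha : a ≤ a') (hb : b ≤ b') {τ τ' : P.Traj k}
    (h : Agree a b τ τ') : Agree a' b' τ τ' :=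
  fun i => ⟨fun hi => (h i).1 (ha.trans hi), fun hi => (h i).2 (hb.trans hi)⟩

theorem follow_eq_of_agree {L m j : ℕ} (hL : 1 ≤ L) (hj : j ≤ m) (π : P.Executable L m) {k : ℕ}
    {τ τ' : P.Traj k} (hA : Agree 0 0 τ τ') (s s' : Fin (P.nS k)) (x : Fin (P.nX k)) :
    P.follow j hj π k τ s x = P.follow j hj π k τ' s' x := by
  by_cases hk : k < j
  · rw [follow_of_lt hj π hk (τ, s, x), follow_of_lt hj π hk (τ', s', x),
      (preWindow_eq_iff hL (z := (τ, s, x)) (z' := (τ', s', x))).2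
        ⟨hA.mono (Nat.zero_le _) (Nat.zero_le _), rfl⟩]
  · rw [follow_of_not_lt hj π hk (τ, s, x), follow_of_not_lt hj π hk (τ', s', x)]

/-- The ratio of the laws of two executable policies is a function of the observations and
actions. -/
theorem law_mul_law_comm {L m i j : ℕ} (hL : 1 ≤ L) (hi : i ≤ m) (hj : j ≤ m)
    (π : P.Executable L m) {k : ℕ} {τ τ' : P.Traj k} (hA : Agree 0 0 τ τ') :
    (P.law (P.follow i hi π) k τ).toReal * (P.law (P.follow j hj π) k τ').toReal =
      (P.law (P.follow i hi π) k τ').toReal * (P.law (P.follow j hj π) k τ).toReal := by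
  induction k with
  | zero =>
    have : τ = τ' := funext fun k => k.elim0
    rw [this]
  | succ k ih =>
    obtain ⟨σ, t, x, a, rfl⟩ := exists_eq_extend τ
    obtain ⟨σ', t', x', a', rfl⟩ := exists_eq_extend τ'
    rw [agree_extend] at hA
    obtain ⟨hA, hx, ha⟩ := hA
    obtain rfl := hx (Nat.zero_le _)
    obtain rfl := ha (Nat.zero_le _)
    simp only [law_extend_toReal]
    rw [follow_eq_of_agree hL hi π hA t t' x, follow_eq_of_agree hL hj π hA t t' x]
    linear_combination (P.nextState k σ t).toReal * (P.emit k t x).toReal *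
      (P.follow i hi π k σ' t' x a).toReal * (P.nextState k σ' t').toReal *
      (P.emit k t' x).toReal * (P.follow j hj π k σ' t' x a).toReal * ih hA

/-- Averaging conditional expectations, when the likelihood ratio of the outer law `p` and the
inner weights `w` is constant on the classes on which one conditions. -/
theorem sum_mul_condexp_le {Z W : Type} [Fintype Z] [DecidableEq W] (v : Z → W) (p w u : Z → ℝ)
    (hp : ∀ z, 0 ≤ p z) (hu : ∀ z, 0 ≤ u z) (hpw : ∀ z z', v z = v z' → p z * w z' = p z' * w z) :
    ∑ z, p z * ((∑ z', if v z' = v z then w z' * u z' else 0) /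
        ∑ z', if v z' = v z then w z' else 0)
      ≤ ∑ z, p z * u z := by
  set T : W → ℝ := fun y => ∑ z', if v z' = y then w z' else 0
  calc ∑ z, p z * ((∑ z', if v z' = v z then w z' * u z' else 0) / T (v z))
      = ∑ z, ∑ z', if v z' = v z then p z' * u z' * (w z / T (v z')) else 0 := by
        refine Finset.sum_congr rfl fun z _ => ?_
        rw [Finset.sum_div, Finset.mul_sum]
        refine Finset.sum_congr rfl fun z' _ => ?_
        split_ifs with hv
        · rw [hv]
          linear_combination u z' / T (v z) * hpw z z' hv.symm
        · simp
    _ = ∑ z', p z' * u z' * (T (v z') / T (v z')) := by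
        rw [Finset.sum_comm]
        refine Finset.sum_congr rfl fun z' _ => ?_
        simp only [T]
        rw [Finset.sum_div, Finset.mul_sum]
        refine Finset.sum_congr rfl fun z _ => ?_
        by_cases hv : v z' = v z
        · simp [hv]
        · have : ¬ v z = v z' := fun h => hv h.symm
          simp [hv, this]
    _ ≤ ∑ z, p z * u z := by
        refine Finset.sum_le_sum fun z _ => ?_
        have := mul_nonneg (hp z) (hu z)
        exact mul_le_of_le_one_right this (div_self_le_one _)

open Classical in
/-- As long as the window contains the whole history, the latent state can be decoded unless half of
the observations are noisy. -/
theorem short_window_posterior_error_le {δ : ℝ} (hδ : 0 < δ) (hδ1 : δ ≤ 1)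
    (hP : P.IsPerturbedBlock δ) (hD : P.DeterministicTransitions) {L m i j h : ℕ} (hL : 1 ≤ L)
    (hLh : h < L) (hh : h < P.H) (hi : i ≤ m) (hj : j ≤ m) (π : P.Executable L m)
    (hdom : ∀ τ, 0 < (P.law (P.follow i hi π) h τ).toReal →
      0 < (P.law (P.follow j hj π) h τ).toReal) :
    (expect (P.preLaw (P.follow i hi π) h) fun z =>
      1 - windowWeight (P.follow j hj π) (preWindow L z) z.2.1 /
        windowMass (P.follow j hj π) (preWindow L z)) ≤
      2 * (2 ^ (h + 1) * δ ^ ((h + 2) / 2)) := by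
  obtain ⟨c, hc⟩ := exists_noise_indicator hδ hP
  set p : P.Pre h → ℝ := fun z => (P.preLaw (P.follow i hi π) h z).toReal with hpdef
  set w : P.Pre h → ℝ := fun z => (P.preLaw (P.follow j hj π) h z).toReal with hwdef
  -- `u` indicates the event that at least half of the observations are noisy
  set u : P.Pre h → ℝ := fun z => if h + 1 ≤ 2 * preNoise c z then 1 else 0 with hudef
  have nn : ∀ {α : Type} (p : PMF α) (a : α), 0 ≤ (p a).toReal := fun p a => ENNReal.toReal_nonneg
  have hu0 : ∀ z, 0 ≤ u z := fun z => by simp only [hudef]; split_ifs <;> simp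
  have hsub : h + 1 - L = 0 ∧ h - L = 0 := by omega
  have hwin : ∀ z z' : P.Pre h, preWindow L z = preWindow L z' →
      Agree 0 0 z.1 z'.1 ∧ z.2.2 = z'.2.2 := by
    intro z z' e
    have := (preWindow_eq_iff hL).1 e
    rwa [hsub.1, hsub.2] at this
  have hpos : ∀ (π' : P.Policy) (z : P.Pre h), 0 < (P.preLaw π' h z).toReal →
      0 < (P.law π' h z.1).toReal ∧ 0 < (P.nextState h z.1 z.2.1).toReal ∧
        0 < (P.emit h z.2.1 z.2.2).toReal := by
    intro π' z hz
    rw [preLaw_toReal] at hz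
    have h1 := pos_of_mul_pos_right hz (nn _ _)
    exact ⟨pos_of_mul_pos_left hz (mul_nonneg (nn _ _) (nn _ _)), pos_of_mul_pos_left h1 (nn _ _),
      pos_of_mul_pos_right h1 (nn _ _)⟩
  have hpw : ∀ z z', preWindow L z = preWindow L z' → p z * w z' = p z' * w z := by
    intro z z' e
    simp only [hpdef, hwdef, preLaw_toReal]
    linear_combination (P.nextState h z.1 z.2.1).toReal * (P.emit h z.2.1 z.2.2).toReal *
      (P.nextState h z'.1 z'.2.1).toReal * (P.emit h z'.2.1 z'.2.2).toReal *
      law_mul_law_comm hL hi hj π (hwin z z' e).1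
  have hmass : ∀ y, windowMass (P.follow j hj π) y =
      ∑ z', if preWindow L z' = y then w z' else 0 := by
    intro y
    unfold windowMass expect
    exact Finset.sum_congr rfl fun z' _ => by
      by_cases hv : preWindow L z' = y <;> simp [hv, hwdef]
  -- the posterior weight of the wrong states: either the true history has many noisy observations,
  -- or all histories with the same window and another latent state have
  have hpt : ∀ z, 0 < p z → 1 - windowWeight (P.follow j hj π) (preWindow L z) z.2.1 /
      windowMass (P.follow j hj π) (preWindow L z) ≤ u z +
      (∑ z', if preWindow L z' = preWindow L z then w z' * u z' else 0) /
        ∑ z', if preWindow L z' = preWindow L z then w z' else 0 := by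
    intro z hz
    obtain ⟨h1, h2, h3⟩ := hpos _ z hz
    have hw : 0 < w z := by
      simp only [hwdef, preLaw_toReal]
      exact mul_pos (hdom _ h1) (mul_pos h2 h3)
    have hT := hw.trans_le (preLaw_le_windowMass (L := L) (P.follow j hj π) z)
    rw [← hmass]
    have hdiv : ∀ T a u b : ℝ, 0 < T → T - a ≤ T * u + b → 1 - a / T ≤ u + b / T := by
      intro T a u b hT hle
      rw [one_sub_div hT.ne', div_le_iff₀ hT]
      refine hle.trans (le_of_eq ?_)
      field_simp
    refine hdiv _ _ _ _ hT ?_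
    rw [hmass, Finset.sum_mul, windowWeight, expect, ← Finset.sum_sub_distrib,
      ← Finset.sum_add_distrib]
    refine Finset.sum_le_sum fun z' _ => ?_
    by_cases hv : preWindow L z' = preWindow L z
    · have hw' : 0 ≤ w z' := nn _ _
      have hw'' : (P.preLaw (P.follow j hj π) h z').toReal = w z' := rfl
      simp only [hv, if_true, true_and, hw'']
      by_cases hs : z'.2.1 = z.2.1
      · simp only [hs, if_true]
        nlinarith [mul_nonneg hw' (hu0 z'), mul_nonneg hw' (hu0 z)]
      · simp only [hs, if_false, mul_zero, sub_zero]
        rcases hw'.eq_or_lt with h0 | h0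
        · simp [← h0]
        · obtain ⟨h1', h2', h3'⟩ := hpos _ z' h0
          obtain ⟨hA, hx⟩ := hwin z' z hv
          have hN := le_noiseCount_add (fun h hh => (hc h hh).1) hD hh hA h1' (hdom _ h1) h2' h2 hs
          have hN' := (hc h hh).1 z'.2.1 z.2.1 z.2.2 hs
          have hM : h + 1 ≤ preNoise c z' + preNoise c z := by
            unfold preNoise
            rw [hx]
            omega
          have : 1 ≤ u z' + u z := by
            simp only [hudef]
            split_ifs with g1 g2 g2
            · norm_num
            · norm_num
            · norm_num
            · omega
          nlinarith
    · simp [hv]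
  -- Markov's inequality for `δ⁻¹ ^ preNoise`
  have hmarkov : ∑ z, p z * u z ≤ 2 ^ (h + 1) * δ ^ ((h + 2) / 2) := by
    have h1 : ∀ z, u z ≤ δ ^ ((h + 2) / 2) * δ⁻¹ ^ preNoise c z := by
      intro z
      simp only [hudef]
      split_ifs with hz
      · have h2 : (h + 2) / 2 ≤ preNoise c z := by omega
        have h3 : δ⁻¹ ^ ((h + 2) / 2) ≤ δ⁻¹ ^ preNoise c z :=
          pow_le_pow_right₀ ((one_le_inv₀ hδ).2 hδ1) h2
        calc (1 : ℝ) = δ ^ ((h + 2) / 2) * δ⁻¹ ^ ((h + 2) / 2) := by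
              rw [← mul_pow, mul_inv_cancel₀ hδ.ne', one_pow]
          _ ≤ _ := mul_le_mul_of_nonneg_left h3 (by positivity)
      · positivity
    have h2 := expect_preLaw_noise_le hδ (fun h hh => (hc h hh).2) (P.follow i hi π) hh
    have h3 := expect_mono (P.preLaw (P.follow i hi π) h) h1
    rw [expect_const_mul] at h3
    refine h3.trans ?_
    rw [mul_comm]
    exact mul_le_mul_of_nonneg_right h2 (by positivity)
  refine (expect_mono_support _ hpt).trans ?_
  rw [expect_add, two_mul]
  exact add_le_add hmarkov ((sum_mul_condexp_le _ p w u (fun z => nn _ _) hu0 hpw).trans hmarkov)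

end POMDP

/-! ### Empirical frequencies and likelihood -/

open Classical in
/-- How often the value `z` occurs in the sample `D`. -/
def tally {Z : Type} {n : ℕ} (D : Fin n → Z) (z : Z) : ℕ := ∑ i, if D i = z then 1 else 0

theorem sum_tally_mul {Z : Type} [Fintype Z] {n : ℕ} (D : Fin n → Z) (f : Z → ℝ) :
    ∑ z, (tally D z : ℝ) * f z = ∑ i, f (D i) := by
  classical
  simp only [tally, Nat.cast_sum, Finset.sum_mul]
  rw [Finset.sum_comm]
  exact Finset.sum_congr rfl fun i _ => by simp

theorem tally_pos {Z : Type} {n : ℕ} (D : Fin n → Z) (i : Fin n) : 0 < tally D (D i) := by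
  classical
  have := Finset.single_le_sum (f := fun j => if D j = D i then 1 else 0) (s := Finset.univ)
    (fun j _ => Nat.zero_le _) (Finset.mem_univ i)
  simp only [if_true] at this
  exact this

/-- Multiplied by the total, this also holds for vanishing weights. -/
theorem ofWeights_toReal_mul {m : ℕ} (hm : 0 < m) (c : Fin m → ℕ) (a : Fin m) :
    (ofWeights hm c a).toReal * ∑ b, (c b : ℝ) = c a := by
  unfold ofWeights
  have key : ∑' a, (c a : ℝ≥0∞) = ((∑ b, c b : ℕ) : ℝ≥0∞) := by
    rw [tsum_fintype]; push_cast; rfl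
  split_ifs with hc
  · rw [key] at hc
    have h0 : ∑ b, c b = 0 := by exact_mod_cast hc
    have h1 : ∀ b, c b = 0 := fun b => (Finset.sum_eq_zero_iff.1 h0) b (Finset.mem_univ b)
    simp [h1]
  · rw [PMF.normalize_apply, key, ENNReal.toReal_mul, ENNReal.toReal_inv]
    rw [key] at hc
    have h0 : ((∑ b, c b : ℕ) : ℝ) ≠ 0 := by exact_mod_cast hc
    push_cast at h0 ⊢
    simp only [ENNReal.toReal_natCast]
    rw [ENNReal.toReal_sum (fun b _ => ENNReal.natCast_ne_top _)]
    simp only [ENNReal.toReal_natCast]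
    field_simp

section Likelihood

variable {W : Type} {m n : ℕ}

/-- The conditional frequencies of a sample of pairs (uniform where there are no observations). -/
def empirical (hm : 0 < m) (D : Fin n → W × Fin m) (w : W) : PMF (Fin m) :=
  ofWeights hm fun a => tally D (w, a)

theorem empirical_mul (hm : 0 < m) (D : Fin n → W × Fin m) (w : W) (a : Fin m) :
    (empirical hm D w a).toReal * ∑ b, (tally D (w, b) : ℝ) = tally D (w, a) :=
  ofWeights_toReal_mul hm _ a

theorem sum_log (s : Finset (Fin n)) (f : Fin n → ℝ≥0∞) :
    ∑ i ∈ s, ENNReal.log (f i) = ENNReal.log (∏ i ∈ s, f i) := by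
  classical
  induction s using Finset.induction_on with
  | empty => simp
  | insert i s hi ih => rw [Finset.sum_insert hi, Finset.prod_insert hi, ENNReal.log_mul_add, ih]

variable [Fintype W]

/-- The strict Gibbs inequality: only rules that agree with the conditional frequencies on the
sample have at least their likelihood. -/
theorem eq_empirical_of_prod_le (hm : 0 < m) (D : Fin n → W × Fin m) (q : W → PMF (Fin m))
    (h : ∏ i, (empirical hm D (D i).1 (D i).2).toReal ≤ ∏ i, (q (D i).1 (D i).2).toReal)
    (i : Fin n) :
    (q (D i).1 (D i).2).toReal = (empirical hm D (D i).1 (D i).2).toReal := by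
  set N : W → ℝ := fun w => ∑ b, (tally D (w, b) : ℝ)
  set e : Fin n → ℝ := fun i => (empirical hm D (D i).1 (D i).2).toReal
  set p : Fin n → ℝ := fun i => (q (D i).1 (D i).2).toReal
  have hNe : ∀ i, e i * N (D i).1 = tally D (D i) := fun i => empirical_mul hm D _ _
  have ht : ∀ i, (0 : ℝ) < tally D (D i) := fun i => by exact_mod_cast tally_pos D i
  have he : ∀ i, 0 < e i := by
    intro i
    refine lt_of_le_of_ne ENNReal.toReal_nonneg fun h0 => ?_
    have := hNe i
    rw [← h0, zero_mul] at this
    exact (ht i).ne this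
  have hp : ∀ i, 0 < p i := by
    have h1 : 0 < ∏ i, p i := (Finset.prod_pos fun i _ => he i).trans_le h
    intro i
    refine lt_of_le_of_ne ENNReal.toReal_nonneg fun h0 => ?_
    rw [Finset.prod_eq_zero (Finset.mem_univ i) h0.symm] at h1
    exact lt_irrefl _ h1
  -- the likelihood ratios sum up to at most `n`, while the sum of their logarithms is nonnegative;
  -- so `log x ≤ x - 1` holds with equality for each of them
  have hsum : ∑ i, p i / e i ≤ n := by
    have h1 : ∀ i, p i / e i = (q (D i).1 (D i).2).toReal * N (D i).1 / tally D (D i) := by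
      intro i
      rw [← hNe i]
      have h2 := he i
      have h3 : N (D i).1 ≠ 0 := fun h0 => by
        have := hNe i
        rw [h0, mul_zero] at this
        exact (ht i).ne this
      change p i / e i = p i * N (D i).1 / (e i * N (D i).1)
      rw [mul_div_mul_right _ _ h3]
    calc ∑ i, p i / e i = ∑ i, (q (D i).1 (D i).2).toReal * N (D i).1 / tally D (D i) :=
          Finset.sum_congr rfl fun i _ => h1 i
      _ = ∑ z, (tally D z : ℝ) * ((q z.1 z.2).toReal * N z.1 / tally D z) :=
          (sum_tally_mul D fun z => (q z.1 z.2).toReal * N z.1 / tally D z).symm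
      _ ≤ ∑ z : W × Fin m, (q z.1 z.2).toReal * N z.1 := by
          refine Finset.sum_le_sum fun z _ => ?_
          have hN : 0 ≤ N z.1 := Finset.sum_nonneg fun b _ => Nat.cast_nonneg _
          have hq : 0 ≤ (q z.1 z.2).toReal := ENNReal.toReal_nonneg
          rcases Nat.eq_zero_or_pos (tally D z) with h0 | h0
          · rw [h0]
            simpa using mul_nonneg hq hN
          · rw [mul_div_cancel₀ _ (by positivity)]
      _ = ∑ w, N w := by
          rw [Fintype.sum_prod_type]
          refine Finset.sum_congr rfl fun w _ => ?_
          dsimp only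
          rw [← Finset.sum_mul, sum_toReal, one_mul]
      _ = ∑ z, (tally D z : ℝ) * 1 := by
          rw [Fintype.sum_prod_type]
          simp [N]
      _ = n := by
          rw [sum_tally_mul]
          simp
  have hlog : 0 ≤ ∑ i, Real.log (p i / e i) := by
    have h1 : ∀ i, Real.log (p i / e i) = Real.log (p i) - Real.log (e i) := fun i =>
      Real.log_div (hp i).ne' (he i).ne'
    simp only [h1, Finset.sum_sub_distrib]
    rw [← Real.log_prod fun i _ => (hp i).ne', ← Real.log_prod fun i _ => (he i).ne', sub_nonneg]
    exact Real.log_le_log (Finset.prod_pos fun i _ => he i) h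
  by_contra hne
  have hlt : ∑ i, Real.log (p i / e i) < ∑ i, (p i / e i - 1) := by
    refine Finset.sum_lt_sum (fun j _ => Real.log_le_sub_one_of_pos (div_pos (hp j) (he j)))
      ⟨i, Finset.mem_univ i, Real.log_lt_sub_one_of_pos (div_pos (hp i) (he i)) fun h1 => hne ?_⟩
    exact (div_eq_one_iff_eq (he i).ne').1 h1
  rw [Finset.sum_sub_distrib] at hlt
  simp only [Finset.sum_const, Finset.card_univ, Fintype.card_fin, nsmul_eq_mul, mul_one] at hlt
  linarith

theorem prod_le_prod_empirical (hm : 0 < m) (D : Fin n → W × Fin m) (q : W → PMF (Fin m)) :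
    ∏ i, q (D i).1 (D i).2 ≤ ∏ i, empirical hm D (D i).1 (D i).2 := by
  by_contra hlt
  push Not at hlt
  have hne : ∀ q' : W → PMF (Fin m), ∏ i, q' (D i).1 (D i).2 ≠ ⊤ := fun q' =>
    ENNReal.prod_ne_top fun i _ => PMF.apply_ne_top _ _
  have h1 := (ENNReal.toReal_le_toReal (hne _) (hne _)).2 hlt.le
  rw [ENNReal.toReal_prod, ENNReal.toReal_prod] at h1
  have h2 : ∏ i, q (D i).1 (D i).2 = ∏ i, empirical hm D (D i).1 (D i).2 :=
    Finset.prod_congr rfl fun i _ => (ENNReal.toReal_eq_toReal_iff' (PMF.apply_ne_top _ _)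
      (PMF.apply_ne_top _ _)).1 (eq_empirical_of_prod_le hm D q h1 i)
  exact hlt.ne' h2

/-- A rule with maximal likelihood coincides with the conditional frequencies wherever there are
observations. -/
theorem mul_sum_tally_eq_of_prod_le (hm : 0 < m) (D : Fin n → W × Fin m) (q : W → PMF (Fin m))
    (h : ∏ i, empirical hm D (D i).1 (D i).2 ≤ ∏ i, q (D i).1 (D i).2) (w : W) (a : Fin m) :
    (q w a).toReal * ∑ b, (tally D (w, b) : ℝ) = tally D (w, a) := by
  have hne : ∀ q' : W → PMF (Fin m), ∏ i, q' (D i).1 (D i).2 ≠ ⊤ := fun q' =>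
    ENNReal.prod_ne_top fun i _ => PMF.apply_ne_top _ _
  have h1 := (ENNReal.toReal_le_toReal (hne _) (hne _)).2 h
  rw [ENNReal.toReal_prod, ENNReal.toReal_prod] at h1
  have hle : ∀ b ∈ Finset.univ, (tally D (w, b) : ℝ) ≤
      (q w b).toReal * ∑ b, (tally D (w, b) : ℝ) := by
    intro b _
    by_cases hb : ∃ i, D i = (w, b)
    · obtain ⟨i, hi⟩ := hb
      have := eq_empirical_of_prod_le hm D q h1 i
      rw [hi] at this
      rw [this, empirical_mul]
    · push Not at hb
      have : tally D (w, b) = 0 := by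
        unfold tally
        exact Finset.sum_eq_zero fun i _ => if_neg (hb i)
      rw [this, Nat.cast_zero]
      exact mul_nonneg ENNReal.toReal_nonneg (Finset.sum_nonneg fun b _ => Nat.cast_nonneg _)
  have hsum : ∑ b, (tally D (w, b) : ℝ) =
      ∑ b, (q w b).toReal * ∑ b, (tally D (w, b) : ℝ) := by
    rw [← Finset.sum_mul, sum_toReal, one_mul]
  exact ((Finset.sum_eq_sum_iff_of_le hle).1 hsum a (Finset.mem_univ a)).symm

/-- Maximal likelihood turns an `ℓ¹` bound for the joint frequencies into a bound for the
conditional law: here `p` is the joint law, and no window needs to have been observed. -/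
theorem sum_abs_sub_le_of_maximal (D : Fin n → W × Fin m) (q : W → PMF (Fin m))
    (h : ∀ w a, (q w a).toReal * ∑ b, (tally D (w, b) : ℝ) = tally D (w, a)) (p : W × Fin m → ℝ) :
    ∑ w, ∑ a, |n * ((∑ b, p (w, b)) * (q w a).toReal - p (w, a))| ≤
      2 * ∑ z, |(tally D z : ℝ) - n * p z| := by
  have h1 : ∀ w a, |n * ((∑ b, p (w, b)) * (q w a).toReal - p (w, a))| ≤
      |(tally D (w, a) : ℝ) - n * p (w, a)| +
        (∑ b, |(tally D (w, b) : ℝ) - n * p (w, b)|) * (q w a).toReal := by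
    intro w a
    have e : n * ((∑ b, p (w, b)) * (q w a).toReal - p (w, a)) =
        ((tally D (w, a) : ℝ) - n * p (w, a)) -
          (∑ b, ((tally D (w, b) : ℝ) - n * p (w, b))) * (q w a).toReal := by
      rw [← h w a, Finset.sum_sub_distrib, ← Finset.mul_sum]
      ring
    rw [e]
    refine (abs_sub _ _).trans (add_le_add le_rfl ?_)
    rw [abs_mul, abs_of_nonneg (ENNReal.toReal_nonneg (a := q w a))]
    exact mul_le_mul_of_nonneg_right (Finset.abs_sum_le_sum_abs _ _) ENNReal.toReal_nonneg
  calc ∑ w, ∑ a, |n * ((∑ b, p (w, b)) * (q w a).toReal - p (w, a))|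
      ≤ ∑ w, ∑ a, (|(tally D (w, a) : ℝ) - n * p (w, a)| +
        (∑ b, |(tally D (w, b) : ℝ) - n * p (w, b)|) * (q w a).toReal) :=
        Finset.sum_le_sum fun w _ => Finset.sum_le_sum fun a _ => h1 w a
    _ = 2 * ∑ z, |(tally D z : ℝ) - n * p z| := by
        rw [Fintype.sum_prod_type, two_mul, ← Finset.sum_add_distrib]
        refine Finset.sum_congr rfl fun w _ => ?_
        rw [Finset.sum_add_distrib, ← Finset.mul_sum, sum_toReal, mul_one]

end Likelihood

namespace POMDP

variable {P : POMDP}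

theorem logLik_le_of_prod_le {L n h : ℕ} (hh : h < P.H) (D : Fin n → P.Sample h)
    (q q' : P.StepPolicy L h)
    (hle : ∏ i, q (visible L hh (D i)).1 (visible L hh (D i)).2 ≤
      ∏ i, q' (visible L hh (D i)).1 (visible L hh (D i)).2) :
    P.logLik hh D q ≤ P.logLik hh D q' := by
  unfold logLik
  refine EReal.div_le_div_right_of_nonneg ?_ ?_
  · exact EReal.coe_nonneg.2 (Nat.cast_nonneg n)
  · rw [sum_log, sum_log]
    exact ENNReal.log_monotone hle

theorem prod_le_of_logLik_le {L n h : ℕ} (hn : 0 < n) (hh : h < P.H) (D : Fin n → P.Sample h)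
    (q q' : P.StepPolicy L h) (hle : P.logLik hh D q ≤ P.logLik hh D q') :
    ∏ i, q (visible L hh (D i)).1 (visible L hh (D i)).2 ≤
      ∏ i, q' (visible L hh (D i)).1 (visible L hh (D i)).2 := by
  unfold logLik at hle
  rw [sum_log, sum_log] at hle
  have hpos : (0 : EReal) < ((n : ℝ) : EReal) := by
    have : (0 : ℝ) < n := by exact_mod_cast hn
    exact_mod_cast this
  have h1 := (EReal.strictMono_div_right_of_pos hpos (EReal.coe_ne_top _)).le_iff_le.1 hle
  exact ENNReal.log_le_log_iff.1 h1

end POMDP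

/-! ### Concentration of empirical frequencies -/

section Concentration

variable {Z : Type} [Fintype Z]

theorem toOuterMeasure_eq_ofReal_expect (p : PMF Z) (s : Set Z) [DecidablePred (· ∈ s)] :
    p.toOuterMeasure s = ENNReal.ofReal (expect p fun z => if z ∈ s then 1 else 0) := by
  rw [PMF.toOuterMeasure_apply_fintype, expect, ENNReal.ofReal_sum_of_nonneg]
  · refine Finset.sum_congr rfl fun z _ => ?_
    by_cases hz : z ∈ s
    · simp [hz, p.apply_ne_top z]
    · simp [hz]
  · intro z _
    split_ifs <;> simp

theorem expect_iid_prod (p : PMF Z) (g : Z → ℝ) (n : ℕ) :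
    expect (iid p n) (fun D => ∏ i, g (D i)) = expect p g ^ n := by
  induction n with
  | zero => simp [iid, expect_pure]
  | succ n ih =>
    simp only [iid, expect_bind, expect_map, Fin.prod_univ_succ, Fin.cons_zero, Fin.cons_succ]
    simp only [expect_const_mul, ih, expect_mul_const]
    rw [pow_succ']

/-- A moment generating function bound for a centred variable with values in `[-2, 2]`. -/
theorem expect_exp_le (p : PMF Z) (f : Z → ℝ) (hf : ∀ z, |f z| ≤ 2) (h0 : expect p f = 0) (l : ℝ) :
    (expect p fun z => Real.exp (l * f z)) ≤ Real.exp (2 * l ^ 2) := by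
  have h1 : ∀ z, Real.exp (l * f z) ≤ Real.cosh (2 * l) + Real.sinh (2 * l) / 2 * f z := by
    intro z
    obtain ⟨ha, hb⟩ := abs_le.1 (hf z)
    have := convexOn_exp.2 (Set.mem_univ (2 * l)) (Set.mem_univ (-(2 * l)))
      (by linarith : (0 : ℝ) ≤ 1 / 2 + f z / 4) (by linarith : (0 : ℝ) ≤ 1 / 2 - f z / 4) (by ring)
    simp only [smul_eq_mul] at this
    rw [Real.cosh_eq, Real.sinh_eq]
    calc Real.exp (l * f z) = Real.exp ((1 / 2 + f z / 4) * (2 * l)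
          + (1 / 2 - f z / 4) * -(2 * l)) := by congr 1; ring
      _ ≤ _ := this
      _ = _ := by ring
  refine (expect_mono p h1).trans ?_
  rw [expect_add, expect_const, expect_const_mul, h0, mul_zero, add_zero]
  refine (Real.cosh_le_exp_half_sq _).trans (le_of_eq ?_)
  congr 1
  ring

/-- The `ℓ¹` deviation of the frequencies in `n` independent draws from a law on a finite type: a
Chernoff bound for each sign vector `sg T` and a union bound over all sign vectors. -/
theorem tally_deviation_prob_le (p : PMF Z) (n : ℕ) {t : ℝ} (ht : 0 ≤ t) :
    (iid p n).toOuterMeasure {D | n * t < ∑ z, |(tally D z : ℝ) - n * (p z).toReal|} ≤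
      ENNReal.ofReal (2 ^ Fintype.card Z * Real.exp (-(n * t ^ 2 / 8))) := by
  classical
  rw [toOuterMeasure_eq_ofReal_expect]
  refine ENNReal.ofReal_le_ofReal ?_
  set dev : (Fin n → Z) → ℝ := fun D => ∑ z, |(tally D z : ℝ) - n * (p z).toReal|
  set sg : Finset Z → Z → ℝ := fun T z => if z ∈ T then 1 else -1
  set f : Finset Z → Z → ℝ := fun T z => sg T z - expect p (sg T)
  have hsg : ∀ T z, |sg T z| ≤ 1 := by
    intro T z
    simp only [sg]
    split_ifs <;> simp
  have hE : ∀ T, |expect p (sg T)| ≤ 1 := by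
    intro T
    rw [abs_le]
    constructor
    · rw [← expect_const p (-1)]
      exact expect_mono p fun z => (abs_le.1 (hsg T z)).1
    · rw [← expect_const p 1]
      exact expect_mono p fun z => (abs_le.1 (hsg T z)).2
  have hf : ∀ T z, |f T z| ≤ 2 := fun T z => by
    refine (abs_sub _ _).trans ?_
    linarith [hsg T z, hE T]
  have hf0 : ∀ T, expect p (f T) = 0 := by
    intro T
    have : expect p (f T) = expect p (fun z => sg T z + -expect p (sg T)) := rfl
    rw [this, expect_add, expect_const]
    ring
  -- the deviation is attained by a sign vector, which depends on `D`
  have hdev : ∀ D, ∃ T, dev D = ∑ i, f T (D i) := by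
    intro D
    refine ⟨Finset.univ.filter fun z => 0 ≤ (tally D z : ℝ) - n * (p z).toReal, ?_⟩
    set T := Finset.univ.filter fun z => 0 ≤ (tally D z : ℝ) - n * (p z).toReal with hT
    have h1 : ∀ z, |(tally D z : ℝ) - n * (p z).toReal| =
        (tally D z : ℝ) * sg T z - n * ((p z).toReal * sg T z) := by
      intro z
      simp only [sg, hT, Finset.mem_filter, Finset.mem_univ, true_and]
      split_ifs with hz
      · rw [abs_of_nonneg hz]
        ring
      · rw [abs_of_neg (not_le.1 hz)]
        ring
    simp only [dev, h1]
    rw [Finset.sum_sub_distrib, sum_tally_mul, ← Finset.mul_sum]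
    simp only [f, Finset.sum_sub_distrib, Finset.sum_const, Finset.card_univ, Fintype.card_fin,
      nsmul_eq_mul]
    rfl
  -- the exponent `t / 4` optimizes the bound `exp (2 n l ^ 2 - l n t)`
  set l := t / 4 with hl
  have hl0 : 0 ≤ l := by positivity
  calc (expect (iid p n) fun D => if D ∈ {D | n * t < dev D} then 1 else 0)
      ≤ expect (iid p n) fun D =>
          Real.exp (-(l * (n * t))) * ∑ T, ∏ i, Real.exp (l * f T (D i)) := by
        refine expect_mono _ fun D => ?_
        split_ifs with hD
        · obtain ⟨T, hT⟩ := hdev D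
          have h1 : Real.exp (l * dev D) ≤ ∑ T, ∏ i, Real.exp (l * f T (D i)) := by
            rw [hT, Finset.mul_sum, Real.exp_sum]
            exact Finset.single_le_sum (f := fun T => ∏ i, Real.exp (l * f T (D i)))
              (fun T _ => (Finset.prod_pos fun i _ => Real.exp_pos _).le) (Finset.mem_univ T)
          have h2 : l * (n * t) ≤ l * dev D :=
            mul_le_mul_of_nonneg_left (le_of_lt hD) hl0
          calc (1 : ℝ) = Real.exp (-(l * (n * t))) * Real.exp (l * (n * t)) := by
                rw [← Real.exp_add]; simp
            _ ≤ Real.exp (-(l * (n * t))) * Real.exp (l * dev D) :=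
                mul_le_mul_of_nonneg_left (Real.exp_le_exp.2 h2) (Real.exp_pos _).le
            _ ≤ _ := mul_le_mul_of_nonneg_left h1 (Real.exp_pos _).le
        · exact mul_nonneg (Real.exp_pos _).le (Finset.sum_nonneg fun T _ =>
            Finset.prod_nonneg fun i _ => (Real.exp_pos _).le)
    _ = Real.exp (-(l * (n * t))) * ∑ T, (expect p fun z => Real.exp (l * f T z)) ^ n := by
        rw [expect_const_mul, expect_sum]
        congr 1
        exact Finset.sum_congr rfl fun T _ =>
          expect_iid_prod p (fun z => Real.exp (l * f T z)) n
    _ ≤ Real.exp (-(l * (n * t))) * ∑ _T : Finset Z, Real.exp (2 * l ^ 2) ^ n := by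
        refine mul_le_mul_of_nonneg_left (Finset.sum_le_sum fun T _ => ?_) (Real.exp_pos _).le
        exact pow_le_pow_left₀ (expect_nonneg _ fun z => (Real.exp_pos _).le)
          (expect_exp_le p _ (hf T) (hf0 T) l) n
    _ = 2 ^ Fintype.card Z * Real.exp (-(n * t ^ 2 / 8)) := by
        rw [Finset.sum_const, Finset.card_univ, Fintype.card_finset, nsmul_eq_mul,
          ← Real.exp_nat_mul, mul_left_comm, ← Real.exp_add]
        push_cast
        congr 2
        rw [hl]
        ring

end Concentration

namespace POMDP

variable {P : POMDP}

/-! ### From fitted steps to the trajectory law -/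

/-- The total `ℓ¹` error of step `k` of `π` as a conditional law of the expert action given the
window, under the roll-in law of step `k`, is at most `2 t`. -/
def FitsStep (e : P.LatentPolicy) (t : ℝ) {L m : ℕ} (π : P.Executable L m) (k : ℕ) (hk : k < m) :
    Prop :=
  ∑ w, ∑ a,
    |(∑ b, (P.obsLaw e L k (P.follow (k - L) ((Nat.sub_le k L).trans hk.le) π) (w, b)).toReal)
      * (π ⟨k, hk⟩ w a).toReal
    - (P.obsLaw e L k (P.follow (k - L) ((Nat.sub_le k L).trans hk.le) π) (w, a)).toReal| ≤ 2 * t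

open Classical in
theorem obsLaw_toReal (e : P.LatentPolicy) {L h : ℕ} (f : P.Policy) (w : P.Window L h)
    (a : Fin (P.nA h)) :
    (P.obsLaw e L h f (w, a)).toReal = ∑ s, windowWeight f w s * (e h s a).toReal := by
  rw [← expect_ite_eq, expect_obsLaw]
  simp only [windowWeight, ← expect_mul_const]
  rw [← expect_sum]
  refine expect_congr _ fun z => ?_
  rw [expect_single _ a fun b hb => by simp [hb]]
  by_cases hz : preWindow L z = w <;> simp [hz]

theorem sum_obsLaw_toReal (e : P.LatentPolicy) {L h : ℕ} (f : P.Policy) (w : P.Window L h) :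
    ∑ a, (P.obsLaw e L h f (w, a)).toReal = windowMass f w := by
  simp only [obsLaw_toReal, ← sum_windowWeight]
  rw [Finset.sum_comm]
  refine Finset.sum_congr rfl fun s _ => ?_
  rw [← Finset.mul_sum, sum_toReal, mul_one]

/-- A mixture of laws is close to a component of large weight. -/
theorem sum_abs_sub_mixture_le {S Y : Type} [Fintype S] [Fintype Y] (e : S → PMF Y) (w : S → ℝ)
    (hw : ∀ s, 0 ≤ w s) (hpos : 0 < ∑ s, w s) (s : S) :
    ∑ a, |(e s a).toReal - (∑ t, w t * (e t a).toReal) / ∑ t, w t| ≤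
      2 * (1 - w s / ∑ t, w t) := by
  classical
  set T := ∑ t, w t
  have h1 : ∀ a, |(e s a).toReal - (∑ t, w t * (e t a).toReal) / T| ≤
      ∑ t, w t / T * |(e s a).toReal - (e t a).toReal| := by
    intro a
    have h2 : (e s a).toReal - (∑ t, w t * (e t a).toReal) / T =
        ∑ t, w t / T * ((e s a).toReal - (e t a).toReal) := by
      simp only [mul_sub, Finset.sum_sub_distrib]
      rw [← Finset.sum_mul, ← Finset.sum_div, div_self hpos.ne', one_mul, Finset.sum_div]
      congr 1
      exact Finset.sum_congr rfl fun t _ => by ring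
    rw [h2]
    refine (Finset.abs_sum_le_sum_abs _ _).trans (Finset.sum_le_sum fun t _ => ?_)
    rw [abs_mul, abs_of_nonneg (div_nonneg (hw t) hpos.le)]
  calc ∑ a, |(e s a).toReal - (∑ t, w t * (e t a).toReal) / T|
      ≤ ∑ a, ∑ t, w t / T * |(e s a).toReal - (e t a).toReal| :=
        Finset.sum_le_sum fun a _ => h1 a
    _ = ∑ t, w t / T * l1 (e s) (e t) := by
        rw [Finset.sum_comm]
        exact Finset.sum_congr rfl fun t _ => by rw [← Finset.mul_sum]; rfl
    _ ≤ ∑ t, (2 * (w t / T) - if t = s then 2 * (w s / T) else 0) := by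
        refine Finset.sum_le_sum fun t _ => ?_
        split_ifs with hts
        · subst hts
          simp [l1]
        · have := mul_le_mul_of_nonneg_left (l1_le_two (e s) (e t))
            (div_nonneg (hw t) hpos.le)
          linarith
    _ = 2 * (1 - w s / T) := by
        rw [Finset.sum_sub_distrib, ← Finset.mul_sum, ← Finset.sum_div, div_self hpos.ne']
        simp
        ring

theorem expect_preLaw_preWindow (f : P.Policy) {L h : ℕ} (G : P.Window L h → ℝ) :
    (expect (P.preLaw f h) fun z => G (preWindow L z)) = ∑ w, windowMass f w * G w := by
  classical
  simp only [windowMass, ← expect_mul_const]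
  rw [← expect_sum]
  exact expect_congr _ fun z => by simp

theorem follow_pos {L m i j k : ℕ} (π : P.Executable L m) (hi : i ≤ m) (hj : j ≤ i) (hk : k ≤ P.H)
    (τ : P.Traj k) (hτ : 0 < (P.law (P.follow i hi π) k τ).toReal) :
    0 < (P.law (P.follow j (hj.trans hi) π) k τ).toReal := by
  classical
  have := expect_law_le_follow π hi hj hk (fun τ' => if τ' = τ then 1 else 0)
    fun τ' => by split_ifs <;> simp
  rw [expect_ite_eq, expect_ite_eq] at this
  exact pos_of_mul_pos_right (hτ.trans_le this) (by positivity)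

/-- The error of one step: a decoding error, and a fitting error that is amplified by the change of
measure from the roll-in policy. -/
theorem expect_step_error_le (e : P.LatentPolicy) {L : ℕ} (π : P.Executable L P.H) {h : ℕ}
    (hh : h < P.H) {t : ℝ} (hfit : FitsStep e t π h hh) :
    (expect (P.preLaw (P.ofExecutable π) h) fun z => l1 (P.ofLatent e h z.1 z.2.1 z.2.2)
      (P.ofExecutable π h z.1 z.2.1 z.2.2)) ≤
    2 * (expect (P.preLaw (P.ofExecutable π) h) fun z =>
      1 - windowWeight (P.follow (h - L) ((Nat.sub_le h L).trans hh.le) π) (preWindow L z) z.2.1 /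
        windowMass (P.follow (h - L) ((Nat.sub_le h L).trans hh.le) π) (preWindow L z)) +
    2 * ((P.maxA : ℝ) ^ L * t) := by
  set f := P.follow (h - L) ((Nat.sub_le h L).trans hh.le) π with hf
  set p : P.Window L h → Fin (P.nA h) → ℝ := fun w a => (P.obsLaw e L h f (w, a)).toReal with hp
  set G : P.Window L h → ℝ := fun w => ∑ a, |p w a / windowMass f w - (π ⟨h, hh⟩ w a).toReal|
  have hG : ∀ w, 0 ≤ G w := fun w => Finset.sum_nonneg fun _ _ => abs_nonneg _
  have h1 : (expect (P.preLaw (P.ofExecutable π) h) fun z => G (preWindow L z)) ≤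
      2 * ((P.maxA : ℝ) ^ L * t) := by
    have hle := expect_preLaw_le_follow π (i := P.H) (j := h - L) le_rfl
      ((Nat.sub_le h L).trans hh.le) hh.le (fun z => G (preWindow L z)) fun z => hG _
    refine hle.trans ?_
    have h2 : (expect (P.preLaw f h) fun z => G (preWindow L z)) ≤ 2 * t := by
      rw [expect_preLaw_preWindow]
      refine le_trans (Finset.sum_le_sum fun w _ => ?_) hfit
      rw [Finset.mul_sum]
      refine Finset.sum_le_sum fun a _ => ?_
      rw [sum_obsLaw_toReal, ← hf]
      have hm : 0 ≤ windowMass f w := by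
        rw [← sum_windowWeight]
        exact Finset.sum_nonneg fun s _ => windowWeight_nonneg f w s
      rcases hm.eq_or_lt with h0 | h0
      · rw [← h0, zero_mul]
        exact abs_nonneg _
      · nth_rewrite 1 [← abs_of_pos h0]
        rw [← abs_mul, mul_sub, mul_div_cancel₀ _ h0.ne', abs_sub_comm]
    have h3 : (P.maxA : ℝ) ^ (h - (h - L)) ≤ (P.maxA : ℝ) ^ L := by
      refine pow_le_pow_right₀ ?_ (by omega)
      exact_mod_cast one_le_maxA (Nat.zero_lt_of_lt hh)
    calc (P.maxA : ℝ) ^ (h - (h - L)) * (expect (P.preLaw f h) fun z => G (preWindow L z))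
        ≤ (P.maxA : ℝ) ^ L * (2 * t) :=
          mul_le_mul h3 h2 (expect_nonneg _ fun z => hG _) (by positivity)
      _ = 2 * ((P.maxA : ℝ) ^ L * t) := by ring
  refine le_trans ?_ (add_le_add le_rfl h1)
  rw [← expect_const_mul, ← expect_add]
  refine expect_mono_support _ fun z hz => ?_
  rw [preLaw_toReal] at hz
  have nn : ∀ {α : Type} (p : PMF α) (a : α), 0 ≤ (p a).toReal := fun p a => ENNReal.toReal_nonneg
  have hz1 := pos_of_mul_pos_left hz (mul_nonneg (nn _ _) (nn _ _))
  have hz2 := pos_of_mul_pos_right hz (nn _ _)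
  have hzf : 0 < (P.preLaw f h z).toReal := by
    rw [preLaw_toReal]
    exact mul_pos (follow_pos π le_rfl ((Nat.sub_le h L).trans hh.le) hh.le z.1 hz1) hz2
  have hm := hzf.trans_le (preLaw_le_windowMass (L := L) f z)
  have e1 : P.ofExecutable π h z.1 z.2.1 z.2.2 = π ⟨h, hh⟩ (preWindow L z) :=
    follow_of_lt le_rfl π hh z
  rw [e1]
  calc l1 (P.ofLatent e h z.1 z.2.1 z.2.2) (π ⟨h, hh⟩ (preWindow L z))
      ≤ ∑ a, (|(e h z.2.1 a).toReal - p (preWindow L z) a / windowMass f (preWindow L z)| +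
          |p (preWindow L z) a / windowMass f (preWindow L z)
            - (π ⟨h, hh⟩ (preWindow L z) a).toReal|) :=
        Finset.sum_le_sum fun a _ => abs_sub_le _ _ _
    _ ≤ _ := by
        rw [Finset.sum_add_distrib]
        refine add_le_add ?_ le_rfl
        have := sum_abs_sub_mixture_le (e h) (windowWeight f (preWindow L z))
          (windowWeight_nonneg f _) (by rwa [sum_windowWeight]) z.2.1
        rw [sum_windowWeight] at this
        simpa only [hp, obsLaw_toReal] using this

/-- The contraction of the filter gives the exponent `L / 2`, which is better than `L / 9`. -/
theorem two_sqrt_pow_le {δ : ℝ} (hδ : 0 < δ) (hδ1 : 4 * δ ≤ 1) (L : ℕ) :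
    (2 * √δ) ^ L ≤ (4 * δ) ^ ((L : ℝ) / 9) := by
  have h4 : (0 : ℝ) < 4 * δ := by positivity
  have h1 : 2 * √δ = (4 * δ) ^ (1 / 2 : ℝ) := by
    rw [← Real.sqrt_eq_rpow, Real.sqrt_mul (by norm_num)]
    congr 1
    rw [show (4 : ℝ) = 2 ^ 2 by norm_num, Real.sqrt_sq (by norm_num)]
  rw [h1, ← Real.rpow_natCast, ← Real.rpow_mul h4.le]
  refine Real.rpow_le_rpow_of_exponent_ge h4 hδ1 ?_
  have : (0 : ℝ) ≤ L := Nat.cast_nonneg L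
  linarith

/-- The decoding errors of short histories form a geometric series: two more steps gain a factor
`4 δ ≤ 1 / 4`. -/
theorem sum_short_window_error_le {δ : ℝ} (hδ : 0 < δ) (hδ1 : 16 * δ ≤ 1) (m : ℕ) :
    ∑ h ∈ Finset.range m, 2 * (2 ^ (h + 1) * δ ^ ((h + 2) / 2)) ≤ 32 * δ := by
  have h1 : ∀ h, 2 * (2 ^ (h + 1) * δ ^ ((h + 2) / 2)) ≤ 16 * δ * (1 / 2) ^ h := by
    intro h
    have e : (h + 2) / 2 = h / 2 + 1 := by omega
    have h2 : δ ^ (h / 2) ≤ (1 / 16) ^ (h / 2) := pow_le_pow_left₀ hδ.le (by linarith) _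
    have h3 : (1 / 16 : ℝ) ^ (h / 2) = (1 / 4) ^ (2 * (h / 2)) := by
      rw [pow_mul]
      norm_num
    have h4 : (1 / 4 : ℝ) ^ (2 * (h / 2)) * (1 / 4) ≤ (1 / 4) ^ h := by
      rw [← pow_succ]
      exact pow_le_pow_of_le_one (by norm_num) (by norm_num) (by omega)
    have h5 : δ ^ (h / 2) ≤ 4 * (1 / 4) ^ h := by
      rw [h3] at h2
      linarith
    have h6 : (2 : ℝ) ^ h * (1 / 4) ^ h = (1 / 2) ^ h := by
      rw [← mul_pow]
      norm_num
    calc 2 * (2 ^ (h + 1) * δ ^ ((h + 2) / 2)) = 4 * δ * 2 ^ h * δ ^ (h / 2) := by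
          rw [e]; ring
      _ ≤ 4 * δ * 2 ^ h * (4 * (1 / 4) ^ h) := mul_le_mul_of_nonneg_left h5 (by positivity)
      _ = 16 * δ * (2 ^ h * (1 / 4) ^ h) := by ring
      _ = _ := by rw [h6]
  refine (Finset.sum_le_sum fun h _ => h1 h).trans ?_
  rw [← Finset.mul_sum]
  have := sum_geometric_two_le m
  nlinarith

/-- The deterministic part of the analysis: if every step fits, the trajectory laws are close. -/
theorem tv_le_of_fitsStep (e : P.LatentPolicy) {L : ℕ} (hL : 1 ≤ L) {δ : ℝ} (hδ : 0 < δ)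
    (hδ1 : 16 * δ ≤ 1) (hP : P.IsPerturbedBlock δ) (hD : P.DeterministicTransitions) {t : ℝ}
    (π : P.Executable L P.H) (hfit : ∀ h (hh : h < P.H), FitsStep e t π h hh) :
    P.tv (P.ofLatent e) (P.ofExecutable π) ≤
      32 * δ + (4 * δ) ^ ((L : ℝ) / 9) * P.maxS * P.H + P.H * ((P.maxA : ℝ) ^ L * t) := by
  set B := (4 * δ) ^ ((L : ℝ) / 9) * (P.maxS : ℝ)
  have hB : 0 ≤ B := by positivity
  have hstep : ∀ h ∈ Finset.range P.H,
      (expect (P.preLaw (P.ofExecutable π) h) fun z => l1 (P.ofLatent e h z.1 z.2.1 z.2.2)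
        (P.ofExecutable π h z.1 z.2.1 z.2.2)) ≤
      2 * (2 * (2 ^ (h + 1) * δ ^ ((h + 2) / 2)) + B + (P.maxA : ℝ) ^ L * t) := by
    intro h hh
    rw [Finset.mem_range] at hh
    have hsub : h - L ≤ P.H := (Nat.sub_le h L).trans hh.le
    refine (expect_step_error_le e π hh (hfit h hh)).trans ?_
    have hdom : ∀ k ≤ h, ∀ τ, 0 < (P.law (P.ofExecutable π) k τ).toReal →
        0 < (P.law (P.follow (h - L) hsub π) k τ).toReal := fun k hk τ hτ =>
      follow_pos π le_rfl hsub (hk.trans hh.le) τ hτ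
    have hpost : (expect (P.preLaw (P.ofExecutable π) h) fun z =>
        1 - windowWeight (P.follow (h - L) hsub π) (preWindow L z) z.2.1 /
          windowMass (P.follow (h - L) hsub π) (preWindow L z)) ≤
        2 * (2 ^ (h + 1) * δ ^ ((h + 2) / 2)) + B := by
      rcases lt_or_ge h L with hLh | hLh
      · have := short_window_posterior_error_le hδ (by linarith) hP hD hL hLh hh le_rfl hsub π
          (hdom h le_rfl)
        exact this.trans (le_add_of_nonneg_right hB)
      · have h1 := full_window_posterior_error_le hδ.le hP hD hL hLh hh
          (f := P.follow (h - L) hsub π) (π := P.ofExecutable π)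
          (fun k hk τ s x => follow_of_not_lt hsub π (not_lt.2 hk) (τ, s, x)) hdom
          (law_follow_eq π le_rfl hsub le_rfl)
        have h2 : (2 * √δ) ^ L * (P.maxS : ℝ) ≤ B :=
          mul_le_mul_of_nonneg_right (two_sqrt_pow_le hδ (by linarith) L) (Nat.cast_nonneg _)
        have h3 : 0 ≤ 2 * (2 ^ (h + 1) * δ ^ ((h + 2) / 2)) := by positivity
        linarith
    linarith
  have hsum := (l1_law_le (P.ofLatent e) (P.ofExecutable π) P.H).trans (Finset.sum_le_sum hstep)
  rw [← Finset.mul_sum, Finset.sum_add_distrib, Finset.sum_add_distrib] at hsum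
  have hs := sum_short_window_error_le hδ hδ1 P.H
  simp only [Finset.sum_const, Finset.card_range, nsmul_eq_mul] at hsum
  rw [tv_eq_l1]
  linarith

/-! ### The probability that all steps fit -/

/-- The union bound for an experiment in two stages. -/
theorem toOuterMeasure_bind_le {α β : Type*} (p : PMF α) (f : α → PMF β) (s : Set β) (B : Set α)
    (c : ℝ≥0∞) (h : ∀ a ∉ B, (f a).toOuterMeasure s ≤ c) :
    (p.bind f).toOuterMeasure s ≤ p.toOuterMeasure B + c := by
  classical
  rw [PMF.toOuterMeasure_bind_apply, PMF.toOuterMeasure_apply]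
  calc ∑' a, p a * (f a).toOuterMeasure s ≤ ∑' a, (B.indicator p a + p a * c) := by
        refine ENNReal.tsum_le_tsum fun a => ?_
        by_cases ha : a ∈ B
        · rw [Set.indicator_of_mem ha]
          refine le_add_right ?_
          calc p a * (f a).toOuterMeasure s ≤ p a * 1 := by
                gcongr
                rw [PMF.toOuterMeasure_apply, ← (f a).tsum_coe]
                exact ENNReal.tsum_le_tsum fun b => Set.indicator_le_self _ _ _
            _ = p a := mul_one _
        · refine le_add_left ?_
          gcongr
          exact h a ha
    _ = _ := by rw [ENNReal.tsum_add, ENNReal.tsum_mul_right, p.tsum_coe, one_mul]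

theorem toOuterMeasure_eq_zero_of_disjoint {α : Type*} (p : PMF α) (s : Set α)
    (h : ∀ a ∈ p.support, a ∉ s) : p.toOuterMeasure s = 0 := by
  rw [PMF.toOuterMeasure_apply_eq_zero_iff]
  exact Set.disjoint_left.2 h

theorem follow_snoc {L h j : ℕ} (hj : j ≤ h) (π : P.Executable L h) (q : P.StepPolicy L h) :
    P.follow j (hj.trans (Nat.le_succ h))
      (Fin.snoc (α := fun k : Fin (h + 1) => P.StepPolicy L k) π q : P.Executable L (h + 1)) =
    P.follow j hj π := by
  funext k τ s x
  unfold follow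
  split_ifs with hk
  · have := Fin.snoc_castSucc (α := fun k : Fin (h + 1) => P.StepPolicy L k) q π
      ⟨k, hk.trans_le hj⟩
    exact congrFun this _
  · rfl

theorem fitsStep_snoc (e : P.LatentPolicy) {t : ℝ} {L h : ℕ} (π : P.Executable L h)
    (q : P.StepPolicy L h) {k : ℕ} (hk : k < h) (hfit : FitsStep e t π k hk) :
    FitsStep e t (Fin.snoc (α := fun k : Fin (h + 1) => P.StepPolicy L k) π q :
      P.Executable L (h + 1)) k (hk.trans (Nat.lt_succ_self h)) := by
  unfold FitsStep at hfit ⊢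
  rw [follow_snoc ((Nat.sub_le k L).trans hk.le)]
  have : (Fin.snoc (α := fun k : Fin (h + 1) => P.StepPolicy L k) π q : P.Executable L (h + 1))
      ⟨k, hk.trans (Nat.lt_succ_self h)⟩ = π ⟨k, hk⟩ :=
    Fin.snoc_castSucc (α := fun k : Fin (h + 1) => P.StepPolicy L k) q π ⟨k, hk⟩
  rw [this]
  exact hfit

theorem fitsStep_snoc_last (e : P.LatentPolicy) {t : ℝ} {L h : ℕ} (π : P.Executable L h)
    (q : P.StepPolicy L h)
    (hfit : ∑ w, ∑ a, |(∑ b, (P.obsLaw e L h (P.follow (h - L) (Nat.sub_le h L) π) (w, b)).toReal)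
        * (q w a).toReal
      - (P.obsLaw e L h (P.follow (h - L) (Nat.sub_le h L) π) (w, a)).toReal| ≤ 2 * t) :
    FitsStep e t (Fin.snoc (α := fun k : Fin (h + 1) => P.StepPolicy L k) π q :
      P.Executable L (h + 1)) h (Nat.lt_succ_self h) := by
  unfold FitsStep
  rw [follow_snoc (Nat.sub_le h L)]
  have : (Fin.snoc (α := fun k : Fin (h + 1) => P.StepPolicy L k) π q : P.Executable L (h + 1))
      ⟨h, Nat.lt_succ_self h⟩ = q :=
    Fin.snoc_last (α := fun k : Fin (h + 1) => P.StepPolicy L k) q π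
  rw [this]
  exact hfit

/-- If the frequencies of windows and expert actions deviate little, a maximizer of the likelihood
fits. -/
theorem fits_of_deviation_le (e : P.LatentPolicy) {L n h : ℕ} (hn : 0 < n) (hh : h < P.H) {t : ℝ}
    (f : P.Policy) (D : Fin n → P.Sample h) (q : P.StepPolicy L h)
    (hq : ∀ q' : P.StepPolicy L h, P.logLik hh D q' ≤ P.logLik hh D q)
    (hdev : ∑ z, |(tally (fun i => visible L hh (D i)) z : ℝ) - n * (P.obsLaw e L h f z).toReal|
      ≤ n * t) :
    ∑ w, ∑ a, |(∑ b, (P.obsLaw e L h f (w, b)).toReal) * (q w a).toReal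
      - (P.obsLaw e L h f (w, a)).toReal| ≤ 2 * t := by
  set V := fun i => visible L hh (D i)
  have h1 := mul_sum_tally_eq_of_prod_le (P.nA_pos h) V q
    (prod_le_of_logLik_le hn hh D (empirical (P.nA_pos h) V) q (hq _))
  have h2 := sum_abs_sub_le_of_maximal V q h1 fun z => (P.obsLaw e L h f z).toReal
  have hn' : (0 : ℝ) < n := by exact_mod_cast hn
  simp only [abs_mul, abs_of_pos hn', ← Finset.mul_sum] at h2
  refine le_of_mul_le_mul_left (h2.trans ?_) hn'
  linarith

/-- The union bound over the rounds. The deviation bound `hc` has to hold for every roll-in policy,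
as the roll-in policy of a round depends on the previous ones. -/
theorem forward_bad_le (e : P.LatentPolicy) {L n : ℕ} (hn : 0 < n) (sel : P.Rule L n)
    (hsel : P.IsArgmaxRule sel) {t : ℝ} {c : ℝ≥0∞}
    (hc : ∀ h, h < P.H → ∀ f : P.Policy, (iid (P.obsLaw e L h f) n).toOuterMeasure
      {D | n * t < ∑ z, |(tally D z : ℝ) - n * (P.obsLaw e L h f z).toReal|} ≤ c)
    (h : ℕ) (hh : h ≤ P.H) :
    (P.forward e sel h hh).toOuterMeasure {π | ∃ k, ∃ hk : k < h, ¬ FitsStep e t π k hk} ≤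
      h * c := by
  induction h with
  | zero =>
    refine le_of_eq_of_le (toOuterMeasure_eq_zero_of_disjoint _ _ fun π _ => ?_) zero_le
    rintro ⟨k, hk, -⟩
    exact Nat.not_lt_zero k hk
  | succ h ih =>
    rw [forward, Nat.cast_succ, add_mul, one_mul]
    refine (toOuterMeasure_bind_le _ _ _ {π | ∃ k, ∃ hk : k < h, ¬ FitsStep e t π k hk} c
      fun π hπ => ?_).trans (add_le_add (ih (Nat.le_of_succ_le hh)) le_rfl)
    set f := P.follow (h - L) (Nat.sub_le h L) π with hf
    set Bad : Set (Fin n → P.Sample h) := {D | n * t <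
      ∑ z, |(tally (fun i => visible L hh (D i)) z : ℝ) - n * (P.obsLaw e L h f z).toReal|}
    have hBad : (iid (P.sampleLaw e hh π) n).toOuterMeasure Bad ≤ c := by
      have := hc h hh f
      rw [hf, ← map_visible_sampleLaw e hh π, ← map_iid, PMF.toOuterMeasure_map_apply,
        map_visible_sampleLaw e hh π] at this
      exact this
    refine (toOuterMeasure_bind_le _ _ _ Bad 0 fun D hD => ?_).trans (by rwa [add_zero])
    rw [PMF.toOuterMeasure_map_apply]
    refine le_of_eq (toOuterMeasure_eq_zero_of_disjoint _ _ fun q hq => ?_)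
    rintro ⟨k, hk, hbad⟩
    apply hbad
    rcases (Nat.lt_succ_iff.1 hk).lt_or_eq with hkh | rfl
    · refine fitsStep_snoc e π q hkh ?_
      by_contra hno
      exact hπ ⟨k, hkh, hno⟩
    · refine fitsStep_snoc_last e π q ?_
      exact fits_of_deviation_le e hn hh f D q (hsel k hh π D q hq) (not_lt.1 hD)

theorem card_window_mul_le {L h : ℕ} (hh : h < P.H) :
    Fintype.card (P.Window L h × Fin (P.nA h)) ≤ P.maxX ^ L * P.maxA ^ (L + 1) := by
  have hX := one_le_maxX (P := P) (Nat.zero_lt_of_lt hh)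
  have hA := one_le_maxA (P := P) (Nat.zero_lt_of_lt hh)
  have h1 : Fintype.card ((k : Finset.Icc (h + 1 - L) h) → Fin (P.nX k)) ≤ P.maxX ^ L := by
    rw [Fintype.card_pi]
    simp only [Fintype.card_fin]
    refine (Finset.prod_le_pow_card _ _ P.maxX fun k _ => ?_).trans ?_
    · exact nX_le_maxX ((Finset.mem_Icc.1 k.2).2.trans_lt hh)
    · refine Nat.pow_le_pow_right hX ?_
      simp
      omega
  have h2 : Fintype.card ((k : Finset.Ico (h - L) h) → Fin (P.nA k)) ≤ P.maxA ^ L := by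
    rw [Fintype.card_pi]
    simp only [Fintype.card_fin]
    refine (Finset.prod_le_pow_card _ _ P.maxA fun k _ => ?_).trans ?_
    · exact nA_le_maxA ((Finset.mem_Ico.1 k.2).2.trans hh)
    · refine Nat.pow_le_pow_right hA ?_
      simp
      omega
  rw [Fintype.card_prod, Fintype.card_prod, Fintype.card_fin, pow_succ, ← mul_assoc]
  exact Nat.mul_le_mul (Nat.mul_le_mul h1 h2) (nA_le_maxA hh)

/-- The arithmetic of the sample size. With `M = X ^ L * A ^ (L + 1)` pairs of a window and an action
and accuracy `t = ε / (H * A ^ L)`, the deviation bound needs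
`n t² / 8 ≥ M log 2 + log (H / η)`, and both terms are at most `M log (H n / η)`. -/
theorem sample_size_bound {H n N X A : ℕ} {L : ℕ} {η ε : ℝ} (hHn : 2 ≤ H * n) (hη : 0 < η)
    (hη1 : η ≤ 1) (hε : 0 < ε) (hA : 1 ≤ A) (hX : 1 ≤ X) (hN : N ≤ X ^ L * A ^ (L + 1))
    (h : 16 * (X : ℝ) ^ L * (A : ℝ) ^ (3 * L + 1) * (H : ℝ) ^ 2 * (ε ^ 2)⁻¹
      * Real.log ((H : ℝ) * (n : ℝ) / η) ≤ (n : ℝ)) :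
    2 ^ N * Real.exp (-(n * (ε / (H * (A : ℝ) ^ L)) ^ 2 / 8)) ≤ η / H := by
  have hH0 : 0 < H := Nat.pos_of_ne_zero fun h0 => by simp [h0] at hHn
  have hn0 : 0 < n := Nat.pos_of_ne_zero fun h0 => by simp [h0] at hHn
  have hH : (1 : ℝ) ≤ H := by exact_mod_cast hH0
  have hn : (1 : ℝ) ≤ n := by exact_mod_cast hn0
  have hA' : (1 : ℝ) ≤ A := by exact_mod_cast hA
  have hX' : (1 : ℝ) ≤ X := by exact_mod_cast hX
  have hHn' : (2 : ℝ) ≤ H * n := by exact_mod_cast hHn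
  set l := Real.log ((H : ℝ) * n / η) with hl
  set M : ℝ := (X : ℝ) ^ L * (A : ℝ) ^ (L + 1) with hM
  have hM1 : 1 ≤ M := one_le_mul_of_one_le_of_one_le (one_le_pow₀ hX') (one_le_pow₀ hA')
  have hNM : (N : ℝ) ≤ M := by
    rw [hM]
    exact_mod_cast hN
  have hl2 : Real.log 2 ≤ l := by
    refine Real.log_le_log (by norm_num) ?_
    rw [le_div_iff₀ hη]
    nlinarith
  have hlH : Real.log (H / η) ≤ l := by
    refine Real.log_le_log (by positivity) ?_
    refine div_le_div_of_nonneg_right ?_ hη.le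
    nlinarith
  have hl0 : 0 ≤ l := (Real.log_nonneg (by norm_num)).trans hl2
  have key : 2 * M * l ≤ n * (ε / (H * (A : ℝ) ^ L)) ^ 2 / 8 := by
    have hA0 : (0 : ℝ) < (A : ℝ) ^ L := by positivity
    have hpos : 0 < ((H : ℝ) * (A : ℝ) ^ L) ^ 2 := by positivity
    rw [div_pow, mul_div_assoc', le_div_iff₀ (by norm_num), le_div_iff₀ hpos]
    have h1 := mul_le_mul_of_nonneg_right h (sq_nonneg ε)
    calc 2 * M * l * 8 * ((H : ℝ) * (A : ℝ) ^ L) ^ 2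
        = 16 * (X : ℝ) ^ L * (A : ℝ) ^ (3 * L + 1) * (H : ℝ) ^ 2 * (ε ^ 2)⁻¹ * l * ε ^ 2 := by
          rw [hM]
          field_simp
          ring
      _ ≤ n * ε ^ 2 := h1
  have h2 : N * Real.log 2 + Real.log (H / η) ≤ 2 * M * l := by
    have h3 : N * Real.log 2 ≤ M * l :=
      mul_le_mul hNM hl2 (Real.log_nonneg (by norm_num)) (by linarith)
    have h4 : l ≤ M * l := le_mul_of_one_le_left hl0 hM1
    linarith
  have h5 : (2 : ℝ) ^ N = Real.exp (N * Real.log 2) := by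
    rw [Real.exp_nat_mul, Real.exp_log (by norm_num)]
  have h6 : η / H = Real.exp (-Real.log (H / η)) := by
    rw [← Real.log_inv, Real.exp_log (by positivity), inv_div]
  rw [h5, h6, ← Real.exp_add]
  exact Real.exp_le_exp.2 (by linarith)

/-- The statistical guarantee, with explicit constants. -/
theorem value_and_tv_bound (P : POMDP) (e : P.LatentPolicy) (L n : ℕ) (δ η ε : ℝ)
    (hR : P.NormalizedRewards) (hL : 1 ≤ L) (hHn : 2 ≤ P.H * n) (hδ : 0 < δ) (hη : 0 < η)
    (hε : 0 < ε) (hP : P.IsPerturbedBlock δ) (hD : P.DeterministicTransitions)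
    (hsize : 16 * (P.maxX : ℝ) ^ L * (P.maxA : ℝ) ^ (3 * L + 1) * (P.H : ℝ) ^ 2 * (ε ^ 2)⁻¹
      * Real.log ((P.H : ℝ) * (n : ℝ) / η) ≤ (n : ℝ)) (sel : P.Rule L n)
    (hsel : P.IsArgmaxRule sel) :
    ENNReal.ofReal (1 - η) ≤ (P.forward e sel P.H le_rfl).toOuterMeasure
      {π | P.value (P.ofLatent e) - P.value (P.ofExecutable π)
            ≤ P.tv (P.ofLatent e) (P.ofExecutable π) ∧
          P.tv (P.ofLatent e) (P.ofExecutable π)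
            ≤ 32 * δ + (4 * δ) ^ ((L : ℝ) / 9) * (P.maxS : ℝ) * (P.H : ℝ) + ε} := by
  rcases lt_or_ge 1 η with hη1 | hη1
  -- for `η > 1` nothing is claimed
  · rw [ENNReal.ofReal_of_nonpos (by linarith)]
    exact zero_le
  have hH : 0 < P.H := Nat.pos_of_ne_zero fun h0 => by simp [h0] at hHn
  have hn : 0 < n := Nat.pos_of_ne_zero fun h0 => by simp [h0] at hHn
  have hHr : (0 : ℝ) < P.H := by exact_mod_cast hH
  have hA : (0 : ℝ) < (P.maxA : ℝ) ^ L := by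
    have : (0 : ℝ) < P.maxA := by exact_mod_cast one_le_maxA hH
    positivity
  set t := ε / (P.H * (P.maxA : ℝ) ^ L) with ht
  have ht0 : 0 ≤ t := by positivity
  have hHt : (P.H : ℝ) * ((P.maxA : ℝ) ^ L * t) = ε := by
    rw [ht]
    field_simp
  set Good : Set (P.Executable L P.H) := {π | P.value (P.ofLatent e) - P.value (P.ofExecutable π)
            ≤ P.tv (P.ofLatent e) (P.ofExecutable π) ∧
          P.tv (P.ofLatent e) (P.ofExecutable π)
            ≤ 32 * δ + (4 * δ) ^ ((L : ℝ) / 9) * (P.maxS : ℝ) * (P.H : ℝ) + ε}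
  set Bad : Set (P.Executable L P.H) := {π | ∃ k, ∃ hk : k < P.H, ¬ FitsStep e t π k hk}
  have hgb : Badᶜ ⊆ Good := by
    intro π hπ
    refine ⟨value_sub_le_tv hR _ _, ?_⟩
    rcases le_or_gt (16 * δ) 1 with h16 | h16
    · rw [← hHt]
      refine tv_le_of_fitsStep e hL hδ h16 hP hD π fun h hh => ?_
      by_contra hno
      exact hπ ⟨h, hh, hno⟩
    -- for `δ > 1 / 16` the term `32 δ` exceeds the largest possible total variation distance
    · have h1 := tv_le_one (P.ofLatent e) (P.ofExecutable π)
      have h2 : 0 ≤ (4 * δ) ^ ((L : ℝ) / 9) * (P.maxS : ℝ) * (P.H : ℝ) := by positivity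
      linarith
  have hbad : (P.forward e sel P.H le_rfl).toOuterMeasure Bad ≤ ENNReal.ofReal η := by
    have h1 := forward_bad_le e hn sel hsel (t := t) (c := ENNReal.ofReal (η / P.H))
      (fun h hh f => (tally_deviation_prob_le (P.obsLaw e L h f) n ht0).trans
        (ENNReal.ofReal_le_ofReal (sample_size_bound hHn hη hη1 hε (one_le_maxA hH) (one_le_maxX hH)
          (card_window_mul_le hh) hsize))) P.H le_rfl
    refine h1.trans (le_of_eq ?_)
    rw [← ENNReal.ofReal_natCast, ← ENNReal.ofReal_mul hHr.le, mul_div_cancel₀ _ hHr.ne']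
  have htotal : 1 ≤ (P.forward e sel P.H le_rfl).toOuterMeasure Bad +
      (P.forward e sel P.H le_rfl).toOuterMeasure Good := by
    have h1 : (P.forward e sel P.H le_rfl).toOuterMeasure (Bad ∪ Good) = 1 := by
      rw [PMF.toOuterMeasure_apply_eq_one_iff]
      intro π _
      by_cases h : π ∈ Bad
      · exact Or.inl h
      · exact Or.inr (hgb h)
    rw [← h1]
    exact MeasureTheory.measure_union_le _ _
  calc ENNReal.ofReal (1 - η) = 1 - ENNReal.ofReal η := by
        rw [ENNReal.ofReal_sub _ hη.le, ENNReal.ofReal_one]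
    _ ≤ 1 - (P.forward e sel P.H le_rfl).toOuterMeasure Bad := tsub_le_tsub_left hbad _
    _ ≤ _ := tsub_le_iff_left.2 htotal

end POMDP

/-! ### Couplings -/

/-- A coupling of two laws that is carried by the relation `R`. This is the correctness notion for
programs: the law of the configuration on one side, the law of the ideal object on the other. -/
def Couples {α β : Type*} (μ : PMF α) (ν : PMF β) (R : α → β → Prop) : Prop :=
  ∃ κ : PMF (α × β), κ.map Prod.fst = μ ∧ κ.map Prod.snd = ν ∧ ∀ x ∈ κ.support, R x.1 x.2

section Couples

variable {α β γ α' β' : Type*}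

theorem bind_congr_support (p : PMF α) {f g : α → PMF β} (h : ∀ a ∈ p.support, f a = g a) :
    p.bind f = p.bind g := by
  ext b
  rw [PMF.bind_apply, PMF.bind_apply]
  refine tsum_congr fun a => ?_
  by_cases ha : a ∈ p.support
  · rw [h a ha]
  · rw [(PMF.apply_eq_zero_iff p a).2 ha, zero_mul, zero_mul]

theorem map_congr_support (p : PMF α) {f g : α → β} (h : ∀ a ∈ p.support, f a = g a) :
    p.map f = p.map g := by
  rw [← PMF.bind_pure_comp, ← PMF.bind_pure_comp]
  exact bind_congr_support p fun a ha => by simp [h a ha]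

theorem Couples.mono {μ : PMF α} {ν : PMF β} {R R' : α → β → Prop} (h : Couples μ ν R)
    (hR : ∀ a b, R a b → R' a b) : Couples μ ν R' := by
  obtain ⟨κ, h1, h2, h3⟩ := h
  exact ⟨κ, h1, h2, fun x hx => hR _ _ (h3 x hx)⟩

theorem Couples.exists_of_mem_support {α β : Type*} {μ : PMF α} {ν : PMF β} {R : α → β → Prop}
    (h : Couples μ ν R) {a : α} (ha : a ∈ μ.support) : ∃ b, R a b := by
  obtain ⟨κ, rfl, -, hκ⟩ := h
  obtain ⟨x, hx, rfl⟩ := (PMF.mem_support_map_iff _ _ _).1 ha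
  exact ⟨x.2, hκ x hx⟩

theorem couples_map (ν : PMF γ) (f : γ → α) (g : γ → β) {R : α → β → Prop}
    (h : ∀ c ∈ ν.support, R (f c) (g c)) : Couples (ν.map f) (ν.map g) R := by
  refine ⟨ν.map fun c => (f c, g c), by rw [PMF.map_comp]; rfl, by rw [PMF.map_comp]; rfl, ?_⟩
  intro x hx
  obtain ⟨c, hc, rfl⟩ := (PMF.mem_support_map_iff _ _ _).1 hx
  exact h c hc

theorem couples_pure_right (μ : PMF α) (b : β) {R : α → β → Prop} (h : ∀ a ∈ μ.support, R a b) :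
    Couples μ (PMF.pure b) R := by
  have := couples_map μ id (Function.const _ b) (R := R) h
  rwa [PMF.map_id, PMF.map_const] at this

theorem Couples.bind {μ : PMF α} {ν : PMF β} {R : α → β → Prop} (h : Couples μ ν R)
    {f : α → PMF α'} {g : β → PMF β'} {R' : α' → β' → Prop}
    (hfg : ∀ a b, R a b → Couples (f a) (g b) R') : Couples (μ.bind f) (ν.bind g) R' := by
  classical
  obtain ⟨κ, rfl, rfl, hκ⟩ := h
  have : ∀ x : α × β, ∃ κ' : PMF (α' × β'), x ∈ κ.support → κ'.map Prod.fst = f x.1 ∧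
      κ'.map Prod.snd = g x.2 ∧ ∀ y ∈ κ'.support, R' y.1 y.2 := by
    intro x
    by_cases hx : x ∈ κ.support
    · obtain ⟨κ', h'⟩ := hfg x.1 x.2 (hκ x hx)
      exact ⟨κ', fun _ => h'⟩
    · exact ⟨(f x.1).bind fun a => (g x.2).map fun b => (a, b), fun h' => absurd h' hx⟩
  choose κ' hκ' using this
  refine ⟨κ.bind κ', ?_, ?_, ?_⟩
  · rw [PMF.map_bind, PMF.bind_map]
    exact bind_congr_support κ fun x hx => (hκ' x hx).1
  · rw [PMF.map_bind, PMF.bind_map]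
    exact bind_congr_support κ fun x hx => (hκ' x hx).2.1
  · intro y hy
    obtain ⟨x, hx, hy⟩ := (PMF.mem_support_bind_iff _ _ _).1 hy
    exact (hκ' x hx).2.2 y hy

/-- Running a deterministic continuation on the left. -/
theorem Couples.bind_left {μ : PMF α} {ν : PMF β} {R : α → β → Prop} (h : Couples μ ν R)
    {f : α → PMF α'} {R' : α' → β → Prop} (hf : ∀ a b, R a b → ∀ a' ∈ (f a).support, R' a' b) :
    Couples (μ.bind f) ν R' := by
  rw [← PMF.bind_pure ν]
  exact h.bind fun a b hab => couples_pure_right _ _ (hf a b hab)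

theorem Couples.map_eq {μ : PMF α} {ν : PMF β} {F : α → β} (h : Couples μ ν fun a b => F a = b) :
    μ.map F = ν := by
  obtain ⟨κ, rfl, rfl, hκ⟩ := h
  rw [PMF.map_comp]
  exact map_congr_support κ hκ

end Couples

/-! ### Programs -/

section Iter

variable {α : Type*} (g : α → PMF α)

/-- `n` steps of the Markov chain with kernel `g`. -/
def iter : ℕ → α → PMF α
  | 0, c => PMF.pure c
  | n + 1, c => (g c).bind (iter n)

theorem iter_succ_right (n : ℕ) (c : α) : iter g (n + 1) c = (iter g n c).bind g := by
  induction n generalizing c with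
  | zero =>
    rw [iter, iter, PMF.pure_bind]
    exact PMF.bind_pure _
  | succ n ih =>
    rw [iter, iter, PMF.bind_bind]
    exact congrArg (PMF.bind (g c)) (funext fun c' => ih c')

theorem iterate_bind_eq (n : ℕ) (c : α) :
    (fun μ : PMF α => μ.bind g)^[n] (PMF.pure c) = iter g n c := by
  induction n with
  | zero => rfl
  | succ n ih => rw [Function.iterate_succ_apply', ih, iter_succ_right]

theorem iter_support (Q : ℕ → α → Prop) (n : ℕ) (c : α) (h0 : Q 0 c)
    (hs : ∀ i < n, ∀ c, Q i c → ∀ c' ∈ (g c).support, Q (i + 1) c') :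
    ∀ c' ∈ (iter g n c).support, Q n c' := by
  induction n with
  | zero =>
    intro c' hc'
    rw [iter, PMF.mem_support_pure_iff] at hc'
    rwa [hc']
  | succ n ih =>
    intro c' hc'
    rw [iter_succ_right, PMF.mem_support_bind_iff] at hc'
    obtain ⟨b, hb, hc'⟩ := hc'
    exact hs n (Nat.lt_succ_self n) b (ih (fun i hi => hs i (hi.trans (Nat.lt_succ_self n))) b hb)
      c' hc'

end Iter

theorem Prog.run_loop (P : POMDP) (e : P.LatentPolicy) (f : Expr) (p : Prog) (c : Config P) :
    (Prog.loop f p).run P e c =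
      iter (fun c' => p.run P e (c'.tick 1)) (f.val c.mem) (c.tick (f.cost + 1)) := by
  rw [Prog.run, iterate_bind_eq]

section ConfigLemmas

variable {P : POMDP} (c : Config P) (t k i v : ℕ)

@[simp] theorem Config.tick_mem : (c.tick t).mem = c.mem := rfl
@[simp] theorem Config.tick_time : (c.tick t).time = c.time + t := rfl
@[simp] theorem Config.tick_episodes : (c.tick t).episodes = c.episodes := rfl
@[simp] theorem Config.write_time : (c.write k i v).time = c.time := rfl
@[simp] theorem Config.write_episodes : (c.write k i v).episodes = c.episodes := rfl

end ConfigLemmas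

/-- Memory with one entry replaced. -/
def Mem.put (m : Mem) (k i v : ℕ) : Mem := fun k' i' => if k' = k ∧ i' = i then v else m k' i'

@[simp] theorem Config.write_mem {P : POMDP} (c : Config P) (k i v : ℕ) :
    (c.write k i v).mem = c.mem.put k i v := rfl

theorem Mem.put_same (m : Mem) (k i v : ℕ) : m.put k i v k i = v := by simp [Mem.put]

theorem Mem.put_of_ne (m : Mem) {k k' : ℕ} (h : k' ≠ k) (i v : ℕ) : m.put k i v k' = m k' := by
  funext i'
  simp [Mem.put, h]

theorem Mem.put_of_ne_index (m : Mem) (k : ℕ) {i i' : ℕ} (h : i' ≠ i) (v : ℕ) :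
    m.put k i v k i' = m k i' := by
  simp [Mem.put, h]

/-! ### Running time and number of episodes -/

namespace Prog

/-- The polynomial variable that bounds the parameter in entry `j` of array `0`: the variables
stand for `n`, `H`, `X ^ L`, `A ^ L`. -/
def paramVar : ℕ → MvPolynomial (Fin 4) ℕ
  | 0 => MvPolynomial.X 0
  | 1 => MvPolynomial.X 1
  | 2 => MvPolynomial.X 1
  | 3 => MvPolynomial.X 2
  | 4 => MvPolynomial.X 3
  | _ => 0

/-- The number of iterations of a loop is the value of a parameter. -/
def loopParam : Expr → Option ℕ
  | .get 0 (.lit j) => some j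
  | _ => none

/-- The parameters are never overwritten, all loops are bounded by parameters, and no episode
starts inside a conditional. -/
def Safe : Prog → Prop
  | set k _ _ => k ≠ 0
  | seq p q => Safe p ∧ Safe q
  | ite _ p q => Safe p ∧ Safe q
  | loop f p => (loopParam f).isSome ∧ Safe p
  | rand k _ _ => k ≠ 0
  | reset k _ => k ≠ 0
  | act k _ _ => k ≠ 0
  | expert k _ => k ≠ 0

/-- A bound for the running time that can be read off the program text. -/
def timePoly : Prog → MvPolynomial (Fin 4) ℕ
  | set _ i f => (i.cost + f.cost + 1 : ℕ)
  | seq p q => timePoly p + timePoly q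
  | ite f p q => (f.cost + 1 : ℕ) + timePoly p + timePoly q
  | loop f p => (f.cost + 1 : ℕ) + ((loopParam f).elim 0 paramVar) * (timePoly p + 1)
  | rand _ i f => (i.cost + f.cost + 1 : ℕ)
  | reset _ i => (i.cost + 1 : ℕ)
  | act _ i f => (i.cost + f.cost + 1 : ℕ)
  | expert _ i => (i.cost + 1 : ℕ)

/-- The number of episodes that a program starts, for given parameters. Conditionals are assumed to
start as many episodes in both branches. -/
def resets (v : ℕ → ℕ) : Prog → ℕ
  | seq p q => resets v p + resets v q
  | ite _ p _ => resets v p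
  | loop f p => ((loopParam f).elim 0 v) * resets v p
  | reset _ _ => 1
  | _ => 0

/-- Both branches of each conditional start the same number of episodes. -/
def Balanced (v : ℕ → ℕ) : Prog → Prop
  | seq p q => Balanced v p ∧ Balanced v q
  | ite _ p q => Balanced v p ∧ Balanced v q ∧ resets v p = resets v q
  | loop _ p => Balanced v p
  | _ => True

theorem eq_of_loopParam {f : Expr} {j : ℕ} (h : loopParam f = some j) : f = .get 0 (.lit j) := by
  unfold loopParam at h
  split at h
  · simp_all
  · simp at h

/-- The static analysis is correct: the parameters are kept, the running time is at most the value of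
`timePoly`, and the number of episodes is exactly `resets`. -/
theorem run_time_episodes {P : POMDP} (e : P.LatentPolicy) {v : ℕ → ℕ} {x : Fin 4 → ℕ}
    (hv : ∀ j, v j ≤ MvPolynomial.eval x (paramVar j)) (p : Prog) (hp : p.Safe) (hb : p.Balanced v)
    (c : Config P) (hc : c.mem 0 = v) :
    ∀ c' ∈ (p.run P e c).support, c'.mem 0 = v ∧
      c'.time ≤ c.time + MvPolynomial.eval x p.timePoly ∧
      c'.episodes = c.episodes + p.resets v := by
  have hput : ∀ (m : Mem) (k i w : ℕ), k ≠ 0 → m 0 = v → m.put k i w 0 = v := by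
    intro m k i w hk hm
    rw [Mem.put_of_ne _ hk.symm, hm]
  induction p generalizing c with
  | set k i f =>
    intro c' hc'
    rw [run, PMF.mem_support_pure_iff] at hc'
    subst hc'
    refine ⟨hput _ _ _ _ hp hc, ?_, ?_⟩
    · simp [timePoly]
    · simp [resets]
  | seq p q ihp ihq =>
    intro c' hc'
    rw [run, PMF.mem_support_bind_iff] at hc'
    obtain ⟨b, hb', hc'⟩ := hc'
    obtain ⟨h1, h2, h3⟩ := ihp hp.1 hb.1 c hc b hb'
    obtain ⟨h1', h2', h3'⟩ := ihq hp.2 hb.2 b h1 c' hc'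
    refine ⟨h1', ?_, ?_⟩
    · simp only [timePoly, map_add]
      omega
    · rw [h3', h3, resets, add_assoc]
  | ite f p q ihp ihq =>
    intro c' hc'
    rw [run] at hc'
    split_ifs at hc' with hf
    · obtain ⟨h1, h2, h3⟩ := ihp hp.1 hb.1 (c.tick (f.cost + 1)) hc c' hc'
      refine ⟨h1, ?_, ?_⟩
      · simp [timePoly] at h2 ⊢
        omega
      · simpa [resets] using h3
    · obtain ⟨h1, h2, h3⟩ := ihq hp.2 hb.2.1 (c.tick (f.cost + 1)) hc c' hc'
      refine ⟨h1, ?_, ?_⟩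
      · simp [timePoly] at h2 ⊢
        omega
      · rw [h3, resets, hb.2.2, Config.tick_episodes]
  | loop f p ih =>
    intro c' hc'
    obtain ⟨hf, hp'⟩ := hp
    obtain ⟨j, hj⟩ := Option.isSome_iff_exists.1 hf
    have hfe := eq_of_loopParam hj
    rw [run_loop] at hc'
    have hval : f.val c.mem = v j := by rw [hfe]; simp [Expr.val, hc]
    have := iter_support (fun c' => p.run P e (c'.tick 1))
      (fun i c' => c'.mem 0 = v ∧
        c'.time ≤ c.time + (f.cost + 1) + i * (MvPolynomial.eval x p.timePoly + 1) ∧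
        c'.episodes = c.episodes + i * p.resets v) (f.val c.mem) (c.tick (f.cost + 1))
      ⟨hc, by simp, by simp⟩ (by
        rintro i - b ⟨h1, h2, h3⟩ b' hb'
        obtain ⟨h1', h2', h3'⟩ := ih hp' hb (b.tick 1) h1 b' hb'
        refine ⟨h1', ?_, ?_⟩
        · simp only [Config.tick_time] at h2'
          rw [add_mul, one_mul]
          omega
        · rw [h3', Config.tick_episodes, h3, add_mul, one_mul, add_assoc]) c' hc'
    obtain ⟨h1, h2, h3⟩ := this
    refine ⟨h1, ?_, ?_⟩
    · have hle := Nat.mul_le_mul_right (MvPolynomial.eval x p.timePoly + 1) (hv j)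
      rw [hval] at h2
      simp only [timePoly, hj, Option.elim_some, map_add, map_mul, map_one, map_natCast,
        Nat.cast_id]
      omega
    · rw [h3, hval, resets, hj, Option.elim_some]
  | rand k i f =>
    intro c' hc'
    rw [run] at hc'
    obtain ⟨r, -, rfl⟩ := (PMF.mem_support_map_iff _ _ _).1 hc'
    refine ⟨hput _ _ _ _ hp hc, ?_, ?_⟩
    · simp [timePoly]
    · simp [resets]
  | reset k i =>
    intro c' hc'
    rw [run, PMF.mem_support_bind_iff] at hc'
    obtain ⟨s, -, hc'⟩ := hc'
    obtain ⟨y, -, rfl⟩ := (PMF.mem_support_map_iff _ _ _).1 hc'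
    refine ⟨hput _ _ _ _ hp hc, ?_, ?_⟩
    · simp [timePoly]
    · simp [resets]
  | act k i f =>
    intro c' hc'
    rw [run] at hc'
    obtain ⟨o, -, rfl⟩ := (PMF.mem_support_map_iff _ _ _).1 hc'
    rcases o with _ | ⟨env', y⟩
    · refine ⟨hc, ?_, ?_⟩
      · simp [timePoly]
      · simp [resets]
    · refine ⟨hput _ _ _ _ hp hc, ?_, ?_⟩
      · simp [timePoly]
      · simp [resets]
  | expert k i =>
    intro c' hc'
    rw [run] at hc'
    split at hc'
    · rw [PMF.mem_support_pure_iff] at hc'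
      subst hc'
      refine ⟨hc, ?_, ?_⟩
      · simp [timePoly]
      · simp [resets]
    · obtain ⟨y, -, rfl⟩ := (PMF.mem_support_map_iff _ _ _).1 hc'
      refine ⟨hput _ _ _ _ hp hc, ?_, ?_⟩
      · simp [timePoly]
      · simp [resets]

/-! ### Deterministic programs -/

/-- Programs that only compute: no randomness, no interaction. -/
def Det : Prog → Prop
  | set _ _ _ => True
  | seq p q => Det p ∧ Det q
  | ite _ p q => Det p ∧ Det q
  | loop _ p => Det p
  | _ => False

/-- The effect of a deterministic program on the memory. -/
def exec : Prog → Mem → Mem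
  | set k i f, m => m.put k (i.val m) (f.val m)
  | seq p q, m => exec q (exec p m)
  | ite f p q, m => if f.val m ≠ 0 then exec p m else exec q m
  | loop f p, m => (exec p)^[f.val m] m
  | _, m => m

theorem run_det {P : POMDP} (e : P.LatentPolicy) (p : Prog) (hp : p.Det) (c : Config P) :
    ∀ c' ∈ (p.run P e c).support, c'.mem = p.exec c.mem ∧ c'.env = c.env := by
  induction p generalizing c with
  | set k i f =>
    intro c' hc'
    rw [run, PMF.mem_support_pure_iff] at hc'
    subst hc'
    exact ⟨rfl, rfl⟩
  | seq p q ihp ihq =>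
    intro c' hc'
    rw [run, PMF.mem_support_bind_iff] at hc'
    obtain ⟨b, hb, hc'⟩ := hc'
    obtain ⟨h1, h2⟩ := ihp hp.1 c b hb
    obtain ⟨h1', h2'⟩ := ihq hp.2 b c' hc'
    exact ⟨by rw [h1', h1, exec], h2'.trans h2⟩
  | ite f p q ihp ihq =>
    intro c' hc'
    rw [run] at hc'
    rw [exec]
    split_ifs at hc' ⊢ with hf
    · exact ihp hp.1 (c.tick (f.cost + 1)) c' hc'
    · exact ihq hp.2 (c.tick (f.cost + 1)) c' hc'
  | loop f p ih =>
    intro c' hc'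
    rw [run_loop] at hc'
    exact iter_support (fun c' => p.run P e (c'.tick 1))
      (fun i c' => c'.mem = p.exec^[i] c.mem ∧ c'.env = c.env) (f.val c.mem) (c.tick (f.cost + 1))
      ⟨rfl, rfl⟩ (by
        rintro i - b ⟨h1, h2⟩ b' hb'
        obtain ⟨h1', h2'⟩ := ih hp (b.tick 1) b' hb'
        refine ⟨?_, h2'.trans h2⟩
        rw [h1', Function.iterate_succ_apply', ← h1, Config.tick_mem]) c' hc'
  | rand k i f => exact hp.elim
  | reset k i => exact hp.elim
  | act k i f => exact hp.elim
  | expert k i => exact hp.elim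

/-- The arrays that a deterministic program may change. -/
def writes : Prog → List ℕ
  | set k _ _ => [k]
  | seq p q => writes p ++ writes q
  | ite _ p q => writes p ++ writes q
  | loop _ p => writes p
  | _ => []

theorem exec_of_notMem_writes (p : Prog) {k : ℕ} (hk : k ∉ p.writes) (m : Mem) :
    p.exec m k = m k := by
  induction p generalizing m with
  | set k' i f =>
    simp only [writes, List.mem_singleton] at hk
    rw [exec, Mem.put_of_ne _ hk]
  | seq p q ihp ihq =>
    simp only [writes, List.mem_append, not_or] at hk
    rw [exec, ihq hk.2, ihp hk.1]
  | ite f p q ihp ihq =>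
    simp only [writes, List.mem_append, not_or] at hk
    rw [exec]
    split_ifs
    · exact ihp hk.1 m
    · exact ihq hk.2 m
  | loop f p ih =>
    rw [exec]
    generalize f.val m = n
    induction n with
    | zero => rfl
    | succ n ihn => rw [Function.iterate_succ_apply', ih hk, ihn]
  | _ => rfl

end Prog

/-! ### Table indices as digit expansions -/

/-- Horner's scheme: the digits `d 0, …, d (i - 1)` in base `B`, appended to the number `v`. -/
def hornerVal (B : ℕ) (d : ℕ → ℕ) (v : ℕ) : ℕ → ℕ
  | 0 => v
  | i + 1 => B * hornerVal B d v i + d i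

theorem hornerVal_congr {B v i : ℕ} {d d' : ℕ → ℕ} (h : ∀ j < i, d j = d' j) :
    hornerVal B d v i = hornerVal B d' v i := by
  induction i with
  | zero => rfl
  | succ i ih =>
    rw [hornerVal, hornerVal, ih fun j hj => h j (hj.trans (Nat.lt_succ_self i)),
      h i (Nat.lt_succ_self i)]

theorem hornerVal_eq_sum (B : ℕ) (d : ℕ → ℕ) (v i : ℕ) :
    hornerVal B d v i = v * B ^ i + ∑ j ∈ Finset.range i, d j * B ^ (i - 1 - j) := by
  induction i with
  | zero => simp [hornerVal]
  | succ i ih =>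
    rw [hornerVal, ih, Finset.sum_range_succ, mul_add, Finset.mul_sum]
    have : ∀ j ∈ Finset.range i, B * (d j * B ^ (i - 1 - j)) = d j * B ^ (i + 1 - 1 - j) := by
      intro j hj
      have hj := Finset.mem_range.1 hj
      have e : i + 1 - 1 - j = i - 1 - j + 1 := by omega
      rw [e, pow_succ]
      ring
    rw [Finset.sum_congr rfl this]
    simp [pow_succ]
    ring

theorem mul_add_inj {B u u' a a' : ℕ} (ha : a < B) (ha' : a' < B) (h : B * u + a = B * u' + a') :
    u = u' ∧ a = a' := by
  have hB : 0 < B := Nat.zero_lt_of_lt ha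
  have h1 := congrArg (· / B) h
  have h2 := congrArg (· % B) h
  simp only [Nat.mul_add_div hB, Nat.div_eq_of_lt ha, Nat.div_eq_of_lt ha', add_zero] at h1
  simp only [Nat.mul_add_mod, Nat.mod_eq_of_lt ha, Nat.mod_eq_of_lt ha'] at h2
  exact ⟨h1, h2⟩

theorem hornerVal_inj {B v v' i : ℕ} {d d' : ℕ → ℕ} (hd : ∀ j < i, d j < B)
    (hd' : ∀ j < i, d' j < B)
    (h : hornerVal B d v i = hornerVal B d' v' i) : v = v' ∧ ∀ j < i, d j = d' j := by
  induction i with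
  | zero => exact ⟨h, fun j hj => absurd hj (Nat.not_lt_zero j)⟩
  | succ i ih =>
    obtain ⟨h1, h2⟩ := mul_add_inj (hd i (Nat.lt_succ_self i)) (hd' i (Nat.lt_succ_self i)) h
    obtain ⟨h3, h4⟩ := ih (fun j hj => hd j (hj.trans (Nat.lt_succ_self i)))
      (fun j hj => hd' j (hj.trans (Nat.lt_succ_self i))) h1
    refine ⟨h3, fun j hj => ?_⟩
    rcases (Nat.lt_succ_iff.1 hj).lt_or_eq with hj | rfl
    · exact h4 j hj
    · exact h2

namespace POMDP

variable {P : POMDP} {L h : ℕ}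

/-- The digits of the observations of a window, padded with leading zeros to length `L`. -/
def obsDigit (w : P.Window L h) (j : ℕ) : ℕ :=
  if hj : h + 1 + j - L ∈ Finset.Icc (h + 1 - L) h ∧ L ≤ h + 1 + j then w.1 ⟨_, hj.1⟩ else 0

/-- The digits of the actions of a window, padded with leading zeros to length `L`. -/
def actDigit (w : P.Window L h) (j : ℕ) : ℕ :=
  if hj : h + j - L ∈ Finset.Ico (h - L) h ∧ L ≤ h + j then w.2 ⟨_, hj.1⟩ else 0

theorem obsDigit_eq (w : P.Window L h) (k : Finset.Icc (h + 1 - L) h) :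
    obsDigit w (k + L - (h + 1)) = w.1 k := by
  obtain ⟨k, hk⟩ := k
  have hk' := Finset.mem_Icc.1 hk
  have e : h + 1 + (k + L - (h + 1)) - L = k := by omega
  have hj : h + 1 + (k + L - (h + 1)) - L ∈ Finset.Icc (h + 1 - L) h ∧
      L ≤ h + 1 + (k + L - (h + 1)) := ⟨by rw [e]; exact hk, by omega⟩
  simp only [obsDigit, dif_pos hj]
  congr!

theorem actDigit_eq (w : P.Window L h) (k : Finset.Ico (h - L) h) :
    actDigit w (k + L - h) = w.2 k := by
  obtain ⟨k, hk⟩ := k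
  have hk' := Finset.mem_Ico.1 hk
  have e : h + (k + L - h) - L = k := by omega
  have hj : h + (k + L - h) - L ∈ Finset.Ico (h - L) h ∧ L ≤ h + (k + L - h) :=
    ⟨by rw [e]; exact hk, by omega⟩
  simp only [actDigit, dif_pos hj]
  congr!

theorem obsDigit_lt (hh : h < P.H) (w : P.Window L h) (j : ℕ) : obsDigit w j < P.maxX := by
  unfold obsDigit
  split_ifs with hj
  · exact (w.1 ⟨_, hj.1⟩).2.trans_le (nX_le_maxX ((Finset.mem_Icc.1 hj.1).2.trans_lt hh))
  · exact one_le_maxX (Nat.zero_lt_of_lt hh)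

theorem actDigit_lt (hh : h < P.H) (w : P.Window L h) (j : ℕ) : actDigit w j < P.maxA := by
  unfold actDigit
  split_ifs with hj
  · exact (w.2 ⟨_, hj.1⟩).2.trans_le (nA_le_maxA ((Finset.mem_Ico.1 hj.1).2.trans hh))
  · exact one_le_maxA (Nat.zero_lt_of_lt hh)

theorem window_ext {w w' : P.Window L h} (h1 : ∀ j < L, obsDigit w j = obsDigit w' j)
    (h2 : ∀ j < L, actDigit w j = actDigit w' j) : w = w' := by
  refine Prod.ext (funext fun k => Fin.ext ?_) (funext fun k => Fin.ext ?_)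
  · have hk := Finset.mem_Icc.1 k.2
    rw [← obsDigit_eq, ← obsDigit_eq]
    exact h1 _ (by omega)
  · have hk := Finset.mem_Ico.1 k.2
    rw [← actDigit_eq, ← actDigit_eq]
    exact h2 _ (by omega)

/-- The index of the first table entry for a window. -/
def tableBase (w : P.Window L h) : ℕ :=
  P.maxA * hornerVal P.maxA (actDigit w) (hornerVal P.maxX (obsDigit w) h L) L

theorem sum_obsDigit (w : P.Window L h) (B : ℕ) :
    ∑ k, (w.1 k : ℕ) * B ^ (h - (k : ℕ)) =
      ∑ j ∈ Finset.range L, obsDigit w j * B ^ (L - 1 - j) := by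
  refine Finset.sum_of_injOn (fun k => (k : ℕ) + L - (h + 1)) ?_ ?_ ?_ ?_
  · rintro ⟨k, hk⟩ - ⟨k', hk'⟩ - e
    have hk := Finset.mem_Icc.1 hk
    have hk' := Finset.mem_Icc.1 hk'
    simp only at e
    exact Subtype.ext (by simp only; omega)
  · rintro ⟨k, hk⟩ -
    have hk := Finset.mem_Icc.1 hk
    simp only [Finset.coe_range, Set.mem_Iio]
    omega
  · intro j hj hno
    have : obsDigit w j = 0 := by
      unfold obsDigit
      refine dif_neg fun hj' => hno ?_
      exact ⟨⟨_, hj'.1⟩, by simp, by simp only; omega⟩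
    rw [this, zero_mul]
  · rintro ⟨k, hk⟩ -
    rw [obsDigit_eq]
    have hk := Finset.mem_Icc.1 hk
    congr 2
    simp only
    omega

theorem sum_actDigit (w : P.Window L h) (B : ℕ) :
    ∑ k, (w.2 k : ℕ) * B ^ (h - 1 - (k : ℕ)) =
      ∑ j ∈ Finset.range L, actDigit w j * B ^ (L - 1 - j) := by
  refine Finset.sum_of_injOn (fun k => (k : ℕ) + L - h) ?_ ?_ ?_ ?_
  · rintro ⟨k, hk⟩ - ⟨k', hk'⟩ - e
    have hk := Finset.mem_Ico.1 hk
    have hk' := Finset.mem_Ico.1 hk'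
    simp only at e
    exact Subtype.ext (by simp only; omega)
  · rintro ⟨k, hk⟩ -
    have hk := Finset.mem_Ico.1 hk
    simp only [Finset.coe_range, Set.mem_Iio]
    omega
  · intro j hj hno
    have : actDigit w j = 0 := by
      unfold actDigit
      refine dif_neg fun hj' => hno ?_
      exact ⟨⟨_, hj'.1⟩, by simp, by simp only; omega⟩
    rw [this, zero_mul]
  · rintro ⟨k, hk⟩ -
    rw [actDigit_eq]
    have hk := Finset.mem_Ico.1 hk
    congr 2
    simp only
    omega

theorem tableIndex_eq (w : P.Window L h) (a : ℕ) : tableIndex P w a = tableBase w + a := by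
  rw [tableIndex, tableBase, hornerVal_eq_sum, hornerVal_eq_sum, ← sum_obsDigit, ← sum_actDigit,
    mul_comm P.maxA]

/-- Table entries for different steps, windows or actions are different. -/
theorem tableIndex_inj {h' : ℕ} (hh : h < P.H) (hh' : h' < P.H) {w : P.Window L h}
    {w' : P.Window L h'} {a a' : ℕ} (ha : a < P.maxA) (ha' : a' < P.maxA)
    (e : tableIndex P w a = tableIndex P w' a') : h = h' ∧ HEq w w' ∧ a = a' := by
  rw [tableIndex_eq, tableIndex_eq, tableBase, tableBase] at e
  obtain ⟨e1, rfl⟩ := mul_add_inj ha ha' e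
  obtain ⟨e2, hact⟩ := hornerVal_inj (fun j _ => actDigit_lt hh w j)
    (fun j _ => actDigit_lt hh' w' j) e1
  obtain ⟨rfl, hobs⟩ := hornerVal_inj (fun j _ => obsDigit_lt hh w j)
    (fun j _ => obsDigit_lt hh' w' j) e2
  exact ⟨rfl, heq_of_eq (window_ext hobs hact), rfl⟩

end POMDP

/-! ### Sampling from a table of weights -/

/-- Partial sums of weights. -/
def partialSum (c : ℕ → ℕ) (i : ℕ) : ℕ := ∑ j ∈ Finset.range i, c j

theorem partialSum_succ (c : ℕ → ℕ) (i : ℕ) : partialSum c (i + 1) = partialSum c i + c i :=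
  Finset.sum_range_succ _ _

theorem partialSum_mono (c : ℕ → ℕ) : Monotone (partialSum c) :=
  monotone_nat_of_le_succ fun i => by rw [partialSum_succ]; exact Nat.le_add_right _ _

/-- The number of indices `j < A` whose partial sum (up to and including `j`) is at most `r`. -/
def rank (c : ℕ → ℕ) (A r : ℕ) : ℕ :=
  ∑ j ∈ Finset.range A, if partialSum c (j + 1) ≤ r then 1 else 0

theorem rank_eq {c : ℕ → ℕ} {A r a : ℕ} (ha : a < A) (h1 : partialSum c a ≤ r)
    (h2 : r < partialSum c (a + 1)) : rank c A r = a := by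
  unfold rank
  rw [Finset.sum_ite, Finset.sum_const_zero, add_zero, Finset.sum_const, smul_eq_mul, mul_one]
  have : Finset.filter (fun j => partialSum c (j + 1) ≤ r) (Finset.range A) = Finset.range a := by
    ext j
    simp only [Finset.mem_filter, Finset.mem_range]
    constructor
    · rintro ⟨-, hj⟩
      by_contra hja
      have := partialSum_mono c (show a + 1 ≤ j + 1 by omega)
      omega
    · intro hj
      refine ⟨hj.trans ha, ?_⟩
      have := partialSum_mono c (show j + 1 ≤ a by omega)
      omega
  rw [this, Finset.card_range]

theorem exists_partialSum {c : ℕ → ℕ} {m r : ℕ} (h : r < partialSum c m) :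
    ∃ a < m, partialSum c a ≤ r ∧ r < partialSum c (a + 1) := by
  induction m with
  | zero => simp [partialSum] at h
  | succ m ih =>
    by_cases hm : r < partialSum c m
    · obtain ⟨a, ha, h'⟩ := ih hm
      exact ⟨a, ha.trans (Nat.lt_succ_self m), h'⟩
    · exact ⟨m, Nat.lt_succ_self m, not_lt.1 hm, h⟩

theorem partialSum_eq_of_zero {c : ℕ → ℕ} {m A : ℕ} (hmA : m ≤ A)
    (h0 : ∀ j, m ≤ j → j < A → c j = 0) : partialSum c A = partialSum c m := by
  induction A, hmA using Nat.le_induction with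
  | base => rfl
  | succ A hA ih =>
    rw [partialSum_succ, ih fun j hj hjA => h0 j hj (hjA.trans (Nat.lt_succ_self A)),
      h0 A hA (Nat.lt_succ_self A), add_zero]

theorem randBelow_eq {m : ℕ} [Nonempty (Fin m)] :
    randBelow m = (PMF.uniformOfFintype (Fin m)).map fun r : Fin m => (r : ℕ) := by
  obtain ⟨k, rfl⟩ := Nat.exists_eq_succ_of_ne_zero (Fin.pos_iff_nonempty.2 ‹_›).ne'
  exact PMF.map_id _

/-- Inversion of the distribution function: the rank of a uniformly random number has the law
given by the weights. -/
theorem couples_rank {m A : ℕ} (hm : 0 < m) (hmA : m ≤ A) (c : ℕ → ℕ)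
    (h0 : ∀ j, m ≤ j → j < A → c j = 0) (htot : partialSum c A ≠ 0) :
    Couples (randBelow (partialSum c A)) (ofWeights hm fun a => c a)
      (fun r a => rank c A r = a) := by
  classical
  set T := partialSum c A with hT
  have hTm : T = partialSum c m := partialSum_eq_of_zero hmA h0
  have hpos : 0 < T := Nat.pos_of_ne_zero htot
  have : Nonempty (Fin T) := ⟨⟨0, hpos⟩⟩
  have hrank : ∀ r : Fin T, rank c A r < m := by
    intro r
    obtain ⟨a, ha, h1, h2⟩ := exists_partialSum (lt_of_lt_of_eq r.2 hTm)
    rw [rank_eq (ha.trans_le hmA) h1 h2]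
    exact ha
  have hlaw : (PMF.uniformOfFintype (Fin T)).map
      (fun r : Fin T => (⟨rank c A r, hrank r⟩ : Fin m)) =
      ofWeights hm fun a => c a := by
    ext a
    have hsum : ∑' b : Fin m, ((c b : ℕ) : ℝ≥0∞) = (T : ℝ≥0∞) := by
      rw [tsum_fintype, hTm, partialSum, Fin.sum_univ_eq_sum_range (fun i => ((c i : ℕ) : ℝ≥0∞))]
      push_cast
      rfl
    have hT0 : (T : ℝ≥0∞) ≠ 0 := by exact_mod_cast htot
    unfold ofWeights
    rw [dif_neg (by rw [hsum]; exact hT0), PMF.normalize_apply, hsum, PMF.map_apply, tsum_fintype]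
    simp only [PMF.uniformOfFintype_apply, Fintype.card_fin]
    rw [← Finset.sum_filter, Finset.sum_const, nsmul_eq_mul]
    congr 2
    have : (Finset.univ.filter fun r : Fin T => a = ⟨rank c A r, hrank r⟩).map Fin.valEmbedding =
        Finset.Ico (partialSum c a) (partialSum c (a + 1)) := by
      ext r
      simp only [Finset.mem_map, Finset.mem_filter, Finset.mem_univ, true_and, Fin.ext_iff,
        Fin.valEmbedding_apply, Finset.mem_Ico]
      constructor
      · rintro ⟨r, hr, rfl⟩
        obtain ⟨b, hb, h1, h2⟩ := exists_partialSum (lt_of_lt_of_eq r.2 hTm)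
        rw [rank_eq (hb.trans_le hmA) h1 h2] at hr
        rw [hr]
        exact ⟨h1, h2⟩
      · rintro ⟨h1, h2⟩
        have hlt : r < T := by
          rw [hTm]
          exact h2.trans_le (partialSum_mono c a.2)
        exact ⟨⟨r, hlt⟩, (rank_eq (a.2.trans_le hmA) h1 h2).symm, rfl⟩
    have hcard := congrArg Finset.card this
    rw [Finset.card_map, Nat.card_Ico, partialSum_succ, Nat.add_sub_cancel_left] at hcard
    exact hcard
  rw [randBelow_eq, ← hlaw]
  exact couples_map _ _ _ fun r _ => rfl

/-! ### The program

Array `3` is the table. During an episode, entry `i + L` of array `5` (of array `6`) holds the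
observation (the action) of step `i`; the first `L` entries stay `0`, which gives the leading zeros
of the digit expansions. The scalars are: `10` the current round, `11` the current step, `12` a
counter, `13` the table index, `14` an auxiliary sum, `15` a counter, `16` the sum of the weights,
`17` the action, `18` the random number, `19` a partial sum, `20` the expert action. -/

/-- The scalar in array `k`. -/
def sc (k : ℕ) : Expr := .get k (.lit 0)

/-- Assignment to a scalar. -/
def Prog.assign (k : ℕ) (f : Expr) : Prog := .set k (.lit 0) f

/-- Multiply the table index by parameter `j` and add `f`. -/
def mulAdd (j : ℕ) (f : Expr) : Prog :=
  .seq (.assign 14 (.lit 0)) (.seq (.loop (.get 0 (.lit j)) (.assign 14 (.add (sc 14) (sc 13))))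
    (.assign 13 (.add (sc 14) f)))

/-- Append `L` digits in the base given by parameter `j` to the table index. -/
def horner (j : ℕ) (f : Expr) : Prog :=
  .seq (.assign 12 (.lit 0)) (.loop (.get 0 (.lit 2))
    (.seq (mulAdd j f) (.assign 12 (.add (sc 12) (.lit 1)))))

/-- Compute the table index for the current step and window. -/
def indexProg : Prog :=
  .seq (.assign 13 (sc 11)) (.seq (horner 3 (.get 5 (.add (.add (sc 11) (sc 12)) (.lit 1))))
    (.seq (horner 4 (.get 6 (.add (sc 11) (sc 12)))) (mulAdd 4 (.lit 0))))

/-- Sum up the weights that start at the table index. -/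
def sumProg : Prog :=
  .seq (.assign 16 (.lit 0)) (.seq (.assign 15 (.lit 0)) (.loop (.get 0 (.lit 4))
    (.seq (.assign 16 (.add (sc 16) (.get 3 (.add (sc 13) (sc 15)))))
      (.assign 15 (.add (sc 15) (.lit 1))))))

/-- Find the action that belongs to the random number. -/
def findProg : Prog :=
  .seq (.assign 19 (.lit 0)) (.seq (.assign 17 (.lit 0)) (.seq (.assign 15 (.lit 0))
    (.loop (.get 0 (.lit 4))
      (.seq (.assign 19 (.add (sc 19) (.get 3 (.add (sc 13) (sc 15)))))
        (.seq (.ite (.sub (.add (sc 18) (.lit 1)) (sc 19)) (.assign 17 (.add (sc 17) (.lit 1)))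
            (.assign 17 (sc 17)))
          (.assign 15 (.add (sc 15) (.lit 1))))))))

/-- Draw an action from the learned policy. -/
def sampleProg : Prog :=
  .seq indexProg (.seq sumProg (.ite (sc 16)
    (.seq (.rand 18 (.lit 0) (sc 16)) findProg) (.rand 17 (.lit 0) (.get 2 (sc 11)))))

/-- Choose an action: from the learned policy more than `L` steps before the current round, uniformly
otherwise. -/
def chooseProg : Prog :=
  .ite (.sub (.sub (sc 10) (.get 0 (.lit 2))) (sc 11)) sampleProg
    (.rand 17 (.lit 0) (.get 2 (sc 11)))

/-- One step of an episode. -/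
def stepProg : Prog :=
  .seq chooseProg (.seq (.set 6 (.add (sc 11) (.get 0 (.lit 2))) (sc 17))
    (.seq (.act 5 (.add (.add (sc 11) (.get 0 (.lit 2))) (.lit 1)) (sc 17))
      (.assign 11 (.add (sc 11) (.lit 1)))))

/-- One sample: an episode up to the step of the current round, a query to the expert, and the count
of the result. -/
def episodeProg : Prog :=
  .seq (.reset 5 (.get 0 (.lit 2))) (.seq (.assign 11 (.lit 0))
    (.seq (.loop (.get 0 (.lit 1)) (.ite (.sub (sc 10) (sc 11)) stepProg (.assign 14 (.lit 0))))
      (.seq (.expert 20 (.lit 0)) (.seq indexProg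
        (.set 3 (.add (sc 13) (sc 20)) (.add (.get 3 (.add (sc 13) (sc 20))) (.lit 1)))))))

/-- The modified Forward algorithm. -/
def forwardProg : Prog :=
  .loop (.get 0 (.lit 1)) (.seq (.loop (.get 0 (.lit 0)) episodeProg)
    (.assign 10 (.add (sc 10) (.lit 1))))

/-! ### Effects of the deterministic parts -/

theorem Mem.put_put (m : Mem) (k i v w : ℕ) : (m.put k i v).put k i w = m.put k i w := by
  funext k' i'
  simp only [Mem.put]
  split_ifs <;> rfl

theorem exec_mulAdd (j : ℕ) (f : Expr) (m : Mem)
    (hf : ∀ v, f.val (m.put 14 0 v) = f.val m) :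
    (mulAdd j f).exec m =
      (m.put 14 0 (m 0 j * m 13 0)).put 13 0 (m 0 j * m 13 0 + f.val m) := by
  have hloop : ∀ i, (Prog.assign 14 (.add (sc 14) (sc 13))).exec^[i] (m.put 14 0 0) =
      m.put 14 0 (i * m 13 0) := by
    intro i
    induction i with
    | zero => simp
    | succ i ih =>
      rw [Function.iterate_succ_apply', ih]
      simp only [Prog.assign, Prog.exec, Expr.val, sc, Mem.put_same, Mem.put_put]
      rw [Mem.put_of_ne m (by norm_num : (13 : ℕ) ≠ 14)]
      congr 1
      ring
  simp only [mulAdd, Prog.exec]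
  have e1 : (Prog.assign 14 (.lit 0)).exec m = m.put 14 0 0 := rfl
  have e2 : (Expr.get 0 (.lit j)).val (m.put 14 0 0) = m 0 j := by
    simp [Expr.val, Mem.put_of_ne]
  rw [e1, e2, hloop]
  simp [Prog.assign, Prog.exec, Expr.val, sc, Mem.put_same, hf]

/-- The digits may be computed from any part of the memory that the loop does not change and from the
counter. -/
theorem horner_exec (j : ℕ) (f : Expr) (m : Mem) (d : ℕ → ℕ)
    (hf : ∀ m' : Mem, (∀ k, k ≠ 12 → k ≠ 13 → k ≠ 14 → m' k = m k) → f.val m' = d (m' 12 0)) :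
    (horner j f).exec m 13 0 = hornerVal (m 0 j) d (m 13 0) (m 0 2) ∧
      ∀ k, k ≠ 12 → k ≠ 13 → k ≠ 14 → (horner j f).exec m k = m k := by
  set body := Prog.seq (mulAdd j f) (.assign 12 (.add (sc 12) (.lit 1))) with hbody
  have hloop : ∀ i, (body.exec^[i] (m.put 12 0 0)) 12 0 = i ∧
      (body.exec^[i] (m.put 12 0 0)) 13 0 = hornerVal (m 0 j) d (m 13 0) i ∧
      ∀ k, k ≠ 12 → k ≠ 13 → k ≠ 14 → body.exec^[i] (m.put 12 0 0) k = m k := by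
    intro i
    induction i with
    | zero =>
      refine ⟨Mem.put_same _ _ _ _, ?_, fun k hk _ _ => Mem.put_of_ne _ hk _ _⟩
      rw [Function.iterate_zero_apply, Mem.put_of_ne _ (by norm_num)]
      rfl
    | succ i ih =>
      rw [Function.iterate_succ_apply']
      set m' := body.exec^[i] (m.put 12 0 0) with hm'
      obtain ⟨h1, h2, h3⟩ := ih
      have hf1 : ∀ v, f.val (m'.put 14 0 v) = f.val m' := by
        intro v
        rw [hf m' h3, hf (m'.put 14 0 v) fun k k1 k2 k3 => by
          rw [Mem.put_of_ne _ k3, h3 k k1 k2 k3], Mem.put_of_ne _ (by norm_num)]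
      have e : body.exec m' = ((m'.put 14 0 (m' 0 j * m' 13 0)).put 13 0
          (m' 0 j * m' 13 0 + f.val m')).put 12 0 (m' 12 0 + 1) := by
        rw [hbody, Prog.exec, exec_mulAdd j f m' hf1]
        simp [Prog.assign, Prog.exec, Expr.val, sc, Mem.put_of_ne]
      rw [e]
      refine ⟨?_, ?_, ?_⟩
      · rw [Mem.put_same, h1]
      · rw [Mem.put_of_ne _ (by norm_num), Mem.put_same, h2, h3 0 (by norm_num) (by norm_num)
          (by norm_num), hf m' h3, h1, hornerVal]
      · intro k k1 k2 k3
        rw [Mem.put_of_ne _ k1, Mem.put_of_ne _ k2, Mem.put_of_ne _ k3, h3 k k1 k2 k3]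
  have e : (horner j f).exec m = body.exec^[m 0 2] (m.put 12 0 0) := by
    simp [horner, Prog.exec, Prog.assign, Expr.val, Mem.put_of_ne, hbody]
  rw [e]
  exact (hloop _).2

theorem indexProg_exec (m : Mem) :
    indexProg.exec m 13 0 = m 0 4 * hornerVal (m 0 4) (fun t => m 6 (m 11 0 + t))
        (hornerVal (m 0 3) (fun t => m 5 (m 11 0 + t + 1)) (m 11 0) (m 0 2)) (m 0 2) ∧
      ∀ k, k ≠ 12 → k ≠ 13 → k ≠ 14 → indexProg.exec m k = m k := by
  set m1 := (Prog.assign 13 (sc 11)).exec m with hm1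
  have hm1' : m1 = m.put 13 0 (m 11 0) := rfl
  have k1 : ∀ k, k ≠ 13 → m1 k = m k := fun k hk => by rw [hm1', Mem.put_of_ne _ hk]
  obtain ⟨h2, k2⟩ := horner_exec 3 (.get 5 (.add (.add (sc 11) (sc 12)) (.lit 1))) m1
    (fun t => m 5 (m 11 0 + t + 1)) (by
      intro m' hm'
      simp only [Expr.val, sc]
      rw [hm' 5 (by norm_num) (by norm_num) (by norm_num),
        hm' 11 (by norm_num) (by norm_num) (by norm_num), k1 5 (by norm_num), k1 11 (by norm_num)])
  set m2 := (horner 3 (.get 5 (.add (.add (sc 11) (sc 12)) (.lit 1)))).exec m1 with hm2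
  have k2' : ∀ k, k ≠ 12 → k ≠ 13 → k ≠ 14 → m2 k = m k := fun k h1 h2 h3 => by
    rw [k2 k h1 h2 h3, k1 k h2]
  obtain ⟨h3, k3⟩ := horner_exec 4 (.get 6 (.add (sc 11) (sc 12))) m2
    (fun t => m 6 (m 11 0 + t)) (by
      intro m' hm'
      simp only [Expr.val, sc]
      rw [hm' 6 (by norm_num) (by norm_num) (by norm_num),
        hm' 11 (by norm_num) (by norm_num) (by norm_num),
        k2' 6 (by norm_num) (by norm_num) (by norm_num),
        k2' 11 (by norm_num) (by norm_num) (by norm_num)])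
  set m3 := (horner 4 (.get 6 (.add (sc 11) (sc 12)))).exec m2 with hm3
  have k3' : ∀ k, k ≠ 12 → k ≠ 13 → k ≠ 14 → m3 k = m k := fun k h1 h2 h3 => by
    rw [k3 k h1 h2 h3, k2' k h1 h2 h3]
  have e : indexProg.exec m = (m3.put 14 0 (m3 0 4 * m3 13 0)).put 13 0 (m3 0 4 * m3 13 0 + 0) :=
    exec_mulAdd 4 (.lit 0) m3 fun v => rfl
  rw [e]
  constructor
  · rw [Mem.put_same, add_zero, h3, h2, k3' 0 (by norm_num) (by norm_num) (by norm_num),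
      k2' 0 (by norm_num) (by norm_num) (by norm_num), k1 0 (by norm_num), hm1', Mem.put_same]
  · intro k h1 h2 h3
    rw [Mem.put_of_ne _ h2, Mem.put_of_ne _ h3, k3' k h1 h2 h3]

theorem sumProg_exec (m : Mem) :
    sumProg.exec m 16 0 = partialSum (fun j => m 3 (m 13 0 + j)) (m 0 4) := by
  set c := fun j => m 3 (m 13 0 + j)
  set body := Prog.seq (.assign 16 (.add (sc 16) (.get 3 (.add (sc 13) (sc 15)))))
      (.assign 15 (.add (sc 15) (.lit 1))) with hbody
  have hloop : ∀ i, body.exec^[i] ((m.put 16 0 0).put 15 0 0) =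
      (m.put 16 0 (partialSum c i)).put 15 0 i := by
    intro i
    induction i with
    | zero => rfl
    | succ i ih =>
      rw [Function.iterate_succ_apply', ih, partialSum_succ]
      funext k' i'
      simp only [hbody, Prog.exec, Prog.assign, Expr.val, sc, Mem.put, c]
      simp
      split_ifs <;> simp_all
  have e : sumProg.exec m = body.exec^[m 0 4] ((m.put 16 0 0).put 15 0 0) := by
    simp [sumProg, Prog.exec, Prog.assign, Expr.val, Mem.put_of_ne, hbody]
  rw [e, hloop, Mem.put_of_ne _ (by norm_num), Mem.put_same]

theorem findProg_exec (m : Mem) :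
    findProg.exec m 17 0 = rank (fun j => m 3 (m 13 0 + j)) (m 0 4) (m 18 0) := by
  set c := fun j => m 3 (m 13 0 + j)
  set body := Prog.seq (.assign 19 (.add (sc 19) (.get 3 (.add (sc 13) (sc 15)))))
        (.seq (.ite (.sub (.add (sc 18) (.lit 1)) (sc 19)) (.assign 17 (.add (sc 17) (.lit 1)))
            (.assign 17 (sc 17)))
          (.assign 15 (.add (sc 15) (.lit 1)))) with hbody
  set m0 := ((m.put 19 0 0).put 17 0 0).put 15 0 0 with hm0
  have hloop : ∀ i, (body.exec^[i] m0) 15 0 = i ∧ (body.exec^[i] m0) 19 0 = partialSum c i ∧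
      (body.exec^[i] m0) 17 0 = rank c i (m 18 0) ∧
      ∀ k, k ≠ 15 → k ≠ 17 → k ≠ 19 → body.exec^[i] m0 k = m k := by
    intro i
    induction i with
    | zero =>
      refine ⟨rfl, rfl, rfl, fun k h1 h2 h3 => ?_⟩
      rw [Function.iterate_zero_apply, hm0, Mem.put_of_ne _ h1, Mem.put_of_ne _ h2,
        Mem.put_of_ne _ h3]
    | succ i ih =>
      rw [Function.iterate_succ_apply']
      set m' := body.exec^[i] m0
      obtain ⟨h1, h2, h3, h4⟩ := ih
      have e1 : (Prog.assign 19 (.add (sc 19) (.get 3 (.add (sc 13) (sc 15))))).exec m' =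
          m'.put 19 0 (partialSum c (i + 1)) := by
        rw [partialSum_succ]
        simp only [Prog.assign, Prog.exec, Expr.val, sc, h1, h2, c]
        rw [h4 3 (by norm_num) (by norm_num) (by norm_num),
          h4 13 (by norm_num) (by norm_num) (by norm_num)]
      have e2 : (Prog.ite (.sub (.add (sc 18) (.lit 1)) (sc 19))
          (.assign 17 (.add (sc 17) (.lit 1))) (.assign 17 (sc 17))).exec
            (m'.put 19 0 (partialSum c (i + 1))) =
          (m'.put 19 0 (partialSum c (i + 1))).put 17 0 (rank c (i + 1) (m 18 0)) := by
        have hr : rank c (i + 1) (m 18 0) =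
            rank c i (m 18 0) + if partialSum c (i + 1) ≤ m 18 0 then 1 else 0 :=
          Finset.sum_range_succ _ _
        have h18 : m' 18 0 = m 18 0 := by rw [h4 18 (by norm_num) (by norm_num) (by norm_num)]
        simp only [Prog.assign, Prog.exec, Expr.val, sc, Mem.put_same]
        rw [Mem.put_of_ne m' (by norm_num : (18 : ℕ) ≠ 19),
          Mem.put_of_ne m' (by norm_num : (17 : ℕ) ≠ 19), h18, h3, hr]
        by_cases hle : partialSum c (i + 1) ≤ m 18 0
        · rw [if_pos (by omega), if_pos hle]
        · rw [if_neg (by omega), if_neg hle, add_zero]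
      have e3 : body.exec m' = ((m'.put 19 0 (partialSum c (i + 1))).put 17 0
          (rank c (i + 1) (m 18 0))).put 15 0 (i + 1) := by
        rw [hbody, Prog.exec, Prog.exec, e1, e2]
        simp [Prog.assign, Prog.exec, Expr.val, sc, Mem.put_of_ne, h1]
      rw [e3]
      refine ⟨Mem.put_same _ _ _ _, ?_, ?_, fun k k1 k2 k3 => ?_⟩
      · rw [Mem.put_of_ne _ (by norm_num), Mem.put_of_ne _ (by norm_num), Mem.put_same]
      · rw [Mem.put_of_ne _ (by norm_num), Mem.put_same]
      · rw [Mem.put_of_ne _ k1, Mem.put_of_ne _ k2, Mem.put_of_ne _ k3, h4 k k1 k2 k3]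
  have e : findProg.exec m = body.exec^[m 0 4] m0 := by
    simp [findProg, Prog.exec, Prog.assign, Expr.val, Mem.put_of_ne, hbody, hm0]
  rw [e]
  exact (hloop _).2.2.1

/-! ### Coupling rules for programs -/

theorem couples_bind_of_support {α β γ : Type*} {μ : PMF α} {f : α → PMF β} {ν : PMF γ}
    {R : β → γ → Prop} (h : ∀ a ∈ μ.support, Couples (f a) ν R) : Couples (μ.bind f) ν R := by
  have h1 := (couples_pure_right μ () (R := fun a _ => Couples (f a) ν R) h).bind
    (f := f) (g := fun _ => ν) fun _ _ h' => h'
  rwa [PMF.pure_bind] at h1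

theorem couples_refl {α : Type*} (p : PMF α) : Couples p p fun a b => a = b ∧ a ∈ p.support := by
  have := couples_map p id id (R := fun a b => a = b ∧ a ∈ p.support) fun c hc => ⟨rfl, hc⟩
  rwa [PMF.map_id] at this

theorem couples_seq_det {P : POMDP} (e : P.LatentPolicy) {p q : Prog} (hp : p.Det) {c : Config P}
    {β : Type*} {ν : PMF β} {R : Config P → β → Prop}
    (h : ∀ c', c'.mem = p.exec c.mem → c'.env = c.env → Couples (q.run P e c') ν R) :
    Couples ((Prog.seq p q).run P e c) ν R :=
  couples_bind_of_support fun c' hc' =>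
    h c' (Prog.run_det e p hp c c' hc').1 (Prog.run_det e p hp c c' hc').2

theorem couples_randBelow {m : ℕ} [Nonempty (Fin m)] :
    Couples (randBelow m) (PMF.uniformOfFintype (Fin m)) fun r a => r = a := by
  rw [randBelow_eq]
  have := couples_map (PMF.uniformOfFintype (Fin m)) (fun r : Fin m => (r : ℕ)) id
    (R := fun r a => r = (a : ℕ)) fun _ _ => rfl
  rwa [PMF.map_id] at this

theorem couples_rand {P : POMDP} (e : P.LatentPolicy) (k : ℕ) (i f : Expr) (c : Config P) {m : ℕ}
    [Nonempty (Fin m)] (hm : f.val c.mem = m) :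
    Couples ((Prog.rand k i f).run P e c) (PMF.uniformOfFintype (Fin m))
      fun c' a => c'.mem = c.mem.put k (i.val c.mem) a ∧ c'.env = c.env := by
  rw [Prog.run, hm, ← PMF.bind_pure_comp]
  refine couples_randBelow.bind_left fun r a hra c' hc' => ?_
  rw [Function.comp_apply, PMF.mem_support_pure_iff] at hc'
  subst hc' hra
  exact ⟨rfl, rfl⟩

theorem ofWeights_eq_uniform {m : ℕ} (hm : 0 < m) [Nonempty (Fin m)] (c : Fin m → ℕ)
    (hc : ∀ a, c a = 0) : ofWeights hm c = PMF.uniformOfFintype (Fin m) := by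
  unfold ofWeights
  rw [dif_pos]
  simp [hc]

namespace POMDP

variable {P : POMDP} {L n : ℕ}

/-! ### Simulation of episodes -/

/-- The memory between episodes of round `h`, when the table is `T`. The first `L` entries of the
history arrays are never written and supply the leading zeros of the table index. -/
structure RoundRel (P : POMDP) (L n h : ℕ) (T : ℕ → ℕ) (m : Mem) : Prop where
  params : m 0 = (Config.start P L n).mem 0
  actions : m 2 = (Config.start P L n).mem 2
  table : m 3 = T
  round : m 10 0 = h
  obs_zero : ∀ i < L, m 5 i = 0
  act_zero : ∀ i < L, m 6 i = 0

/-- The configuration in an episode of round `h` after the history `z` up to step `k`. -/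
structure StepRel (P : POMDP) (L n h : ℕ) (T : ℕ → ℕ) {k : ℕ} (c : Config P) (z : P.Pre k) :
    Prop where
  base : RoundRel P L n h T c.mem
  step : c.mem 11 0 = k
  obs : ∀ i : Fin k, c.mem 5 (i + L) = (z.1 i).2.1
  last_obs : c.mem 5 (k + L) = z.2.2
  act : ∀ i : Fin k, c.mem 6 (i + L) = (z.1 i).2.2
  env : c.env = some ⟨k, z.2.1⟩

theorem RoundRel.congr {h : ℕ} {T : ℕ → ℕ} {m m' : Mem} (hm : RoundRel P L n h T m)
    (hk : ∀ k < 12, m' k = m k) : RoundRel P L n h T m' where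
  params := by rw [hk 0 (by norm_num), hm.params]
  actions := by rw [hk 2 (by norm_num), hm.actions]
  table := by rw [hk 3 (by norm_num), hm.table]
  round := by rw [hk 10 (by norm_num), hm.round]
  obs_zero := by rw [hk 5 (by norm_num)]; exact hm.obs_zero
  act_zero := by rw [hk 6 (by norm_num)]; exact hm.act_zero

theorem StepRel.congr {h k : ℕ} {T : ℕ → ℕ} {c c' : Config P} {z : P.Pre k}
    (hc : StepRel P L n h T c z) (hk : ∀ k < 12, c'.mem k = c.mem k) (henv : c'.env = c.env) :
    StepRel P L n h T c' z where
  base := hc.base.congr hk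
  step := by rw [hk 11 (by norm_num), hc.step]
  obs := by rw [hk 5 (by norm_num)]; exact hc.obs
  last_obs := by rw [hk 5 (by norm_num)]; exact hc.last_obs
  act := by rw [hk 6 (by norm_num)]; exact hc.act
  env := henv.trans hc.env

theorem RoundRel.param_n {h : ℕ} {T : ℕ → ℕ} {m : Mem} (hm : RoundRel P L n h T m) : m 0 0 = n := by
  rw [hm.params]; rfl

theorem RoundRel.param_H {h : ℕ} {T : ℕ → ℕ} {m : Mem} (hm : RoundRel P L n h T m) :
    m 0 1 = P.H := by
  rw [hm.params]; rfl

theorem RoundRel.param_L {h : ℕ} {T : ℕ → ℕ} {m : Mem} (hm : RoundRel P L n h T m) : m 0 2 = L := by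
  rw [hm.params]; rfl

theorem RoundRel.param_X {h : ℕ} {T : ℕ → ℕ} {m : Mem} (hm : RoundRel P L n h T m) :
    m 0 3 = P.maxX := by
  rw [hm.params]; rfl

theorem RoundRel.param_A {h : ℕ} {T : ℕ → ℕ} {m : Mem} (hm : RoundRel P L n h T m) :
    m 0 4 = P.maxA := by
  rw [hm.params]; rfl

theorem RoundRel.numActions {h : ℕ} {T : ℕ → ℕ} {m : Mem} (hm : RoundRel P L n h T m) {k : ℕ}
    (hk : k < P.H) : m 2 k = P.nA k := by
  rw [hm.actions]
  simp [Config.start, hk]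

theorem StepRel.obsDigit {h k : ℕ} {T : ℕ → ℕ} {c : Config P} {z : P.Pre k}
    (hc : StepRel P L n h T c z) {t : ℕ} (ht : t < L) :
    c.mem 5 (k + t + 1) = obsDigit (preWindow L z) t := by
  unfold POMDP.obsDigit
  split_ifs with hj
  · obtain ⟨h1, h2⟩ := hj
    have h3 := (Finset.mem_Icc.1 h1).2
    rcases h3.lt_or_eq with hlt | heq
    · have e := hc.obs ⟨k + 1 + t - L, hlt⟩
      have e' : k + 1 + t - L + L = k + t + 1 := by omega
      simp only [e'] at e
      rw [e]
      have := Fin.snoc_castSucc (α := fun i : Fin (k + 1) => Fin (P.nX i)) z.2.2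
        (fun i => (z.1 i).2.1) ⟨k + 1 + t - L, hlt⟩
      exact congrArg Fin.val this.symm
    · have e' : k + t + 1 = k + L := by omega
      rw [e', hc.last_obs]
      have : ∀ j (hj : j < k + 1), j = k → (z.2.2 : ℕ) =
          (Fin.snoc (α := fun i : Fin (k + 1) => Fin (P.nX i)) (fun i => (z.1 i).2.1) z.2.2
            ⟨j, hj⟩ : ℕ) := by
        rintro j hj rfl
        exact congrArg Fin.val (Fin.snoc_last (α := fun i : Fin (j + 1) => Fin (P.nX i)) z.2.2
          (fun i => (z.1 i).2.1)).symm
      exact this _ _ heq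
  · refine hc.base.obs_zero _ ?_
    by_contra hge
    exact hj ⟨Finset.mem_Icc.2 ⟨by omega, by omega⟩, by omega⟩

theorem StepRel.actDigit {h k : ℕ} {T : ℕ → ℕ} {c : Config P} {z : P.Pre k}
    (hc : StepRel P L n h T c z) {t : ℕ} (ht : t < L) :
    c.mem 6 (k + t) = actDigit (preWindow L z) t := by
  unfold POMDP.actDigit
  split_ifs with hj
  · obtain ⟨h1, h2⟩ := hj
    have e := hc.act ⟨k + t - L, (Finset.mem_Ico.1 h1).2⟩
    have e' : k + t - L + L = k + t := by omega
    simp only [e'] at e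
    rw [e]
    rfl
  · refine hc.base.act_zero _ ?_
    by_contra hge
    exact hj ⟨Finset.mem_Ico.2 ⟨by omega, by omega⟩, by omega⟩

theorem StepRel.index {h k : ℕ} {T : ℕ → ℕ} {c : Config P} {z : P.Pre k}
    (hc : StepRel P L n h T c z) : indexProg.exec c.mem 13 0 = tableBase (preWindow L z) := by
  rw [(indexProg_exec c.mem).1, hc.base.param_A, hc.base.param_X, hc.base.param_L, hc.step,
    tableBase, hornerVal_congr fun t ht => hc.actDigit ht,
    hornerVal_congr fun t ht => hc.obsDigit ht]

/-- The table `T` encodes the policy `π` of the first `h` steps. -/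
def Encodes (T : ℕ → ℕ) {h : ℕ} (π : P.Executable L h) : Prop :=
  ∀ k (hk : k < h) (w : P.Window L k),
    (π ⟨k, hk⟩ w = ofWeights (P.nA_pos k) fun a => T (tableIndex P w a)) ∧
      ∀ a, P.nA k ≤ a → a < P.maxA → T (tableIndex P w a) = 0

theorem couples_uniform (e : P.LatentPolicy) {h k : ℕ} {T : ℕ → ℕ} {c : Config P}
    {z : P.Pre k} (hk : k < P.H) (hc : StepRel P L n h T c z) :
    Couples ((Prog.rand 17 (.lit 0) (.get 2 (sc 11))).run P e c) (P.unif k)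
      fun c' a => StepRel P L n h T c' z ∧ c'.mem 17 0 = (a : ℕ) := by
  have : Nonempty (Fin (P.nA k)) := ⟨⟨0, P.nA_pos k⟩⟩
  have hval : (Expr.get 2 (sc 11)).val c.mem = P.nA k := by
    simp only [Expr.val, sc, hc.step]
    exact hc.base.numActions hk
  refine (couples_rand e 17 (.lit 0) (.get 2 (sc 11)) c hval).mono ?_
  rintro c' a ⟨hmem, henv⟩
  refine ⟨hc.congr (fun j hj => ?_) henv, ?_⟩
  · rw [hmem, Mem.put_of_ne _ (by omega)]
  · rw [hmem]
    exact Mem.put_same _ _ _ _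

theorem couples_sampleProg (e : P.LatentPolicy) {h k : ℕ} {T : ℕ → ℕ} {c : Config P}
    {z : P.Pre k} (hk : k < P.H) (hc : StepRel P L n h T c z)
    (hT : ∀ a, P.nA k ≤ a → a < P.maxA → T (tableIndex P (preWindow L z) a) = 0) :
    Couples (sampleProg.run P e c)
      (ofWeights (P.nA_pos k) fun a => T (tableIndex P (preWindow L z) a))
      fun c' a => StepRel P L n h T c' z ∧ c'.mem 17 0 = (a : ℕ) := by
  set w : ℕ → ℕ := fun a => T (tableIndex P (preWindow L z) a) with hw
  refine couples_seq_det e (by simp [indexProg, horner, mulAdd, Prog.Det, Prog.assign])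
    fun c1 hm1 he1 => ?_
  have hk1 : ∀ j, j ≠ 12 → j ≠ 13 → j ≠ 14 → c1.mem j = c.mem j := fun j h1 h2 h3 => by
    rw [hm1, (indexProg_exec c.mem).2 j h1 h2 h3]
  have hb1 : c1.mem 13 0 = tableBase (preWindow L z) := by rw [hm1, hc.index]
  have hc1 : StepRel P L n h T c1 z :=
    hc.congr (fun j hj => hk1 j (by omega) (by omega) (by omega)) he1
  have hw1 : (fun j => c1.mem 3 (c1.mem 13 0 + j)) = w := by
    funext j
    rw [hc1.base.table, hb1]
    simp only [hw, tableIndex_eq]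
  refine couples_seq_det e (by simp [sumProg, Prog.Det, Prog.assign]) fun c2 hm2 he2 => ?_
  have hk2 : ∀ j, j ≠ 15 → j ≠ 16 → c2.mem j = c1.mem j := fun j h1 h2 => by
    rw [hm2, Prog.exec_of_notMem_writes]
    simp only [sumProg, Prog.writes, Prog.assign]
    simp [h1, h2]
  have hc2 : StepRel P L n h T c2 z := hc1.congr (fun j hj => hk2 j (by omega) (by omega)) he2
  have hw2 : (fun j => c2.mem 3 (c2.mem 13 0 + j)) = w := by
    rw [hk2 3 (by norm_num) (by norm_num), hk2 13 (by norm_num) (by norm_num), hw1]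
  have htot : c2.mem 16 0 = partialSum w P.maxA := by
    rw [hm2, sumProg_exec, hw1, hc1.base.param_A]
  rw [Prog.run]
  have hval : (sc 16).val c2.mem = partialSum w P.maxA := htot
  split_ifs with hne
  · rw [hval] at hne
    rw [Prog.run, Prog.run, PMF.bind_map, Config.tick_mem, hval]
    have hcoup := couples_rank (P.nA_pos k) (nA_le_maxA hk) w hT hne
    refine hcoup.bind_left fun r a hra c' hc' => ?_
    obtain ⟨hm', he'⟩ := Prog.run_det e findProg
      (by simp [findProg, Prog.Det, Prog.assign]) _ c' hc'
    have hwr : ∀ j, j ≠ 15 → j ≠ 17 → j ≠ 19 → c'.mem j = c2.mem.put 18 0 r j :=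
        fun j h1 h2 h3 => by
      rw [hm', Prog.exec_of_notMem_writes]
      · rfl
      · simp only [findProg, Prog.writes, Prog.assign]
        simp [h1, h2, h3]
    refine ⟨hc2.congr (fun j hj => ?_) he', ?_⟩
    · rw [hwr j (by omega) (by omega) (by omega), Mem.put_of_ne _ (by omega)]
    · rw [hm', findProg_exec]
      have e1 : ((((c2.tick ((sc 16).cost + 1)).write 18 ((Expr.lit 0).val c2.mem) r).tick
          ((Expr.lit 0).cost + (sc 16).cost + 1)).mem) = c2.mem.put 18 0 r := rfl
      rw [← hra]
      change rank (fun j => c2.mem.put 18 0 r 3 (c2.mem.put 18 0 r 13 0 + j))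
        (c2.mem.put 18 0 r 0 4) (c2.mem.put 18 0 r 18 0) = _
      rw [Mem.put_same, Mem.put_of_ne _ (by norm_num : (3 : ℕ) ≠ 18),
        Mem.put_of_ne _ (by norm_num : (13 : ℕ) ≠ 18), Mem.put_of_ne _ (by norm_num : (0 : ℕ) ≠ 18),
        hw2, hc2.base.param_A]
  · rw [hval, not_not] at hne
    have : Nonempty (Fin (P.nA k)) := ⟨⟨0, P.nA_pos k⟩⟩
    rw [ofWeights_eq_uniform]
    · exact couples_uniform e hk (hc2.congr (fun j _ => rfl) rfl)
    · intro a
      have := Finset.sum_eq_zero_iff.1 hne a (Finset.mem_range.2 (a.2.trans_le (nA_le_maxA hk)))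
      exact this

theorem couples_chooseProg (e : P.LatentPolicy) {h k : ℕ} {T : ℕ → ℕ} {c : Config P}
    {z : P.Pre k} (hk : k < P.H) (hc : StepRel P L n h T c z) (π : P.Executable L h)
    (hπ : Encodes T π) :
    Couples (chooseProg.run P e c)
      (P.follow (h - L) (Nat.sub_le h L) π k z.1 z.2.1 z.2.2)
      fun c' a => StepRel P L n h T c' z ∧ c'.mem 17 0 = (a : ℕ) := by
  have hval : (Expr.sub (.sub (sc 10) (.get 0 (.lit 2))) (sc 11)).val c.mem = h - L - k := by
    simp only [Expr.val, sc, hc.base.round, hc.step, hc.base.param_L]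
  have hc' : ∀ t, StepRel P L n h T (c.tick t) z := fun t => hc.congr (fun _ _ => rfl) rfl
  rw [chooseProg, Prog.run, hval]
  by_cases hlt : k < h - L
  · rw [if_pos (by omega), follow_of_lt _ π hlt z]
    obtain ⟨h1, h2⟩ := hπ k (hlt.trans_le (Nat.sub_le h L)) (preWindow L z)
    rw [h1]
    exact couples_sampleProg e hk (hc' _) h2
  · rw [if_neg (by omega), follow_of_not_lt _ π hlt z]
    exact couples_uniform e hk (hc' _)

theorem preLaw_succ (π : P.Policy) (h : ℕ) :
    P.preLaw π (h + 1) = (P.preLaw π h).bind fun z => (π h z.1 z.2.1 z.2.2).bind fun a =>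
      (P.trans h z.2.1 a).bind fun s' => (P.emit (h + 1) s').map fun x' =>
        (P.extend z.1 z.2.1 z.2.2 a, s', x') := by
  rw [preLaw, law_succ_eq_preLaw]
  simp only [PMF.bind_bind, PMF.bind_map, Function.comp_def, nextState_extend]

/-- A step of the environment, coupled with the state and the observation that result from it. -/
theorem couples_act (e : P.LatentPolicy) {k : ℕ} (c : Config P) (j : ℕ) (i f : Expr)
    {s : Fin (P.nS k)} (henv : c.env = some ⟨k, s⟩) (hk : k + 1 < P.H) {a : Fin (P.nA k)}
    (ha : f.val c.mem = a) {Z : Type*} (F : Fin (P.nS (k + 1)) → Fin (P.nX (k + 1)) → Z) :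
    Couples ((Prog.act j i f).run P e c)
      ((P.trans k s a).bind fun s' => (P.emit (k + 1) s').map fun x' => F s' x')
      fun c' z => ∃ s' x', z = F s' x' ∧ c'.mem = c.mem.put j (i.val c.mem) (x' : ℕ) ∧
        c'.env = some ⟨k + 1, s'⟩ := by
  have hstep : envStep P (some ⟨k, s⟩) (a : ℕ) = (P.trans k s a).bind fun s' =>
      (P.emit (k + 1) s').map fun x : Fin (P.nX (k + 1)) => some (⟨k + 1, s'⟩, (x : ℕ)) := by
    have hka : k + 1 < P.H ∧ (a : ℕ) < P.nA k := ⟨hk, a.2⟩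
    refine (dif_pos hka).trans (congrArg _ (funext fun s' => ?_))
    change PMF.map _ ((P.emit (k + 1) s').bind fun x => PMF.pure (x : ℕ)) = _
    rw [PMF.map_bind, ← PMF.bind_pure_comp]
    simp only [PMF.pure_map, Function.comp_def]
  rw [Prog.run, henv, ha, hstep]
  simp only [PMF.map_bind, PMF.map_comp]
  refine (couples_refl _).bind ?_
  rintro s' - ⟨rfl, -⟩
  refine couples_map _ _ _ fun x' _ => ?_
  exact ⟨s', x', rfl, rfl, rfl⟩

theorem couples_stepProg (e : P.LatentPolicy) {h k : ℕ} {T : ℕ → ℕ} {c : Config P}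
    {z : P.Pre k} (hk : k + 1 < P.H) (hc : StepRel P L n h T c z) (π : P.Executable L h)
    (hπ : Encodes T π) :
    Couples (stepProg.run P e c)
      ((P.follow (h - L) (Nat.sub_le h L) π k z.1 z.2.1 z.2.2).bind fun a =>
        (P.trans k z.2.1 a).bind fun s' => (P.emit (k + 1) s').map fun x' =>
          (P.extend z.1 z.2.1 z.2.2 a, s', x'))
      fun c' z' => StepRel P L n h T c' z' := by
  refine (couples_chooseProg e (Nat.lt_of_succ_lt hk) hc π hπ).bind ?_
  rintro c1 a ⟨hc1, ha1⟩
  refine couples_seq_det (p := .set 6 _ _) e trivial fun c2 hm2 he2 => ?_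
  have hm2' : c2.mem = c1.mem.put 6 (k + L) a := by
    rw [hm2]
    simp only [Prog.exec, Expr.val, sc, hc1.step, hc1.base.param_L, ha1]
  have ha2 : (sc 17).val c2.mem = a := by
    simp only [Expr.val, sc, hm2']
    rw [Mem.put_of_ne _ (by norm_num), ha1]
  refine (couples_act e c2 5 _ (sc 17) (he2.trans hc1.env) hk ha2
    (fun s' x' => (P.extend z.1 z.2.1 z.2.2 a, s', x'))).bind_left ?_
  rintro c3 - ⟨s', x', rfl, hm3, he3⟩ c' hc'
  have hidx : (Expr.add (.add (sc 11) (.get 0 (.lit 2))) (.lit 1)).val c2.mem = k + L + 1 := by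
    simp only [Expr.val, sc, hm2']
    rw [Mem.put_of_ne _ (by norm_num), Mem.put_of_ne _ (by norm_num), hc1.step, hc1.base.param_L]
  rw [hidx, hm2'] at hm3
  obtain ⟨hm4, he4⟩ := Prog.run_det e (.assign 11 (.add (sc 11) (.lit 1))) trivial c3 c' hc'
  have hmem : c'.mem = ((c1.mem.put 6 (k + L) a).put 5 (k + L + 1) x').put 11 0 (k + 1) := by
    rw [hm4, hm3]
    simp only [Prog.exec, Prog.assign, Expr.val, sc]
    rw [Mem.put_of_ne _ (by norm_num), Mem.put_of_ne _ (by norm_num), hc1.step]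
  have hsame : ∀ j, j ≠ 5 → j ≠ 6 → j ≠ 11 → c'.mem j = c1.mem j := fun j h1 h2 h3 => by
    rw [hmem, Mem.put_of_ne _ h3, Mem.put_of_ne _ h1, Mem.put_of_ne _ h2]
  have h5 : ∀ i, i ≠ k + L + 1 → c'.mem 5 i = c1.mem 5 i := fun i hi => by
    rw [hmem, Mem.put_of_ne _ (by norm_num), Mem.put_of_ne_index _ _ hi,
      Mem.put_of_ne _ (by norm_num)]
  have h6 : ∀ i, c'.mem 6 i = c1.mem.put 6 (k + L) a 6 i := fun i => by
    rw [hmem, Mem.put_of_ne _ (by norm_num), Mem.put_of_ne _ (by norm_num)]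
  refine ⟨⟨?_, ?_, ?_, ?_, ?_, ?_⟩, ?_, ?_, ?_, ?_, ?_⟩
  · rw [hsame 0 (by norm_num) (by norm_num) (by norm_num), hc1.base.params]
  · rw [hsame 2 (by norm_num) (by norm_num) (by norm_num), hc1.base.actions]
  · rw [hsame 3 (by norm_num) (by norm_num) (by norm_num), hc1.base.table]
  · rw [hsame 10 (by norm_num) (by norm_num) (by norm_num), hc1.base.round]
  · intro i hi
    rw [h5 i (by omega), hc1.base.obs_zero i hi]
  · intro i hi
    rw [h6, Mem.put_of_ne_index _ _ (by omega), hc1.base.act_zero i hi]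
  · rw [hmem, Mem.put_same]
  · intro i
    refine Fin.lastCases ?_ (fun i => ?_) i
    · simp only []
      rw [extend_last, h5 _ (by simp)]
      exact hc1.last_obs
    · simp only []
      rw [extend_castSucc, h5 _ (by simp; omega)]
      exact hc1.obs i
  · rw [hmem, Mem.put_of_ne _ (by norm_num)]
    have : k + 1 + L = k + L + 1 := by ring
    rw [this, Mem.put_same]
  · intro i
    refine Fin.lastCases ?_ (fun i => ?_) i
    · simp only []
      rw [extend_last, h6]
      exact Mem.put_same _ _ _ _
    · simp only []
      rw [extend_castSucc, h6, Mem.put_of_ne_index _ _ (by simp; omega)]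
      exact hc1.act i
  · rw [he4, he3]

end POMDP

namespace POMDP

variable {P : POMDP} {L n : ℕ}

theorem preLaw_zero (f : P.Policy) : P.preLaw f 0 =
    P.init.bind fun s => (P.emit 0 s).map fun x => (fun k => k.elim0, s, x) := by
  rw [preLaw, law, PMF.pure_bind]
  rfl

theorem couples_reset (e : P.LatentPolicy) {h : ℕ} {T : ℕ → ℕ} {c : Config P}
    (hc : RoundRel P L n h T c.mem) (f : P.Policy) :
    Couples ((Prog.seq (.reset 5 (.get 0 (.lit 2))) (.assign 11 (.lit 0))).run P e c)
      (P.preLaw f 0) fun c' z => StepRel P L n h T c' z := by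
  have hreset : (Prog.reset 5 (.get 0 (.lit 2))).run P e c = P.init.bind fun s =>
      (P.emit 0 s).map fun x : Fin (P.nX 0) =>
        { (c.write 5 L (x : ℕ)).tick ((Expr.get 0 (.lit 2)).cost + 1) with
          env := some ⟨0, s⟩
          episodes := c.episodes + 1 } := by
    have hL : (Expr.get 0 (.lit 2)).val c.mem = L := hc.param_L
    rw [Prog.run, hL]
    refine congrArg _ (funext fun s => ?_)
    change PMF.map _ ((P.emit 0 s).bind fun x => PMF.pure (x : ℕ)) = _
    rw [PMF.map_bind, ← PMF.bind_pure_comp]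
    simp only [PMF.pure_map, Function.comp_def]
  rw [Prog.run, hreset, preLaw_zero, PMF.bind_bind]
  refine (couples_refl P.init).bind ?_
  rintro s - ⟨rfl, -⟩
  refine (couples_map (P.emit 0 s) _ _ (R := fun c1 z => RoundRel P L n h T c1.mem ∧
    c1.mem 5 L = z.2.2 ∧ c1.env = some ⟨0, z.2.1⟩) fun x _ =>
      ⟨?_, Mem.put_same _ _ _ _, rfl⟩).bind_left ?_
  · have hk : ∀ j, j ≠ 5 → c.mem.put 5 L x j = c.mem j := fun j hj => Mem.put_of_ne _ hj _ _
    refine ⟨?_, ?_, ?_, ?_, ?_, ?_⟩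
    · exact (hk 0 (by norm_num)).trans hc.params
    · exact (hk 2 (by norm_num)).trans hc.actions
    · exact (hk 3 (by norm_num)).trans hc.table
    · exact (congrFun (hk 10 (by norm_num)) 0).trans hc.round
    · intro i hi
      exact (Mem.put_of_ne_index _ _ hi.ne _).trans (hc.obs_zero i hi)
    · intro i hi
      exact (congrFun (hk 6 (by norm_num)) i).trans (hc.act_zero i hi)
  · rintro c1 z ⟨h1, h2, h3⟩ c' hc'
    obtain ⟨hm, he⟩ := Prog.run_det e (.assign 11 (.lit 0)) trivial c1 c' hc'
    have hm' : c'.mem = c1.mem.put 11 0 0 := hm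
    have hk : ∀ j, j ≠ 11 → c'.mem j = c1.mem j := fun j hj => by
      rw [hm', Mem.put_of_ne _ hj]
    refine ⟨⟨?_, ?_, ?_, ?_, ?_, ?_⟩, ?_, fun i => i.elim0, ?_, fun i => i.elim0, he.trans h3⟩
    · rw [hk 0 (by norm_num), h1.params]
    · rw [hk 2 (by norm_num), h1.actions]
    · rw [hk 3 (by norm_num), h1.table]
    · rw [hk 10 (by norm_num), h1.round]
    · rw [hk 5 (by norm_num)]
      exact h1.obs_zero
    · rw [hk 6 (by norm_num)]
      exact h1.act_zero
    · rw [hm', Mem.put_same]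
    · rw [hk 5 (by norm_num), zero_add, h2]

/-- The steps of an episode before the query to the expert. The loop makes `H` turns; from step `h`
on it idles. -/
theorem couples_steps (e : P.LatentPolicy) {h : ℕ} {T : ℕ → ℕ} (hh : h < P.H)
    (π : P.Executable L h) (hπ : Encodes T π) {μ : PMF (Config P)}
    (hμ : Couples μ (P.preLaw (P.follow (h - L) (Nat.sub_le h L) π) 0)
      fun c z => StepRel P L n h T c z) :
    Couples (μ.bind fun c => (Prog.loop (.get 0 (.lit 1)) (.ite (.sub (sc 10) (sc 11)) stepProg
        (.assign 14 (.lit 0)))).run P e c)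
      (P.preLaw (P.follow (h - L) (Nat.sub_le h L) π) h) fun c z => StepRel P L n h T c z := by
  set f := P.follow (h - L) (Nat.sub_le h L) π with hf
  set body := Prog.ite (.sub (sc 10) (sc 11)) stepProg (.assign 14 (.lit 0)) with hbody
  set g : Config P → PMF (Config P) := fun c => body.run P e (c.tick 1) with hg
  have htick : ∀ {k : ℕ} {c : Config P} {z : P.Pre k} (t : ℕ), StepRel P L n h T c z →
      StepRel P L n h T (c.tick t) z := fun t hc => hc.congr (fun _ _ => rfl) rfl
  have hval : ∀ {k : ℕ} {c : Config P} {z : P.Pre k}, StepRel P L n h T c z →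
      (Expr.sub (sc 10) (sc 11)).val c.mem = h - k := fun hc => by
    simp only [Expr.val, sc, hc.base.round, hc.step]
  set t₀ := (Expr.get 0 (.lit 1)).cost + 1
  have hstart : (μ.bind fun c => (Prog.loop (.get 0 (.lit 1)) body).run P e c) =
      μ.bind fun c => iter g P.H (c.tick t₀) := by
    refine bind_congr_support μ fun c hc => ?_
    obtain ⟨z, hz⟩ := hμ.exists_of_mem_support hc
    rw [Prog.run_loop]
    congr 1
    exact hz.base.param_H
  have hrun : ∀ i ≤ h, Couples (μ.bind fun c => iter g i (c.tick t₀)) (P.preLaw f i)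
      fun c z => StepRel P L n h T c z := by
    intro i hi
    induction i with
    | zero =>
      refine hμ.bind_left fun c z hc c' hc' => ?_
      rw [iter, PMF.mem_support_pure_iff] at hc'
      subst hc'
      exact htick _ hc
    | succ i ih =>
      simp only [iter_succ_right]
      rw [← PMF.bind_bind, preLaw_succ]
      refine (ih (Nat.le_of_succ_le hi)).bind fun c z hc => ?_
      rw [hg, hbody]
      simp only
      rw [Prog.run, if_pos (by rw [hval (htick 1 hc)]; omega)]
      exact couples_stepProg e (by omega) (htick _ (htick _ hc)) π hπ
  have hidle : ∀ j, Couples (μ.bind fun c => iter g (h + j) (c.tick t₀)) (P.preLaw f h)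
      fun c z => StepRel P L n h T c z := by
    intro j
    induction j with
    | zero => exact hrun h le_rfl
    | succ j ih =>
      rw [← add_assoc]
      simp only [iter_succ_right]
      rw [← PMF.bind_bind]
      refine ih.bind_left fun c z hc c' hc' => ?_
      rw [hg, hbody] at hc'
      simp only at hc'
      rw [Prog.run, if_neg (by rw [hval (htick 1 hc)]; omega)] at hc'
      obtain ⟨hm, he⟩ := Prog.run_det e (.assign 14 (.lit 0)) trivial _ c' hc'
      refine hc.congr (fun i hi => ?_) he
      rw [hm]
      exact Mem.put_of_ne _ (by omega) _ _
  rw [hstart]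
  have := hidle (P.H - h)
  rwa [Nat.add_sub_cancel' hh.le] at this

/-- The count of one sample. -/
theorem couples_count (e : P.LatentPolicy) {h : ℕ} {T : ℕ → ℕ} {c : Config P} {z : P.Pre h}
    (hc : StepRel P L n h T c z) :
    Couples ((Prog.seq (.expert 20 (.lit 0)) (.seq indexProg (.set 3 (.add (sc 13) (sc 20))
        (.add (.get 3 (.add (sc 13) (sc 20))) (.lit 1))))).run P e c)
      ((e h z.2.1).map fun y => (preWindow L z, y)) fun c' d =>
        RoundRel P L n h (fun j => T j + if tableIndex P d.1 d.2 = j then 1 else 0) c'.mem := by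
  have hexp : (Prog.expert 20 (.lit 0)).run P e c = (e h z.2.1).map fun y : Fin (P.nA h) =>
      (c.write 20 0 (y : ℕ)).tick ((Expr.lit 0).cost + 1) := by
    rw [Prog.run, hc.env]
    change PMF.map _ ((e h z.2.1).bind fun x => PMF.pure (x : ℕ)) = _
    rw [PMF.map_bind, ← PMF.bind_pure_comp]
    simp only [PMF.pure_map, Function.comp_def]
    rfl
  rw [Prog.run, hexp]
  have hquery := couples_map (e h z.2.1)
    (fun y : Fin (P.nA h) => (c.write 20 0 (y : ℕ)).tick ((Expr.lit 0).cost + 1))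
    (fun y => (preWindow L z, y))
    (R := fun c1 d => StepRel P L n h T c1 z ∧ c1.mem 20 0 = (d.2 : ℕ) ∧ d.1 = preWindow L z)
    fun y _ => ⟨hc.congr (fun j hj => Mem.put_of_ne _ (by omega) _ _) rfl,
      Mem.put_same c.mem 20 0 (y : ℕ), rfl⟩
  refine hquery.bind_left ?_
  rintro c1 ⟨w, y⟩ ⟨h1, h2, rfl⟩ c' hc'
  obtain ⟨hm, -⟩ := Prog.run_det e _ (by
    simp [indexProg, horner, mulAdd, Prog.Det, Prog.assign]) c1 c' hc'
  have hsame := (indexProg_exec c1.mem).2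
  have hidx := h1.index
  rw [Prog.exec] at hm
  set m2 := indexProg.exec c1.mem with hm2
  have h20 : m2 20 0 = y := by rw [hsame 20 (by norm_num) (by norm_num) (by norm_num), h2]
  have hT2 : m2 3 = T := by
    rw [hsame 3 (by norm_num) (by norm_num) (by norm_num), h1.base.table]
  have hm' : c'.mem = m2.put 3 (tableIndex P (preWindow L z) y)
      (T (tableIndex P (preWindow L z) y) + 1) := by
    rw [hm]
    simp only [Prog.exec, Expr.val, sc, hidx, h20, hT2, tableIndex_eq]
  have hk : ∀ j, j ≠ 3 → j < 12 → c'.mem j = c1.mem j := fun j h3 hj => by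
    rw [hm', Mem.put_of_ne _ h3, hsame j (by omega) (by omega) (by omega)]
  refine ⟨?_, ?_, ?_, ?_, ?_, ?_⟩
  · rw [hk 0 (by norm_num) (by norm_num), h1.base.params]
  · rw [hk 2 (by norm_num) (by norm_num), h1.base.actions]
  · funext j
    simp only
    split_ifs with hj
    · rw [← hj, hm', Mem.put_same]
    · rw [hm', Mem.put_of_ne_index _ _ (Ne.symm hj), hT2, add_zero]
  · rw [hk 10 (by norm_num) (by norm_num), h1.base.round]
  · rw [hk 5 (by norm_num) (by norm_num)]
    exact h1.base.obs_zero
  · rw [hk 6 (by norm_num) (by norm_num)]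
    exact h1.base.act_zero

theorem couples_episodeProg (e : P.LatentPolicy) {h : ℕ} {T : ℕ → ℕ} (hh : h < P.H)
    (π : P.Executable L h) (hπ : Encodes T π) {c : Config P} (hc : RoundRel P L n h T c.mem) :
    Couples (episodeProg.run P e c) (P.obsLaw e L h (P.follow (h - L) (Nat.sub_le h L) π))
      fun c' d => RoundRel P L n h (fun j => T j + if tableIndex P d.1 d.2 = j then 1 else 0)
        c'.mem := by
  have := (couples_steps e hh π hπ (couples_reset e hc _)).bind fun c' z hz => couples_count e hz
  rw [obsLaw]
  convert this using 1
  rw [PMF.bind_bind, Prog.run, PMF.bind_bind]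
  rfl

/-! ### Simulation of rounds -/

theorem Encodes.congr {T T' : ℕ → ℕ} {h : ℕ} (hh : h ≤ P.H) {π : P.Executable L h}
    (hπ : Encodes T π)
    (hT : ∀ k < h, ∀ (w : P.Window L k) (a : ℕ), a < P.maxA →
      T' (tableIndex P w a) = T (tableIndex P w a)) : Encodes T' π := by
  intro k hk w
  obtain ⟨h1, h2⟩ := hπ k hk w
  refine ⟨?_, fun a ha ha' => by rw [hT k hk w a ha', h2 a ha ha']⟩
  rw [h1]
  congr 1
  funext a
  rw [hT k hk w a (a.2.trans_le (nA_le_maxA (hk.trans_le hh)))]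

/-- The sampling loop of a round. The table changes during the loop, but only in the entries for step
`h`, so it encodes the roll-in policy all the time. -/
theorem couples_samples (e : P.LatentPolicy) {h : ℕ} {T : ℕ → ℕ} (hh : h < P.H)
    (π : P.Executable L h) (hπ : Encodes T π) (N : ℕ) {c : Config P}
    (hc : RoundRel P L n h T c.mem) :
    Couples (iter (fun c' => episodeProg.run P e (c'.tick 1)) N c)
      (iid (P.obsLaw e L h (P.follow (h - L) (Nat.sub_le h L) π)) N)
      fun c' D => RoundRel P L n h
        (fun j => T j + tally (fun i => tableIndex P (D i).1 (D i).2) j) c'.mem := by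
  induction N generalizing T c with
  | zero =>
    refine couples_pure_right _ _ fun c' hc' => ?_
    rw [iter, PMF.mem_support_pure_iff] at hc'
    subst hc'
    simpa [tally] using hc
  | succ N ih =>
    rw [iter, iid]
    refine (couples_episodeProg e hh π hπ (c := c.tick 1) hc).bind ?_
    rintro c1 d hc1
    have hπ' : Encodes (fun j => T j + if tableIndex P d.1 d.2 = j then 1 else 0) π := by
      refine hπ.congr hh.le fun k hk w a ha => ?_
      rw [if_neg, add_zero]
      intro heq
      have := (tableIndex_inj hh (hk.trans hh) (d.2.2.trans_le (nA_le_maxA hh)) ha heq).1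
      omega
    have h2 := ih hπ' hc1
    rw [← PMF.bind_pure (iter _ N c1), ← PMF.bind_pure_comp]
    refine h2.bind fun c2 D hc2 => couples_pure_right _ _ fun c' hc' => ?_
    rw [PMF.mem_support_pure_iff] at hc'
    subst hc'
    convert hc2 using 2
    rw [tally, Fin.sum_univ_succ, tally, add_assoc]
    simp only [Fin.cons_zero, Fin.cons_succ]
    congr!

/-- The learner that plays the conditional action frequencies of its samples. -/
def empiricalRule (P : POMDP) (L n : ℕ) : P.Rule L n := fun h hh _ D =>
  PMF.pure (empirical (P.nA_pos h) fun i => visible L hh (D i))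

theorem isArgmaxRule_empiricalRule : P.IsArgmaxRule (empiricalRule P L n) := by
  intro h hh π D q hq q'
  rw [empiricalRule, PMF.mem_support_pure_iff] at hq
  subst hq
  exact P.logLik_le_of_prod_le hh D q' _ (prod_le_prod_empirical _ _ _)

theorem forward_empiricalRule_succ (e : P.LatentPolicy) {h : ℕ} (hh : h + 1 ≤ P.H) :
    P.forward e (empiricalRule P L n) (h + 1) hh =
      (P.forward e (empiricalRule P L n) h (Nat.le_of_succ_le hh)).bind fun π =>
        (iid (P.obsLaw e L h (P.follow (h - L) (Nat.sub_le h L) π)) n).map fun D =>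
          Fin.snoc (α := fun k : Fin (h + 1) => P.StepPolicy L k) π
            (empirical (P.nA_pos h) D) := by
  rw [forward]
  refine congrArg _ (funext fun π => ?_)
  rw [← map_visible_sampleLaw e hh π, ← map_iid, PMF.map_comp, ← PMF.bind_pure_comp]
  refine congrArg _ (funext fun D => ?_)
  rw [empiricalRule, PMF.pure_map]
  rfl

/-- The main loop. The entries for the steps to come are still zero, so that the samples of a round
alone determine the weights of its step. -/
theorem couples_rounds (e : P.LatentPolicy) (h : ℕ) (hh : h ≤ P.H) {c : Config P}
    (hc : RoundRel P L n 0 (fun _ => 0) c.mem) :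
    Couples (iter (fun c' => (Prog.seq (.loop (.get 0 (.lit 0)) episodeProg)
        (.assign 10 (.add (sc 10) (.lit 1)))).run P e (c'.tick 1)) h c)
      (P.forward e (empiricalRule P L n) h hh) fun c' π => ∃ T, RoundRel P L n h T c'.mem ∧
        Encodes T π ∧ ∀ k, h ≤ k → k < P.H → ∀ (w : P.Window L k) (a : ℕ), a < P.maxA →
          T (tableIndex P w a) = 0 := by
  induction h with
  | zero =>
    refine couples_pure_right _ _ fun c' hc' => ?_
    rw [iter, PMF.mem_support_pure_iff] at hc'
    subst hc'
    exact ⟨_, hc, fun k hk => absurd hk (Nat.not_lt_zero k), fun _ _ _ _ _ _ => rfl⟩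
  | succ h ih =>
    rw [iter_succ_right, forward_empiricalRule_succ]
    refine (ih (Nat.le_of_succ_le hh)).bind ?_
    rintro c1 π ⟨T, hc1, hπ, hfresh⟩
    rw [Prog.run, Prog.run_loop]
    have hval : (Expr.get 0 (.lit 0)).val (c1.tick 1).mem = n := hc1.param_n
    rw [hval, ← PMF.bind_pure_comp]
    refine (couples_samples e hh π hπ n (c := (c1.tick 1).tick _) hc1).bind ?_
    intro c2 D hc2
    refine couples_pure_right _ _ fun c' hc' => ?_
    obtain ⟨hm, -⟩ := Prog.run_det e _ (by simp [Prog.Det, Prog.assign]) c2 c' hc'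
    have hm' : c'.mem = c2.mem.put 10 0 (h + 1) := by
      rw [hm]
      simp only [Prog.assign, Prog.exec, Expr.val, sc, hc2.round]
    have hk : ∀ j, j ≠ 10 → c'.mem j = c2.mem j := fun j hj => by rw [hm', Mem.put_of_ne _ hj]
    -- the table entries for step `h` count the samples of this round, all others are unchanged
    have hother : ∀ k, k ≠ h → k < P.H → ∀ (w : P.Window L k) (a : ℕ), a < P.maxA →
        tally (fun i => tableIndex P (D i).1 (D i).2) (tableIndex P w a) = 0 := by
      intro k hkh hkH w a ha
      refine Finset.sum_eq_zero fun i _ => if_neg fun heq => hkh ?_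
      exact (tableIndex_inj hh hkH ((D i).2.2.trans_le (nA_le_maxA hh)) ha heq).1.symm
    have hsame : ∀ (w : P.Window L h) (a : ℕ), a < P.maxA →
        tally (fun i => tableIndex P (D i).1 (D i).2) (tableIndex P w a) =
          ∑ i, if (D i).1 = w ∧ ((D i).2 : ℕ) = a then 1 else 0 := by
      intro w a ha
      unfold tally
      refine Finset.sum_congr rfl fun i _ => ?_
      congr 1
      refine propext ⟨fun heq => ?_, ?_⟩
      · obtain ⟨-, h1, h2⟩ :=
          tableIndex_inj hh hh ((D i).2.2.trans_le (nA_le_maxA hh)) ha heq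
        exact ⟨eq_of_heq h1, h2⟩
      · rintro ⟨rfl, rfl⟩
        rfl
    refine ⟨fun j => T j + tally (fun i => tableIndex P (D i).1 (D i).2) j,
      ⟨?_, ?_, ?_, ?_, ?_, ?_⟩, ?_, ?_⟩
    · rw [hk 0 (by norm_num), hc2.params]
    · rw [hk 2 (by norm_num), hc2.actions]
    · rw [hk 3 (by norm_num), hc2.table]
    · rw [hm', Mem.put_same]
    · rw [hk 5 (by norm_num)]
      exact hc2.obs_zero
    · rw [hk 6 (by norm_num)]
      exact hc2.act_zero
    · intro k hk' w
      rcases (Nat.lt_succ_iff.1 hk').lt_or_eq with hlt | rfl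
      · have hold : Encodes (fun j => T j + tally (fun i => tableIndex P (D i).1 (D i).2) j) π :=
          hπ.congr (Nat.le_of_succ_le hh) fun k hk w a ha => by
            rw [hother k hk.ne (hk.trans hh) w a ha, add_zero]
        have := hold k hlt w
        have e1 : Fin.snoc (α := fun k : Fin (h + 1) => P.StepPolicy L k) π
            (empirical (P.nA_pos h) D) ⟨k, hk'⟩ = π ⟨k, hlt⟩ :=
          Fin.snoc_castSucc (α := fun k : Fin (h + 1) => P.StepPolicy L k) _ _ ⟨k, hlt⟩
        exact ⟨(congrFun e1 w).trans this.1, this.2⟩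
      · have e1 : Fin.snoc (α := fun k : Fin (k + 1) => P.StepPolicy L k) π
            (empirical (P.nA_pos k) D) ⟨k, hk'⟩ = empirical (P.nA_pos k) D :=
          Fin.snoc_last (α := fun k : Fin (k + 1) => P.StepPolicy L k) _ _
        refine ⟨(congrFun e1 w).trans ?_, fun a ha ha' => ?_⟩
        · rw [empirical]
          congr 1
          funext a
          have ha := a.2.trans_le (nA_le_maxA (P := P) hh)
          simp only
          rw [hfresh k le_rfl hh w a ha, zero_add, hsame w a ha, tally]
          refine Finset.sum_congr rfl fun i _ => ?_
          congr 1
          rw [Prod.ext_iff, Fin.ext_iff]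
        · simp only
          rw [hfresh k le_rfl hh w a ha', zero_add, hsame w a ha']
          refine Finset.sum_eq_zero fun i _ => if_neg fun h' => ?_
          have := (D i).2.2
          omega
    · intro k hk' hkH w a ha
      simp only
      rw [hfresh k (Nat.le_of_succ_le hk') hkH w a ha, hother k (by omega) hkH w a ha]

theorem map_outputPolicy_forwardProg (e : P.LatentPolicy) :
    (forwardProg.run P e (Config.start P L n)).map (fun c => outputPolicy P L c.mem) =
      P.forward e (empiricalRule P L n) P.H le_rfl := by
  have hstart : ∀ t, RoundRel P L n 0 (fun _ => 0) ((Config.start P L n).tick t).mem := fun _ =>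
    ⟨rfl, rfl, rfl, rfl, fun _ _ => rfl, fun _ _ => rfl⟩
  rw [forwardProg, Prog.run_loop]
  have hval : (Expr.get 0 (.lit 1)).val (Config.start P L n).mem = P.H := (hstart 0).param_H
  rw [hval]
  refine Couples.map_eq ((couples_rounds e P.H le_rfl (hstart _)).mono ?_)
  rintro c π ⟨T, hc, hπ, -⟩
  funext k w
  rw [outputPolicy, hc.table]
  exact ((hπ k k.2 w).1).symm

theorem forwardProg_time_episodes (e : P.LatentPolicy) (hL : 1 ≤ L) (hLH : L ≤ P.H)
    (c : Config P) (hc : c ∈ (forwardProg.run P e (Config.start P L n)).support) :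
    c.episodes = P.H * n ∧
      c.time ≤ MvPolynomial.eval ![n, P.H, P.maxX ^ L, P.maxA ^ L] forwardProg.timePoly := by
  have hv : ∀ j, (Config.start P L n).mem 0 j ≤
      MvPolynomial.eval ![n, P.H, P.maxX ^ L, P.maxA ^ L] (Prog.paramVar j) := by
    intro j
    -- `L` is bounded by `H`, and `X` and `A` by their `L`-th powers
    match j with
    | 0 => simp [Prog.paramVar, Config.start]
    | 1 => simp [Prog.paramVar, Config.start]
    | 2 => simpa [Prog.paramVar, Config.start] using hLH
    | 3 => simpa [Prog.paramVar, Config.start] using Nat.le_self_pow (by omega) P.maxX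
    | 4 => simpa [Prog.paramVar, Config.start] using Nat.le_self_pow (by omega) P.maxA
    | j + 5 => simp [Prog.paramVar, Config.start]
  obtain ⟨-, h2, h3⟩ := Prog.run_time_episodes e hv forwardProg
    (by simp [forwardProg, episodeProg, stepProg, chooseProg, sampleProg, findProg, sumProg,
      indexProg, horner, mulAdd, Prog.assign, Prog.Safe, Prog.loopParam])
    (by simp [forwardProg, episodeProg, stepProg, chooseProg, sampleProg, findProg, sumProg,
      indexProg, horner, mulAdd, Prog.assign, Prog.Balanced, Prog.resets])
    (Config.start P L n) rfl c hc
  refine ⟨?_, by simpa [Config.start] using h2⟩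
  rw [h3]
  simp [forwardProg, episodeProg, stepProg, chooseProg, sampleProg, findProg, sumProg,
      indexProg, horner, mulAdd, Prog.assign, Prog.resets, Prog.loopParam, Config.start]

end POMDP

end PerturbedBlock

end

theorem mainTheorem7 :
    (∃ C₀ > (0 : ℝ), ∃ C₁ > (1 : ℝ), ∃ K > (0 : ℝ),
      ∀ (P : PerturbedBlock.POMDP) (e : P.LatentPolicy) (L n : ℕ) (δ η ε : ℝ),
        P.NormalizedRewards → 1 ≤ L → L ≤ P.H → 2 ≤ P.H * n → 0 < δ → 0 < η → 0 < ε →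
        P.IsPerturbedBlock δ → P.DeterministicTransitions →
        C₀ * (P.maxX : ℝ) ^ L * (P.maxA : ℝ) ^ (3 * L + 1) * (P.H : ℝ) ^ 2 * (ε ^ 2)⁻¹
          * Real.log ((P.H : ℝ) * (n : ℝ) / η) ≤ (n : ℝ) →
        ∀ sel : P.Rule L n, P.IsArgmaxRule sel →
          ENNReal.ofReal (1 - η) ≤ (P.forward e sel P.H le_rfl).toOuterMeasure
            {π | P.value (P.ofLatent e) - P.value (P.ofExecutable π)
                  ≤ P.tv (P.ofLatent e) (P.ofExecutable π) ∧
                P.tv (P.ofLatent e) (P.ofExecutable π)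
                  ≤ K * δ + (C₁ * δ) ^ ((L : ℝ) / 9) * (P.maxS : ℝ) * (P.H : ℝ) + ε}) ∧
    (∃ (prog : PerturbedBlock.Prog) (poly : MvPolynomial (Fin 4) ℕ),
      ∀ (P : PerturbedBlock.POMDP) (e : P.LatentPolicy) (L n : ℕ),
        1 ≤ L → L ≤ P.H → 1 ≤ n →
        ∃ sel : P.Rule L n, P.IsArgmaxRule sel ∧
          (prog.run P e (PerturbedBlock.Config.start P L n)).map
              (fun c => PerturbedBlock.outputPolicy P L c.mem) = P.forward e sel P.H le_rfl ∧
          ∀ c ∈ (prog.run P e (PerturbedBlock.Config.start P L n)).support,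
            c.episodes = P.H * n ∧
            c.time ≤ MvPolynomial.eval ![n, P.H, P.maxX ^ L, P.maxA ^ L] poly) := by
  refine ⟨⟨16, by norm_num, 4, by norm_num, 32, by norm_num, ?_⟩,
    ⟨PerturbedBlock.forwardProg, PerturbedBlock.forwardProg.timePoly, ?_⟩⟩
  · intro P e L n δ η ε hR hL _ hHn hδ hη hε hP hD hsize sel hsel
    exact PerturbedBlock.POMDP.value_and_tv_bound P e L n δ η ε hR hL hHn hδ hη hε hP hD hsize
      sel hsel
  · intro P e L n hL hLH _
    exact ⟨P.empiricalRule L n, PerturbedBlock.POMDP.isArgmaxRule_empiricalRule,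
      PerturbedBlock.POMDP.map_outputPolicy_forwardProg e,
      PerturbedBlock.POMDP.forwardProg_time_episodes e hL hLH⟩
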